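/- Let $S$ be a noetherian scheme. By a group scheme over $S$ we mean a flat, affine group scheme of finite type over $S$; for such a $G$ let $\mathcal{O}_S[G]$ denote the corresponding quasi-coherent Hopf algebra over $\mathcal{O}_S$, with comultiplication $\mu_G$. A $G$-equivariant quasi-coherent $\mathcal{O}_S$-module is a quasi-coherent $\mathcal{O}_S$-module $\mathcal{F}$ with a counital and coassociative $\mathcal{O}_S$-linear coaction $\mu_{\mathcal{F}}\colon \mathcal{F} \to \mathcal{O}_S[G]\otimes_{\mathcal{O}_S}\mathcal{F}$. A $G$-equivariant vector bundle $V \to S$ is a vector bundle (of finite rank) whose sheaf of sections is equipped with a $G$-equivariant structure. The group scheme $G$ is called linearly reductive if the inclusion $\mathcal{O}_S \to \mathcal{O}_S[G]$ has an $\mathcal{O}_S$-linear retraction which is $G$-equivariant (for the coaction $\mu_G$ on $\mathcal{O}_S[G]$ and the trivial coaction on $\mathcal{O}_S$); it has the resolution property if every $G$-equivariant coherent $\mathcal{O}_S$-module is a $G$-equivariant quotient of a $G$-equivariant locally free $\mathcal{O}_S$-module of finite rank. Let $f\colon T\to S$ be a quasi-affine morphism, where $T$ is an affine noetherian scheme.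 Let $G$ be a group scheme over $S$ which is linearly reductive and has the resolution property. Let $C\subset G$ be a closed normal subgroup scheme, flat over $S$, which is linearly reductive and such that the $\mathcal{O}_S$-module $\mathcal{O}_S[C]$ is locally projective (that is, its sections over every affine open $U \subset S$ form a projective $\mathcal{O}_S(U)$-module). Let $X$ be an affine noetherian $T$-scheme with an action of $G$ over $T$, that is, an action $G\times_S X\to X$ which is a morphism of $T$-schemes, $T$ carrying the trivial action. Then there exist a $G$-equivariant vector bundle $V\to S$ such that $V^C=0$, and a $G$-equivariant section $s$ of the pullback of $V$ to $X$, whose zero locus is the fixed locus: $Z_X(s) = X^C$ as closed subschemes of $X$. Here $V^C=0$ means that the sheaf of sections $\mathcal{E}$ of $V$ satisfies $\mathcal{E}^C = \ker\big(1\otimes \mathrm{id} - \mu_{\mathcal{E}}\colon \mathcal{E}\to \mathcal{O}_S[C]\otimes_{\mathcal{O}_S}\mathcal{E}\big) = 0$ and, more precisely, that the zero section is the only $C$-fixed point of $V$ over every $S$-scheme. The fixed locus $X^C \subset X$ is the closed subscheme such that a morphism of $S$-schemes $Y \to X$ factors through $X^C$ if and only if it is $C$-equivariant for the trivial $C$-action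 on $Y$. The zero locus $Z_X(s)$ is the closed subscheme of $X$ whose ideal is generated by the elements $\varphi(s)$, where $\varphi$ runs over the linear forms on the $\mathcal{O}(X)$-module of sections over $X$ of the pullback of $V$. -/

import Mathlib

open CategoryTheory MonoidalCategory CartesianMonoidalCategory AlgebraicGeometry TopologicalSpace
open scoped TensorProduct MonObj

universe u

noncomputable section

namespace GeomConc

variable {S : Scheme.{u}}

/-! ### Functions on `S`-schemes -/

/-- For an `S`-scheme `Y`, an open `U ⊆ S` and an open `W ⊆ Y` lying over `U`, the ring
`Γ(Y, W)`, regarded as an algebra over `Γ(S, U)`. -/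
def Sec (Y : Over S) (U : S.Opens) (W : Y.left.Opens) (_h : W ≤ Y.hom ⁻¹ᵁ U) : Type u :=
  Γ(Y.left, W)

instance (Y : Over S) (U : S.Opens) (W : Y.left.Opens) (h : W ≤ Y.hom ⁻¹ᵁ U) :
    CommRing (Sec Y U W h) :=
  inferInstanceAs (CommRing Γ(Y.left, W))

instance (Y : Over S) (U : S.Opens) (W : Y.left.Opens) (h : W ≤ Y.hom ⁻¹ᵁ U) :
    Algebra Γ(S, U) (Sec Y U W h) :=
  RingHom.toAlgebra (S := Sec Y U W h) (Y.hom.appLE U W h).hom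

/-- `Coord Y U` is `Γ(Y, π⁻¹ U)` with `π : Y ⟶ S` the structure morphism, as a `Γ(S, U)`-algebra.
For `π` affine this is the value at `U` of the quasi-coherent algebra `𝒪_S[Y]`. -/
abbrev Coord (Y : Over S) (U : S.Opens) : Type u := Sec Y U (Y.hom ⁻¹ᵁ U) le_rfl

lemma le_of_over {Y Z : Over S} (h : Y ⟶ Z) {U : S.Opens} {W : Z.left.Opens}
    (hW : W ≤ Z.hom ⁻¹ᵁ U) {V : Y.left.Opens} (hVW : V ≤ h.left ⁻¹ᵁ W) : V ≤ Y.hom ⁻¹ᵁ U := by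
  intro y hy
  have h1 : Z.hom (h.left y) ∈ U := hW (hVW hy)
  have h2 : Y.hom y = Z.hom (h.left y) := by
    rw [← Over.w h]; rfl
  change Y.hom y ∈ U
  rw [h2]
  exact h1

lemma preimage_le {Y Z : Over S} (h : Y ⟶ Z) (U : S.Opens) :
    Y.hom ⁻¹ᵁ U ≤ h.left ⁻¹ᵁ (Z.hom ⁻¹ᵁ U) := by
  intro y hy
  have h2 : Y.hom y = Z.hom (h.left y) := by
    rw [← Over.w h]; rfl
  change Z.hom (h.left y) ∈ U
  rw [← h2]
  exact hy

/-- Pull-back of functions along a morphism of `S`-schemes. -/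
def pull {Y Z : Over S} (h : Y ⟶ Z) (U : S.Opens) {W : Z.left.Opens} {V : Y.left.Opens}
    (hW : W ≤ Z.hom ⁻¹ᵁ U) (hV : V ≤ Y.hom ⁻¹ᵁ U) (hVW : V ≤ h.left ⁻¹ᵁ W) :
    Sec Z U W hW →ₐ[Γ(S, U)] Sec Y U V hV where
  toRingHom := (h.left.appLE W V hVW).hom
  commutes' r := by
    change (Z.hom.appLE U W hW ≫ h.left.appLE W V hVW).hom r = (Y.hom.appLE U V hV).hom r
    rw [Scheme.Hom.appLE_comp_appLE]
    simp only [Over.w]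

/-- Pull-back `𝒪_S[Z](U) → 𝒪_S[Y](U)` along a morphism of `S`-schemes. -/
abbrev pullCoord {Y Z : Over S} (h : Y ⟶ Z) (U : S.Opens) :
    Coord Z U →ₐ[Γ(S, U)] Coord Y U :=
  pull h U le_rfl le_rfl (preimage_le h U)

/-- Restriction of functions on `Y` from `π⁻¹ U` to `π⁻¹ V`. -/
def coordRes (Y : Over S) {U V : S.Opens} (h : V ≤ U) :
    Coord Y U →ₛₗ[(S.presheaf.map (homOfLE h).op).hom] Coord Y V where
  toFun := (Y.left.presheaf.map (homOfLE (Y.hom.preimage_mono h)).op).hom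
  map_add' := map_add _
  map_smul' r x := by
    simp only [Algebra.smul_def]
    refine (map_mul (Y.left.presheaf.map (homOfLE (Y.hom.preimage_mono h)).op).hom _ _).trans ?_
    congr 1
    change (Y.hom.appLE U _ le_rfl ≫ Y.left.presheaf.map _).hom r =
      (S.presheaf.map _ ≫ Y.hom.appLE V _ le_rfl).hom r
    rw [Scheme.Hom.appLE_map, Scheme.Hom.map_appLE]

/-- Restriction of sections of a sheaf of modules. -/
def secRes (F : S.Modules) {U V : S.Opens} (h : V ≤ U) :
    Γ(F, U) →ₛₗ[(S.presheaf.map (homOfLE h).op).hom] Γ(F, V) where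
  toFun := F.presheaf.map (homOfLE h).op
  map_add' := map_add _
  map_smul' r x := F.map_smul (homOfLE h) r x

/-- The map on sections induced by a morphism of sheaves of modules, as a linear map. -/
def homSec {E F : S.Modules} (φ : E ⟶ F) (U : S.Opens) : Γ(E, U) →ₗ[Γ(S, U)] Γ(F, U) where
  toFun := φ.app U
  map_add' := map_add _
  map_smul' := φ.app_smul

/-! ### The Hopf algebra structure of `𝒪_S[G]` -/

/-- For affine `S`-schemes `Y`, `Z` and `U` affine, the canonical map
`𝒪_S[Y](U) ⊗ 𝒪_S[Z](U) → 𝒪_S[Y ×_S Z](U)` is an isomorphism. -/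
lemma productMap_bijective (Y Z : Over S) [IsAffineHom Y.hom] [IsAffineHom Z.hom]
    (U : S.affineOpens) :
    Function.Bijective (Algebra.TensorProduct.productMap
      (pullCoord (fst Y Z) U.1) (pullCoord (snd Y Z) U.1)) := by
  have H : IsPullback (fst Y Z).left (snd Y Z).left Y.hom Z.hom :=
    IsPullback.of_hasPullback Y.hom Z.hom
  have e1 : (Y ⊗ Z).hom ⁻¹ᵁ U.1 = (fst Y Z).left ⁻¹ᵁ (Y.hom ⁻¹ᵁ U.1) ⊓
      (snd Y Z).left ⁻¹ᵁ (Z.hom ⁻¹ᵁ U.1) :=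
    le_antisymm (le_inf (preimage_le _ _) (preimage_le _ _))
      (inf_le_left.trans (le_of_over (fst Y Z) le_rfl le_rfl))
  have h1 := (isIso_pushoutSection_iff H (US := U.1) le_rfl le_rfl e1).mp
    (isIso_pushoutSection_of_isAffineOpen H le_rfl le_rfl e1 U.2
      (U.2.preimage Z.hom) (U.2.preimage Y.hom))
  have h2 := CommRingCat.isPushout_tensorProduct Γ(S, U.1) (Coord Y U.1) (Coord Z U.1)
  let φ : CommRingCat.of (Coord Y U.1 ⊗[Γ(S, U.1)] Coord Z U.1) ⟶
      CommRingCat.of (Coord (Y ⊗ Z) U.1) :=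
    CommRingCat.ofHom (Algebra.TensorProduct.productMap
      (pullCoord (fst Y Z) U.1) (pullCoord (snd Y Z) U.1)).toRingHom
  have hφ : φ = (h2.isoIsPushout _ _ h1).hom := by
    apply h2.hom_ext
    · refine Eq.trans ?_ (h2.inl_isoIsPushout_hom _ _ h1).symm
      ext x
      change Algebra.TensorProduct.productMap (pullCoord (fst Y Z) U.1) (pullCoord (snd Y Z) U.1)
        (x ⊗ₜ 1) = pullCoord (fst Y Z) U.1 x
      simp
    · refine Eq.trans ?_ (h2.inr_isoIsPushout_hom _ _ h1).symm
      ext x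
      change Algebra.TensorProduct.productMap (pullCoord (fst Y Z) U.1) (pullCoord (snd Y Z) U.1)
        (1 ⊗ₜ x) = pullCoord (snd Y Z) U.1 x
      simp
  have hiso : IsIso φ := by rw [hφ]; exact Iso.isIso_hom _
  exact ConcreteCategory.bijective_of_isIso φ

/-- The isomorphism `𝒪_S[Y](U) ⊗ 𝒪_S[Z](U) ≃ 𝒪_S[Y ×_S Z](U)`. -/
def coordProd (Y Z : Over S) [IsAffineHom Y.hom] [IsAffineHom Z.hom] (U : S.affineOpens) :
    Coord Y U.1 ⊗[Γ(S, U.1)] Coord Z U.1 ≃ₐ[Γ(S, U.1)] Coord (Y ⊗ Z) U.1 :=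
  AlgEquiv.ofBijective _ (productMap_bijective Y Z U)

section Group

variable (G : Over S) [GrpObj G]

/-- The comultiplication `μ_G : 𝒪_S[G] → 𝒪_S[G] ⊗ 𝒪_S[G]` over an affine open. -/
def comul [IsAffineHom G.hom] (U : S.affineOpens) :
    Coord G U.1 →ₐ[Γ(S, U.1)] Coord G U.1 ⊗[Γ(S, U.1)] Coord G U.1 :=
  (coordProd G G U).symm.toAlgHom.comp (pullCoord (μ[G] : G ⊗ G ⟶ G) U.1)

/-- The unit section `S ⟶ G`. -/
def unitSection : S ⟶ G.left := (η[G] : 𝟙_ (Over S) ⟶ G).left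

lemma unitSection_comp : unitSection G ≫ G.hom = 𝟙 S := Over.w (η[G] : 𝟙_ (Over S) ⟶ G)

lemma le_unitSection (U : S.Opens) : U ≤ unitSection G ⁻¹ᵁ (G.hom ⁻¹ᵁ U) := by
  rw [← Scheme.Hom.comp_preimage, unitSection_comp]
  exact le_rfl

/-- The counit `ε : 𝒪_S[G] → 𝒪_S`, i.e. restriction of functions along the unit section. -/
def counit (U : S.Opens) : Coord G U →ₐ[Γ(S, U)] Γ(S, U) where
  toRingHom := ((unitSection G).appLE (G.hom ⁻¹ᵁ U) U (le_unitSection G U)).hom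
  commutes' r := by
    change (G.hom.appLE U _ le_rfl ≫ (unitSection G).appLE _ _ _).hom r = r
    rw [Scheme.Hom.appLE_comp_appLE]
    simp only [unitSection_comp]
    have h : (𝟙 S : S ⟶ S).appLE U U le_rfl = 𝟙 _ :=
      (Scheme.Hom.appLE_eq_app (𝟙 S : S ⟶ S) (U := U)).trans (by simp; rfl)
    exact congrArg (fun f : Γ(S, U) ⟶ Γ(S, U) => f.hom r) h

/-- `G` is linearly reductive: the inclusion `𝒪_S → 𝒪_S[G]` has an `𝒪_S`-linear retraction `ρ`
which is `G`-equivariant, for the coaction `μ_G` on `𝒪_S[G]` and the trivial coaction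
`r ↦ 1 ⊗ r` on `𝒪_S`. A morphism of quasi-coherent sheaves is given by its values on affine
opens. -/
def IsLinearlyReductive [IsAffineHom G.hom] : Prop :=
  ∃ ρ : ∀ U : S.affineOpens, Coord G U.1 →ₗ[Γ(S, U.1)] Γ(S, U.1),
    (∀ (U V : S.affineOpens) (h : V.1 ≤ U.1) (a : Coord G U.1),
      ρ V (coordRes G h a) = S.presheaf.map (homOfLE h).op (ρ U a)) ∧
    (∀ (U : S.affineOpens) (r : Γ(S, U.1)), ρ U (algebraMap Γ(S, U.1) (Coord G U.1) r) = r) ∧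
    (∀ (U : S.affineOpens) (a : Coord G U.1),
      (ρ U).lTensor (Coord G U.1) (comul G U a) = (1 : Coord G U.1) ⊗ₜ[Γ(S, U.1)] ρ U a)

/-- `𝒪_S[G]` is locally projective. -/
def IsLocallyProjective : Prop :=
  ∀ U : S.affineOpens, Module.Projective Γ(S, U.1) (Coord G U.1)

/-! ### Equivariant quasi-coherent modules -/

/-- A `G`-equivariant quasi-coherent `𝒪_S`-module: a quasi-coherent sheaf `F` with a counital and
coassociative coaction `F → 𝒪_S[G] ⊗ F`. As `F` and `𝒪_S[G]` are quasi-coherent, the sections of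
`𝒪_S[G] ⊗ F` over an affine open `U` are `𝒪_S[G](U) ⊗ F(U)`, so that the coaction is a family of
linear maps indexed by the affine opens and compatible with restrictions. -/
structure EquivModule [IsAffineHom G.hom] where
  /-- the underlying sheaf of modules -/
  sheaf : S.Modules
  isQuasicoherent : sheaf.IsQuasicoherent
  /-- the coaction -/
  coact (U : S.affineOpens) :
    Γ(sheaf, U.1) →ₗ[Γ(S, U.1)] Coord G U.1 ⊗[Γ(S, U.1)] Γ(sheaf, U.1)
  coact_res (U V : S.affineOpens) (h : V.1 ≤ U.1) (x : Γ(sheaf, U.1)) :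
    coact V (secRes sheaf h x) =
      TensorProduct.map (coordRes G h) (secRes sheaf h) (coact U x)
  counit_coact (U : S.affineOpens) (x : Γ(sheaf, U.1)) :
    TensorProduct.lid Γ(S, U.1) Γ(sheaf, U.1)
      ((counit G U.1).toLinearMap.rTensor Γ(sheaf, U.1) (coact U x)) = x
  coassoc (U : S.affineOpens) (x : Γ(sheaf, U.1)) :
    (coact U).lTensor (Coord G U.1) (coact U x) =
      TensorProduct.assoc Γ(S, U.1) (Coord G U.1) (Coord G U.1) Γ(sheaf, U.1)
        ((comul G U).toLinearMap.rTensor Γ(sheaf, U.1) (coact U x))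

end Group

namespace EquivModule

variable {G : Over S} [GrpObj G] [IsAffineHom G.hom]

/-- A morphism of `𝒪_S`-modules is `G`-equivariant if it commutes with the coactions. -/
def IsEquivariantHom (E F : EquivModule G) (φ : E.sheaf ⟶ F.sheaf) : Prop :=
  ∀ (U : S.affineOpens) (x : Γ(E.sheaf, U.1)),
    F.coact U (homSec φ U.1 x) = (homSec φ U.1).lTensor (Coord G U.1) (E.coact U x)

/-- Coherence over a noetherian base: finitely generated sections on affine opens. -/
def IsCoherent (F : EquivModule G) : Prop :=
  ∀ U : S.affineOpens, Module.Finite Γ(S, U.1) Γ(F.sheaf, U.1)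

/-- The underlying (quasi-coherent) sheaf is locally free of finite rank, i.e. it is the sheaf of
sections of a vector bundle. -/
def IsVectorBundle (E : EquivModule G) : Prop :=
  ∀ x : S, ∃ U : S.affineOpens, x ∈ U.1 ∧
    Module.Free Γ(S, U.1) Γ(E.sheaf, U.1) ∧ Module.Finite Γ(S, U.1) Γ(E.sheaf, U.1)

/-- The coaction of `C` on `E` obtained by restriction along `i : C ⟶ G`. -/
def coactVia (E : EquivModule G) {C : Over S} (i : C ⟶ G) (U : S.affineOpens) :
    Γ(E.sheaf, U.1) →ₗ[Γ(S, U.1)] Coord C U.1 ⊗[Γ(S, U.1)] Γ(E.sheaf, U.1) :=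
  (pullCoord i U.1).toLinearMap.rTensor Γ(E.sheaf, U.1) ∘ₗ E.coact U

/-- The fixed subsheaf `E^C` (over an affine open): the kernel of `x ↦ 1 ⊗ x - coaction x`. -/
def fixedSections (E : EquivModule G) {C : Over S} (i : C ⟶ G) (U : S.affineOpens) :
    Submodule Γ(S, U.1) Γ(E.sheaf, U.1) :=
  LinearMap.ker
    (TensorProduct.mk Γ(S, U.1) (Coord C U.1) Γ(E.sheaf, U.1) 1 - E.coactVia i U)

/-- The only `C`-fixed points of the vector bundle `V` with sheaf of sections `E` are the zeros:
for `U ⊆ S` affine and every `Γ(S, U)`-algebra `R`, the points of `V` with values in `Spec R` are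
the elements of `R ⊗ E(U)`, and such a point is `C`-fixed if the coaction of `C` (extended
`R`-linearly) maps it to `1 ⊗` itself. -/
def FixedLocusIsZero (E : EquivModule G) {C : Over S} (i : C ⟶ G) : Prop :=
  ∀ (U : S.affineOpens) (R : Type u) [CommRing R] [Algebra Γ(S, U.1) R]
    (x : R ⊗[Γ(S, U.1)] Γ(E.sheaf, U.1)),
    (E.coactVia i U).lTensor R x =
      (TensorProduct.mk Γ(S, U.1) (Coord C U.1) Γ(E.sheaf, U.1) 1).lTensor R x → x = 0

end EquivModule

/-- The resolution property: every `G`-equivariant coherent `𝒪_S`-module is a `G`-equivariant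
quotient of a `G`-equivariant locally free `𝒪_S`-module of finite rank. -/
def HasResolutionProperty (G : Over S) [GrpObj G] [IsAffineHom G.hom] : Prop :=
  ∀ F : EquivModule G, F.IsCoherent →
    ∃ (E : EquivModule G) (φ : E.sheaf ⟶ F.sheaf),
      E.IsVectorBundle ∧ Epi φ ∧ EquivModule.IsEquivariantHom E F φ

/-! ### Actions, fixed loci and sections -/

/-- A morphism of schemes is quasi-affine if the inverse image of every affine open is a
quasi-affine scheme. -/
def IsQuasiAffineHom {T S : Scheme.{u}} (f : T ⟶ S) : Prop :=
  ∀ U : S.affineOpens, (f ⁻¹ᵁ U.1).toScheme.IsQuasiAffine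

/-- The action morphism `G ×_S X ⟶ X`. -/
def act (G X : Over S) [GrpObj G] [ModObj G X] : G ⊗ X ⟶ X := ModObj.smul (M := G) (X := X)

/-- A point `t : Y ⟶ X` is fixed by `C` (acting on `X` through `i : C ⟶ G`): it is
`C`-equivariant for the trivial action on `Y`, i.e. `c • t(y) = t(y)`. -/
def IsFixedPoint {G C X : Over S} [GrpObj G] [ModObj G X] (i : C ⟶ G) {Y : Over S}
    (t : Y ⟶ X) : Prop :=
  (i ⊗ₘ t) ≫ act G X = snd C Y ≫ t

/-- The closed subscheme of `X` with ideal sheaf `I` is the fixed locus `X^C`, i.e. it represents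
the functor of `C`-fixed points of `X`. -/
def IsFixedLocus {G C X : Over S} [GrpObj G] [ModObj G X] (i : C ⟶ G)
    (I : X.left.IdealSheafData) : Prop :=
  ∀ (Y : Over S) (t : Y ⟶ X),
    IsFixedPoint i t ↔ ∃ l : Y.left ⟶ I.subscheme, l ≫ I.subschemeι = t.left

/-- The pull-back `π_X^* F` of an `𝒪_S`-module to an `S`-scheme `X`. -/
abbrev pullbackTo (X : Over S) (F : S.Modules) : X.left.Modules :=
  (Scheme.Modules.pullback X.hom).obj F

/-- The canonical map `F(U) → Γ(W, π_X^* F)` for `W ⊆ X` lying over `U ⊆ S`. -/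
def pullSec (X : Over S) (F : S.Modules) (U : S.Opens) (W : X.left.Opens)
    (h : W ≤ X.hom ⁻¹ᵁ U) : Γ(F, U) →+ Γ(pullbackTo X F, W) :=
  ((pullbackTo X F).presheaf.map (homOfLE h).op).hom.comp
    (((Scheme.Modules.pullbackPushforwardAdjunction X.hom).unit.app F).app U).hom

lemma pullSec_smul (X : Over S) (F : S.Modules) (U : S.Opens) (W : X.left.Opens)
    (h : W ≤ X.hom ⁻¹ᵁ U) (r : Γ(S, U)) (x : Γ(F, U)) :
    pullSec X F U W h (r • x) = (X.hom.appLE U W h).hom r • pullSec X F U W h x := by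
  have h1 := Scheme.Modules.Hom.app_smul
    ((Scheme.Modules.pullbackPushforwardAdjunction X.hom).unit.app F) r x
  change (pullbackTo X F).presheaf.map (homOfLE h).op
    (((Scheme.Modules.pullbackPushforwardAdjunction X.hom).unit.app F).app U (r • x)) = _
  rw [h1]
  exact (pullbackTo X F).map_smul (homOfLE h) (X.hom.app U r) _

/-- The canonical map `Γ(X, W) ⊗ F(U) → Γ(W, π_X^* F)`, `a ⊗ x ↦ a • π_X^* x`, for `W ⊆ X` lying
over `U ⊆ S`. It is an isomorphism for `F` quasi-coherent and `U`, `W` affine. -/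
def tensorToPullback (X : Over S) (F : S.Modules) (U : S.Opens) (W : X.left.Opens)
    (h : W ≤ X.hom ⁻¹ᵁ U) : Sec X U W h ⊗[Γ(S, U)] Γ(F, U) →+ Γ(pullbackTo X F, W) :=
  TensorProduct.liftAddHom
    (AddMonoidHom.mk' (fun a : Sec X U W h => AddMonoidHom.mk'
        (fun x : Γ(F, U) => (show Γ(X.left, W) from a) • pullSec X F U W h x)
        (fun x y => by rw [map_add, smul_add]))
      (fun a b => by ext x; exact add_smul (R := Γ(X.left, W)) a b _))
    (fun r a x => by
      change ((X.hom.appLE U W h).hom r * (show Γ(X.left, W) from a)) • pullSec X F U W h x =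
        (show Γ(X.left, W) from a) • pullSec X F U W h (r • x)
      rw [pullSec_smul, mul_comm, mul_smul])

section Section

variable {G : Over S} [GrpObj G] [IsAffineHom G.hom] (E : EquivModule G)
  (X : Over S) [ModObj G X]

/-- Let `a : G ×_S X ⟶ X` be the action, let `W ⊆ X` lie over `U ⊆ S`, and let `Y ⊆ a⁻¹ W`. This
is the map `Γ(X, W) ⊗ E(U) → Γ(G ×_S X, Y) ⊗ E(U)` sending `f ⊗ x` to `(a^* f) • (coaction x)`, the
functions on `G` occurring in the coaction being pulled back to `G ×_S X`. -/
def twistedPull (U : S.affineOpens) (W : X.left.Opens) (hW : W ≤ X.hom ⁻¹ᵁ U.1)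
    (Y : (G ⊗ X).left.Opens) (hY : Y ≤ (act G X).left ⁻¹ᵁ W) :
    Sec X U.1 W hW ⊗[Γ(S, U.1)] Γ(E.sheaf, U.1) →ₗ[Γ(S, U.1)]
      Sec (G ⊗ X) U.1 Y (le_of_over (act G X) hW hY) ⊗[Γ(S, U.1)] Γ(E.sheaf, U.1) :=
  (Algebra.TensorProduct.productMap
      (pull (act G X) U.1 hW (le_of_over (act G X) hW hY) hY)
      (pull (fst G X) U.1 le_rfl (le_of_over (act G X) hW hY)
        ((le_of_over (act G X) hW hY).trans (preimage_le (fst G X) U.1)))).toLinearMap.rTensor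
      Γ(E.sheaf, U.1) ∘ₗ
    (TensorProduct.assoc Γ(S, U.1) (Sec X U.1 W hW) (Coord G U.1) Γ(E.sheaf, U.1)).symm ∘ₗ
    (E.coact U).lTensor (Sec X U.1 W hW)

/-- A global section `s` of `π_X^* E` is `G`-equivariant: the pull-backs of `s` along the action
`a : G ×_S X ⟶ X` and along the projection `p : G ×_S X ⟶ X` correspond to each other under the
equivariant structure `a^* π_X^* E ≃ p^* π_X^* E` induced by the coaction of `E`. This is checked
on the affine opens `Y` of `G ×_S X` mapped by `a` and `p` into affine opens `W`, `W'` of `X` which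
lie over a common affine open `U` of `S`; these cover `G ×_S X`. -/
def IsEquivariantSection (s : Γ(pullbackTo X E.sheaf, ⊤)) : Prop :=
  ∀ (U : S.affineOpens) (W W' : X.left.affineOpens) (hW : W.1 ≤ X.hom ⁻¹ᵁ U.1)
    (hW' : W'.1 ≤ X.hom ⁻¹ᵁ U.1)
    (z : Sec X U.1 W.1 hW ⊗[Γ(S, U.1)] Γ(E.sheaf, U.1))
    (z' : Sec X U.1 W'.1 hW' ⊗[Γ(S, U.1)] Γ(E.sheaf, U.1)),
    tensorToPullback X E.sheaf U.1 W.1 hW z =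
      (pullbackTo X E.sheaf).presheaf.map (homOfLE le_top).op s →
    tensorToPullback X E.sheaf U.1 W'.1 hW' z' =
      (pullbackTo X E.sheaf).presheaf.map (homOfLE le_top).op s →
    ∀ (Y : (G ⊗ X).left.affineOpens) (hY : Y.1 ≤ (act G X).left ⁻¹ᵁ W.1)
      (hY' : Y.1 ≤ (snd G X).left ⁻¹ᵁ W'.1),
      twistedPull E X U W.1 hW Y.1 hY z =
        (pull (snd G X) U.1 hW' (le_of_over (act G X) hW hY) hY').toLinearMap.rTensor
          Γ(E.sheaf, U.1) z'

end Section

/-- The ideal of the zero locus of a section `s` of an `𝒪_X`-module `P`, for `X` affine: it is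
generated by the `φ(s)`, where `φ` runs over the linear forms `P(X) → 𝒪(X)`. -/
def zeroIdeal {X : Scheme.{u}} (P : X.Modules) (s : Γ(P, ⊤)) : Ideal Γ(X, ⊤) :=
  Ideal.span (Set.range fun φ : Γ(P, ⊤) →ₗ[Γ(X, ⊤)] Γ(X, ⊤) => φ s)

/-- The (ideal sheaf of the) zero locus of a section of an `𝒪_X`-module, for `X` affine. -/
def zeroLocus {X : Scheme.{u}} (P : X.Modules) (s : Γ(P, ⊤)) : X.IdealSheafData :=
  Scheme.IdealSheafData.ofIdealTop (zeroIdeal P s)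

end GeomConc

end

noncomputable section

namespace GeomConc

variable {S : Scheme.{u}}

/-! ### Quasi-coherence in terms of sections -/

/-! Think of the invariant retraction ρ of `C` as integration over `C`. On every equivariant module
with coaction δ it gives the Reynolds operator Q = (ρ ⊗ 1) ∘ δ, where δ is restricted to `C`: the
average m ↦ ∫ c·m. The antipode shows that a left invariant, normalized ρ is also right invariant
and stable under inversion (`comp_antipode_eq`, `rightInv_of_leftInv`). Hence Q is a projector onto
the `C`-fixed sections, natural for equivariant maps. Normality of `C` makes Q commute with the
coaction of `G` (`coact_reynolds_of_normal`), so ker Q is a `G`-stable direct summand.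

Apply this to functions on `X`. A point t of `X` is `C`-fixed if and only if t^*(Qf) = t^*f for all
functions f over a cover of `S` (`pull_rey_of_isFixedPoint`, `isFixedPoint_of_pull_rey`): along a
fixed point the orbit is constant, so the average is the value; conversely averages are
`C`-invariant functions. Thus X^C is cut out by the functions f - Qf, and as everything is
noetherian finitely many f suffice. Since `G` is flat, coactions are locally finite, so these f lie
in a coherent equivariant submodule F of the direct image of 𝒪_X
(`EquivModule.exists_coherent_sub`). The resolution property gives an equivariant bundle E₀ mapping
onto F; let E be the kernel of Q on E₀, again an equivariant bundle. If x lifts f locally, then x -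
Qx is a section of E mapping to f - Qf. Conversely any function coming from E is killed by Q, hence
vanishes along fixed points. So the image of E cuts out exactly X^C (`exists_bundle_fixed`).

A morphism from E to the functions on `X` is the same as a section s of the pull-back of V = E^∨
(`exists_section`). It is equivariant by `twist_eq`, and its zero locus is the one cut out by the
image of E (`zeroIdeal_iff`). Finally Q vanishes on E, hence on V, where it is the transpose
(`reynolds_dualCoact`); a `C`-fixed point of V over any base is its own average, so it is 0
(`fixedLocusIsZero`).

The sheaf theory is done through sections over affine opens. Quasi-coherence is used in the form:
restriction to a basic open D(f) is localization at f (`LocalizesOn`). In this form it can be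
verified for subsheaves, direct images, duals and pull-backs of duals. -/

/-- Restriction of functions. -/
abbrev fres {U V : S.Opens} (h : V ≤ U) : Γ(S, U) →+* Γ(S, V) := (S.presheaf.map (homOfLE h).op).hom

lemma fres_fres {U V W : S.Opens} (h : V ≤ U) (h' : W ≤ V) (r : Γ(S, U)) :
    fres h' (fres h r) = fres (h'.trans h) r := by
  change (S.presheaf.map _ ≫ S.presheaf.map _) r = _
  rw [← Functor.map_comp]
  rfl

lemma secRes_secRes (M : S.Modules) {U V W : S.Opens} (h : V ≤ U) (h' : W ≤ V) (x : Γ(M, U)) :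
    secRes M h' (secRes M h x) = secRes M (h'.trans h) x := by
  change (M.presheaf.map _ ≫ M.presheaf.map _) x = _
  rw [← Functor.map_comp]
  rfl

lemma secRes_rfl (M : S.Modules) {U : S.Opens} (x : Γ(M, U)) : secRes M le_rfl x = x := by
  change M.presheaf.map (𝟙 _) x = x
  rw [M.presheaf.map_id]
  rfl

lemma fres_rfl {U : S.Opens} (x : Γ(S, U)) : fres le_rfl x = x := by
  change S.presheaf.map (𝟙 _) x = x
  rw [S.presheaf.map_id]
  rfl

lemma secRes_smul (M : S.Modules) {U V : S.Opens} (h : V ≤ U) (r : Γ(S, U)) (x : Γ(M, U)) :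
    secRes M h (r • x) = fres h r • secRes M h x :=
  map_smulₛₗ _ _ _

/-- The restriction from `U` to `V` is a localization at `f`, expressed through sections. -/
structure LocalizesAt (M : S.Modules) {U V : S.Opens} (h : V ≤ U) (f : Γ(S, U)) : Prop where
  torsion (x : Γ(M, U)) : secRes M h x = 0 → ∃ n : ℕ, f ^ n • x = 0
  lift (y : Γ(M, V)) : ∃ (n : ℕ) (x : Γ(M, U)), secRes M h x = fres h f ^ n • y

/-- Needed because images of opens under `fromSpec` agree with opens of `S` only up to a
propositional equality. -/
lemma LocalizesAt.congr {M : S.Modules} {U V U' V' : S.Opens} (hU : U' = U) (hV : V' = V)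
    {h : V ≤ U} {h' : V' ≤ U'} {f : Γ(S, U)} {f' : Γ(S, U')} (hf : f' = fres hU.le f)
    (H : LocalizesAt M h' f') : LocalizesAt M h f := by
  subst hU hV
  rw [fres_rfl] at hf
  subst hf
  exact H

/-- The restriction maps of `M` from an affine open to its basic opens are localizations. -/
def LocalizesOn (M : S.Modules) (U : S.Opens) : Prop :=
  ∀ f : Γ(S, U), LocalizesAt M (S.basicOpen_le f) f

section

variable (M : S.Modules) {U : S.Opens} (hU : IsAffineOpen U)

lemma image_fromSpec_top : hU.fromSpec ''ᵁ ⊤ = U := by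
  rw [Scheme.Hom.image_top_eq_opensRange, hU.opensRange_fromSpec]

/-- Scalars act on the restricted sheaf through `ΓSpecIso` and `appIso`; the composite of these
identifications is the restriction map of 𝒪_S, so the two module structures match. -/
lemma smul_restrict_fromSpec (V : (Spec Γ(S, U)).Opens) (hV : hU.fromSpec ''ᵁ V ≤ U)
    (r : Γ(S, U)) (x : Γ(M.restrict hU.fromSpec, V)) :
    (M.restrictAppIso hU.fromSpec V).hom (r • x) =
      fres hV r • (M.restrictAppIso hU.fromSpec V).hom x := by
  have h : (Scheme.ΓSpecIso Γ(S, U)).inv ≫ (Spec Γ(S, U)).presheaf.map V.leTop.op ≫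
      (hU.fromSpec.appIso V).inv = S.presheaf.map (homOfLE hV).op := by
    rw [← Category.assoc, Iso.comp_inv_eq, Scheme.Hom.appIso_hom']
    rw [Scheme.Hom.map_appLE, Scheme.Hom.appLE, hU.fromSpec_app_self, Category.assoc,
      ← Functor.map_comp]
    rfl
  rw [Scheme.Modules.smul_Spec_def]
  have h2 := ConcreteCategory.congr_hom h r
  change _ = (S.presheaf.map (homOfLE hV).op) r • _
  rw [← h2]
  rfl

lemma localizesAt_iff_isLocalizedModule (f : Γ(S, U)) :
    LocalizesAt M (S.basicOpen_le f) f ↔ IsLocalizedModule (.powers f)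
      ((modulesSpecToSheaf.obj (M.restrict hU.fromSpec)).obj.map
        (PrimeSpectrum.basicOpen f : Opens (Spec Γ(S, U))).leTop.op).hom := by
  set D : (Spec Γ(S, U)).Opens := PrimeSpectrum.basicOpen f with hD
  set φ := ((modulesSpecToSheaf.obj (M.restrict hU.fromSpec)).obj.map D.leTop.op).hom with hφ
  have eT : hU.fromSpec ''ᵁ ⊤ = U := image_fromSpec_top hU
  have eD : hU.fromSpec ''ᵁ D = S.basicOpen f := hU.fromSpec_image_basicOpen f
  have hDT : hU.fromSpec ''ᵁ D ≤ hU.fromSpec ''ᵁ ⊤ := Scheme.Hom.image_mono _ le_top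
  -- Move to the images of `⊤` and `D(f)` under `fromSpec`, over which sections of the restricted
  -- sheaf are by definition sections of `M`.
  have key : LocalizesAt M (S.basicOpen_le f) f ↔ LocalizesAt M hDT (fres eT.le f) := by
    constructor
    · intro H
      refine H.congr eT.symm eD.symm ?_
      rw [fres_fres, fres_rfl]
    · exact fun H => H.congr eT eD rfl
  have hres (x : Γ(M, hU.fromSpec ''ᵁ ⊤)) : φ x = secRes M hDT x := rfl
  have hsT (n : ℕ) (x : Γ(M.restrict hU.fromSpec, ⊤)) :
      (show Γ(M, hU.fromSpec ''ᵁ ⊤) from f ^ n • x) =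
        fres eT.le f ^ n • (show Γ(M, hU.fromSpec ''ᵁ ⊤) from x) := by
    rw [← map_pow]
    exact smul_restrict_fromSpec M hU ⊤ eT.le (f ^ n) x
  have hsD (n : ℕ) (x : Γ(M.restrict hU.fromSpec, D)) :
      (show Γ(M, hU.fromSpec ''ᵁ D) from f ^ n • x) =
        fres hDT (fres eT.le f) ^ n • (show Γ(M, hU.fromSpec ''ᵁ D) from x) := by
    rw [← map_pow, ← map_pow, fres_fres]
    exact smul_restrict_fromSpec M hU D (hDT.trans eT.le) (f ^ n) x
  rw [key]
  constructor
  · intro H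
    refine IsLocalizedModule.Away.mk_of_addCommGroup ?_ ?_ ?_
    · exact Scheme.Modules.isUnit_algebraMap_end_of_le_basicOpen f le_rfl
    · intro y
      obtain ⟨n, x, hx⟩ := H.lift y
      exact ⟨n, x, (hsD n y).trans hx.symm⟩
    · intro x hx
      obtain ⟨n, hn⟩ := H.torsion x hx
      exact ⟨n, (hsT n x).trans hn⟩
  · intro H
    refine ⟨fun x hx => ?_, fun y => ?_⟩
    · obtain ⟨⟨_, n, rfl⟩, hn⟩ := (IsLocalizedModule.eq_zero_iff (.powers f) φ).mp hx
      exact ⟨n, (hsT n x).symm.trans hn⟩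
    · obtain ⟨n, x, hx⟩ := IsLocalizedModule.Away.surj φ f y
      exact ⟨n, x, hx.symm.trans (hsD n y)⟩

/-- On `Spec R` a module is quasi-coherent exactly when it is the tilde of its global sections, that
is, when restriction to each D(f) is localization at f. -/
lemma localizesOn_iff_isQuasicoherent : LocalizesOn M U ↔
    (M.restrict hU.fromSpec).IsQuasicoherent := by
  rw [isQuasicoherent_iff_isIso_fromTildeΓ, isIso_fromTildeΓ_iff_isLocalizing]
  exact forall_congr' fun f => localizesAt_iff_isLocalizedModule M hU f

end

lemma localizesOn_of_isQuasicoherent (M : S.Modules) [M.IsQuasicoherent] {U : S.Opens}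
    (hU : IsAffineOpen U) : LocalizesOn M U :=
  (localizesOn_iff_isQuasicoherent M hU).mpr inferInstance

/-- Transport of a presentation along an isomorphism. -/
def presentationOfIso {C : Type*} [Category* C] {J : GrothendieckTopology C}
    {R : Sheaf J RingCat.{u}} [HasSheafify J AddCommGrpCat.{u}]
    [J.WEqualsLocallyBijective AddCommGrpCat.{u}] {M N : SheafOfModules.{u} R} (e : M ≅ N)
    (P : M.Presentation) : N.Presentation :=
  P.ofIsIso e.hom

/-- Quasi-coherence is local. -/
lemma isQuasicoherent_of_restrict (M : S.Modules) {J : Type u} (U : J → S.Opens)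
    (hU : ⨆ i, U i = ⊤) (P : ∀ i, (M.restrict (U i).ι).Presentation) : M.IsQuasicoherent := by
  refine SheafOfModules.QuasicoherentData.isQuasicoherent (R := S.ringCatSheaf) (M := M)
    { I := J, X := U, coversTop := ?_, presentation := fun i => ?_ }
  · rw [Opens.coversTop_iff]
    exact hU
  · let e := Scheme.Modules.overEquiv (U i)
    have he : Limits.PreservesColimitsOfSize.{u, u} e.inverse := inferInstance
    -- A presentation is built from copies of the unit by colimits, so it is carried over by any
    -- functor that preserves colimits and the unit, here the inverse of the equivalence with
    -- modules over the slice.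
    let P' := @SheafOfModules.Presentation.map _ _ _ _ _ _ _ _ _ _ _ _ _ (P i) e.inverse he
      (Opens.sheafOfModulesEquivOverInverseUnit (U i) S.ringCatSheaf).symm
    exact presentationOfIso (e.inverse.mapIso ((Scheme.Modules.overFunctorEquiv (U i)).symm.app M)
      ≪≫ e.unitIso.symm.app (M.over (U i))) P'

/-- Over an affine open where restriction is localization, the sheaf is a tilde, and a tilde has a
presentation coming from generators and relations of its module. These presentations, transported to
the open subschemes, are quasi-coherent data. -/
lemma isQuasicoherent_of_cover (M : S.Modules)
    (h : ∀ x : S, ∃ U : S.affineOpens, x ∈ U.1 ∧ LocalizesOn M U.1) : M.IsQuasicoherent := by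
  choose U hxU h using h
  refine isQuasicoherent_of_restrict M (fun x => (U x).1) ?_ fun x => ?_
  · exact eq_top_iff.2 fun x _ => Opens.mem_iSup.2 ⟨x, hxU x⟩
  · have hU : IsAffineOpen (U x).1 := (U x).2
    have hq := (localizesOn_iff_isQuasicoherent M hU).mp (h x)
    rw [isQuasicoherent_iff_isIso_fromTildeΓ] at hq
    let P := (presentationTilde.{u} (M := (modulesSpecToSheaf.obj
      (M.restrict hU.fromSpec)).presheaf.obj (.op ⊤)) .univ (by simp) _ (Submodule.span_eq _))
    let P' := presentationOfIso (@asIso _ _ _ _ (M.restrict hU.fromSpec).fromTildeΓ hq) P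
    let P'' := Scheme.Modules.presentationRestrict hU.isoSpec.hom P'
    exact presentationOfIso ((Scheme.Modules.restrictFunctorComp _ _).symm.app M ≪≫
      (Scheme.Modules.restrictFunctorCongr (hU.isoSpec_hom_fromSpec)).app M) P''

lemma isQuasicoherent_of_localizesOn (M : S.Modules) (h : ∀ U : S.affineOpens, LocalizesOn M U.1) :
    M.IsQuasicoherent :=
  isQuasicoherent_of_cover M fun x => by
    obtain ⟨U, hU⟩ := Opens.mem_iSup.1
      ((iSup_affineOpens_eq_top S).symm ▸ Opens.mem_top x : x ∈ ⨆ U : S.affineOpens, U.1)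
    exact ⟨U, hU, h U⟩

/-! ### Constructing sheaves of modules from sections -/

lemma sec_ext (M : S.Modules) {J : Type*} {U : S.Opens} (V : J → S.Opens) (hV : ∀ j, V j ≤ U)
    (hcov : U ≤ ⨆ j, V j) {x y : Γ(M, U)} (h : ∀ j, secRes M (hV j) x = secRes M (hV j) y) :
    x = y :=
  TopCat.Sheaf.eq_of_locally_eq' ⟨_, M.isSheaf⟩ V U (fun j => homOfLE (hV j)) hcov x y h

lemma sec_glue (M : S.Modules) {J : Type*} {U : S.Opens} (V : J → S.Opens) (hV : ∀ j, V j ≤ U)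
    (hcov : U ≤ ⨆ j, V j) (x : ∀ j, Γ(M, V j))
    (h : ∀ i j, secRes M (inf_le_left : V i ⊓ V j ≤ V i) (x i) =
      secRes M (inf_le_right : V i ⊓ V j ≤ V j) (x j)) :
    ∃ y : Γ(M, U), ∀ j, secRes M (hV j) y = x j :=
  (TopCat.Sheaf.existsUnique_gluing' ⟨_, M.isSheaf⟩ V U (fun j => homOfLE (hV j)) hcov x
    (fun i j => h i j)).exists

lemma fun_ext {J : Type*} {U : S.Opens} (V : J → S.Opens) (hV : ∀ j, V j ≤ U)
    (hcov : U ≤ ⨆ j, V j) {x y : Γ(S, U)} (h : ∀ j, fres (hV j) x = fres (hV j) y) : x = y :=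
  TopCat.Sheaf.eq_of_locally_eq' S.sheaf V U (fun j => homOfLE (hV j)) hcov x y h

lemma fun_glue {J : Type*} {U : S.Opens} (V : J → S.Opens) (hV : ∀ j, V j ≤ U)
    (hcov : U ≤ ⨆ j, V j) (x : ∀ j, Γ(S, V j))
    (h : ∀ i j, fres (inf_le_left : V i ⊓ V j ≤ V i) (x i) =
      fres (inf_le_right : V i ⊓ V j ≤ V j) (x j)) :
    ∃ y : Γ(S, U), ∀ j, fres (hV j) y = x j :=
  (TopCat.Sheaf.existsUnique_gluing' S.sheaf V U (fun j => homOfLE (hV j)) hcov x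
    (fun i j => h i j)).exists

/-- A sheaf of modules, presented through its sections and restriction maps. -/
structure SheafData (S : Scheme.{u}) where
  /-- the sections -/
  obj : S.Opens → Type u
  [group : ∀ U, AddCommGroup (obj U)]
  [module : ∀ U, Module Γ(S, U) (obj U)]
  /-- the restriction maps -/
  res {U V : S.Opens} (h : V ≤ U) : obj U →ₛₗ[fres h] obj V
  res_rfl {U : S.Opens} (x : obj U) : res le_rfl x = x
  res_res {U V W : S.Opens} (h : V ≤ U) (h' : W ≤ V) (x : obj U) :
    res h' (res h x) = res (h'.trans h) x
  ext {J : Type u} (V : J → S.Opens) (x y : obj (⨆ j, V j))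
    (h : ∀ j, res (le_iSup V j) x = res (le_iSup V j) y) : x = y
  glue {J : Type u} (V : J → S.Opens) (x : ∀ j, obj (V j))
    (h : ∀ i j, res (inf_le_left : V i ⊓ V j ≤ V i) (x i) =
      res (inf_le_right : V i ⊓ V j ≤ V j) (x j)) :
    ∃ y : obj (⨆ j, V j), ∀ j, res (le_iSup V j) y = x j

namespace SheafData

attribute [instance] SheafData.group SheafData.module

variable (D : SheafData S)

/-- The underlying presheaf of abelian groups. -/
def presheaf : TopCat.Presheaf Ab.{u} S where
  obj U := .of (D.obj U.unop)
  map f := AddCommGrpCat.ofHom (D.res f.unop.le).toAddMonoidHom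
  map_id U := by ext x; exact D.res_rfl x
  map_comp f g := by ext x; exact (D.res_res f.unop.le g.unop.le x).symm

instance (U : (Opens S)ᵒᵖ) : Module (S.ringCatSheaf.obj.obj U) (D.presheaf.obj U) :=
  inferInstanceAs (Module Γ(S, U.unop) (D.obj U.unop))

/-- The sheaf of modules defined by `D`. -/
def toModules : S.Modules where
  val := PresheafOfModules.ofPresheaf D.presheaf (fun _ _ f r m => map_smulₛₗ (D.res f.unop.le) r m)
  isSheaf := by
    change TopCat.Presheaf.IsSheaf D.presheaf
    rw [TopCat.Presheaf.isSheaf_iff_isSheaf_comp (forget AddCommGrpCat)]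
    refine TopCat.Presheaf.isSheaf_of_isSheafUniqueGluing_types _ fun J V x hx => ?_
    obtain ⟨y, hy⟩ := D.glue V x hx
    exact ⟨y, hy, fun z hz => D.ext V z y fun j => (hz j).trans (hy j).symm⟩

/-- Sections of the sheaf of modules defined by `D`. -/
def secEquiv (U : S.Opens) : Γ(D.toModules, U) ≃ₗ[Γ(S, U)] D.obj U where
  toFun x := x
  invFun x := x
  map_add' _ _ := rfl
  map_smul' _ _ := rfl

end SheafData

/-- A morphism of sheaves of modules from linear maps on sections. -/
def homOfSec {M N : S.Modules} (φ : ∀ U : S.Opens, Γ(M, U) →ₗ[Γ(S, U)] Γ(N, U))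
    (hφ : ∀ {U V : S.Opens} (h : V ≤ U) (x : Γ(M, U)),
      φ V (secRes M h x) = secRes N h (φ U x)) : M ⟶ N where
  val :=
    { app U := ModuleCat.ofHom (φ U.unop)
      naturality f := by
        ext x
        exact hφ f.unop.le x }

lemma homSec_secRes {M N : S.Modules} (φ : M ⟶ N) {U V : S.Opens} (h : V ≤ U) (x : Γ(M, U)) :
    homSec φ V (secRes M h x) = secRes N h (homSec φ U x) :=
  (ConcreteCategory.congr_hom (φ.mapPresheaf.naturality (homOfLE h).op) x :)

lemma homSec_comp {M N K : S.Modules} (φ : M ⟶ N) (ψ : N ⟶ K) (U : S.Opens) (x : Γ(M, U)) :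
    homSec (φ ≫ ψ) U x = homSec ψ U (homSec φ U x) := rfl

/-! ### Subsheaves -/

/-- A subsheaf of modules. -/
structure SubSheaf (M : S.Modules) where
  /-- the sections -/
  obj (U : S.Opens) : Submodule Γ(S, U) Γ(M, U)
  res {U V : S.Opens} (h : V ≤ U) {x : Γ(M, U)} (hx : x ∈ obj U) : secRes M h x ∈ obj V
  loc {U : S.Opens} (x : Γ(M, U))
    (h : ∀ p ∈ U, ∃ (V : S.Opens) (hV : V ≤ U), p ∈ V ∧ secRes M hV x ∈ obj V) : x ∈ obj U

namespace SubSheaf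

variable {M : S.Modules} (N : SubSheaf M)

/-- The sheaf data of a subsheaf. -/
def data : SheafData S where
  obj U := N.obj U
  res h :=
    { toFun x := ⟨secRes M h x.1, N.res h x.2⟩
      map_add' x y := Subtype.ext (map_add _ _ _)
      map_smul' r x := Subtype.ext (map_smulₛₗ _ _ _) }
  res_rfl x := Subtype.ext (secRes_rfl M x.1)
  res_res h h' x := Subtype.ext (secRes_secRes M h h' x.1)
  ext V x y h := Subtype.ext (sec_ext M V (le_iSup V) le_rfl fun j => congrArg Subtype.val (h j))
  glue V x h := by
    obtain ⟨y, hy⟩ := sec_glue M V (le_iSup V) le_rfl (fun j => (x j).1)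
      fun i j => congrArg Subtype.val (h i j)
    refine ⟨⟨y, N.loc y fun p hp => ?_⟩, fun j => Subtype.ext (hy j)⟩
    obtain ⟨j, hj⟩ := Opens.mem_iSup.mp hp
    exact ⟨V j, le_iSup V j, hj, by rw [hy]; exact (x j).2⟩

/-- The sheaf of modules underlying a subsheaf. -/
def toModules : S.Modules := N.data.toModules

/-- The sections of a subsheaf. -/
def secEquiv (U : S.Opens) : Γ(N.toModules, U) ≃ₗ[Γ(S, U)] N.obj U := N.data.secEquiv U

lemma secEquiv_secRes {U V : S.Opens} (h : V ≤ U) (x : Γ(N.toModules, U)) :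
    (N.secEquiv V (secRes N.toModules h x) : Γ(M, V)) = secRes M h (N.secEquiv U x : Γ(M, U)) := rfl

/-- The inclusion of a subsheaf. -/
def incl : N.toModules ⟶ M :=
  homOfSec (fun U => (N.obj U).subtype ∘ₗ (N.secEquiv U).toLinearMap) (fun _ _ => rfl)

lemma homSec_incl {U : S.Opens} (x : Γ(N.toModules, U)) :
    homSec N.incl U x = (N.secEquiv U x : Γ(M, U)) := rfl

instance : Mono N.incl where
  right_cancellation f g h := by
    refine Scheme.Modules.hom_ext f g fun U => ?_
    ext x
    apply (N.secEquiv U).injective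
    apply Subtype.ext
    have := congrArg (fun k => homSec k U x) h
    exact this

end SubSheaf

/-- The image subsheaf of a morphism. -/
def imageSheaf {M N : S.Modules} (φ : M ⟶ N) : SubSheaf N where
  obj U :=
    { carrier := {y | ∀ p ∈ U, ∃ (V : S.Opens) (hV : V ≤ U), p ∈ V ∧
        ∃ x : Γ(M, V), homSec φ V x = secRes N hV y}
      zero_mem' := fun p hp => ⟨U, le_rfl, hp, 0, by simp⟩
      add_mem' := by
        intro y y' hy hy' p hp
        obtain ⟨V, hV, hpV, x, hx⟩ := hy p hp
        obtain ⟨V', hV', hpV', x', hx'⟩ := hy' p hp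
        refine ⟨V ⊓ V', inf_le_left.trans hV, ⟨hpV, hpV'⟩,
          secRes M inf_le_left x + secRes M inf_le_right x', ?_⟩
        rw [map_add, homSec_secRes, homSec_secRes, hx, hx', secRes_secRes, secRes_secRes, map_add]
      smul_mem' := by
        intro r y hy p hp
        obtain ⟨V, hV, hpV, x, hx⟩ := hy p hp
        exact ⟨V, hV, hpV, fres hV r • x, by rw [map_smul, hx, secRes_smul]⟩ }
  res := by
    intro U V h y hy p hp
    obtain ⟨W, hW, hpW, x, hx⟩ := hy p (h hp)
    refine ⟨W ⊓ V, inf_le_right, ⟨hpW, hp⟩, secRes M inf_le_left x, ?_⟩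
    rw [homSec_secRes, hx, secRes_secRes, secRes_secRes]
  loc := by
    intro U y hy p hp
    obtain ⟨V, hV, hpV, hyV⟩ := hy p hp
    obtain ⟨W, hW, hpW, x, hx⟩ := hyV p hpV
    exact ⟨W, hW.trans hV, hpW, x, by rw [hx, secRes_secRes]⟩

/-- An epimorphism factors through its image subsheaf, whose inclusion is then both mono and epi,
hence an isomorphism. So every section lies in the image, which means that it lifts locally. -/
lemma exists_local_preimage {M N : S.Modules} (φ : M ⟶ N) [Epi φ] {U : S.Opens} (y : Γ(N, U)) :
    ∀ p ∈ U, ∃ (V : S.Opens) (hV : V ≤ U), p ∈ V ∧ ∃ x : Γ(M, V), homSec φ V x = secRes N hV y := by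
  let I := imageSheaf φ
  let ψ : M ⟶ I.toModules := homOfSec (fun U =>
    (I.secEquiv U).symm.toLinearMap ∘ₗ LinearMap.codRestrict (I.obj U) (homSec φ U)
      fun x p hp => ⟨U, le_rfl, hp, x, (secRes_rfl _ _).symm⟩) (by
    intro U V h x
    apply (I.secEquiv V).injective
    apply Subtype.ext
    rw [I.secEquiv_secRes]
    exact homSec_secRes φ h x)
  have hψ : ψ ≫ I.incl = φ := Scheme.Modules.hom_ext _ _ fun U => by ext x; rfl
  have : Epi (ψ ≫ I.incl) := by rw [hψ]; infer_instance
  have : Epi I.incl := epi_of_epi ψ I.incl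
  have : IsIso I.incl := isIso_of_mono_of_epi _
  let x := homSec (inv I.incl) U y
  have hx : homSec I.incl U x = y := by
    change homSec (inv I.incl ≫ I.incl) U y = y
    rw [IsIso.inv_hom_id]
    rfl
  have h2 : ((I.secEquiv U x : I.obj U) : Γ(N, U)) = y := hx
  have h3 : y ∈ I.obj U := h2 ▸ (I.secEquiv U x).2
  exact h3

/-! ### Extending linear forms from an affine open -/

lemma isUnit_fres {U V : S.Opens} (h : V ≤ U) {f : Γ(S, U)} (hV : V ≤ S.basicOpen f) :
    IsUnit (fres h f) := by
  have := (S.toRingedSpace.isUnit_res_basicOpen f).map (fres (U := S.basicOpen f) hV)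
  change IsUnit (fres hV (fres (S.basicOpen_le f) f)) at this
  rwa [fres_fres] at this

lemma isUnit_fres_pow {U V : S.Opens} (h : V ≤ U) {f : Γ(S, U)} (hV : V ≤ S.basicOpen f) (n : ℕ) :
    IsUnit (fres h f ^ n) := (isUnit_fres h hV).pow n

lemma exists_basicOpen_mem {U : S.Opens} (hU : IsAffineOpen U) {V : S.Opens} (hV : V ≤ U) {p : S}
    (hp : p ∈ V) : ∃ f : Γ(S, U), p ∈ S.basicOpen f ∧ S.basicOpen f ≤ V := by
  obtain ⟨f, hf, hpf⟩ := hU.exists_basicOpen_le ⟨p, hp⟩ (hV hp)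
  exact ⟨f, hpf, hf⟩

section Extend

variable (E : S.Modules) {U : S.Opens}

/-- A fraction `x / f ^ n` with `x ∈ E(U)` representing a section over `D(f)`. -/
structure Fraction {V : S.Opens} (e : Γ(E, V)) (hV : V ≤ U) where
  f : Γ(S, U)
  le : S.basicOpen f ≤ V
  n : ℕ
  x : Γ(E, U)
  eq : secRes E (S.basicOpen_le f) x = fres (S.basicOpen_le f) f ^ n • secRes E le e

variable {E}

lemma exists_fraction (hU : IsAffineOpen U) (hE : LocalizesOn E U) {V : S.Opens} (hV : V ≤ U)
    (e : Γ(E, V)) {p : S} (hp : p ∈ V) : ∃ t : Fraction E e hV, p ∈ S.basicOpen t.f := by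
  obtain ⟨f, hpf, hf⟩ := exists_basicOpen_mem hU hV hp
  obtain ⟨n, x, hx⟩ := (hE f).lift (secRes E hf e)
  exact ⟨⟨f, hf, n, x, hx⟩, hpf⟩

/-- Where e = x / f ^ n with x defined over all of `U`, linearity forces the value φ(x) / f ^ n;
these local values agree and glue. -/
lemma exists_extension (hU : IsAffineOpen U) (hE : LocalizesOn E U)
    (φ : Γ(E, U) →ₗ[Γ(S, U)] Γ(S, U)) {V : S.Opens} (hV : V ≤ U) (e : Γ(E, V)) :
    ∃ y : Γ(S, V), ∀ t : Fraction E e hV,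
      fres (S.basicOpen_le t.f) (φ t.x) = fres (S.basicOpen_le t.f) t.f ^ t.n * fres t.le y := by
  have hcov : V ≤ ⨆ t : Fraction E e hV, S.basicOpen t.f := by
    intro p hp
    obtain ⟨t, ht⟩ := exists_fraction hU hE hV e hp
    exact Opens.mem_iSup.mpr ⟨t, ht⟩
  choose v hv using fun t : Fraction E e hV =>
    (isUnit_fres_pow (S.basicOpen_le t.f) le_rfl t.n).exists_left_inv
  obtain ⟨y, hy⟩ := fun_glue (fun t : Fraction E e hV => S.basicOpen t.f) (fun t => t.le) hcov
    (fun t => v t * fres (S.basicOpen_le t.f) (φ t.x)) (by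
      intro s t
      set W := S.basicOpen s.f ⊓ S.basicOpen t.f with hW
      have hWm : W = S.basicOpen (s.f * t.f) := (S.basicOpen_mul _ _).symm
      have hWU : W ≤ U := inf_le_left.trans (S.basicOpen_le _)
      have us := isUnit_fres_pow hWU (inf_le_left : W ≤ S.basicOpen s.f) s.n
      have ut := isUnit_fres_pow hWU (inf_le_right : W ≤ S.basicOpen t.f) t.n
      -- Both fractions represent the same section on the overlap, so the cross-difference vanishes
      -- there and is killed by a power of the product of the denominators, which is invertible on
      -- the overlap.
      have e1 : secRes E hWU (t.f ^ t.n • s.x - s.f ^ s.n • t.x) = 0 := by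
        have h1 := congrArg (secRes E (inf_le_left : W ≤ _)) s.eq
        have h2 := congrArg (secRes E (inf_le_right : W ≤ _)) t.eq
        rw [secRes_secRes, secRes_smul, secRes_secRes, map_pow, fres_fres] at h1 h2
        rw [map_sub, secRes_smul, secRes_smul, h1, h2, smul_smul, smul_smul, map_pow, map_pow,
          mul_comm, sub_self]
      have e2 : secRes E (S.basicOpen_le (s.f * t.f)) (t.f ^ t.n • s.x - s.f ^ s.n • t.x) = 0 := by
        have := congrArg (secRes E hWm.ge) e1
        rwa [secRes_secRes, map_zero] at this
      obtain ⟨k, hk⟩ := (hE (s.f * t.f)).torsion _ e2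
      have e3 := congrArg (fun z => fres hWU (φ z)) hk
      simp only [map_smul, map_sub, map_zero, smul_eq_mul, map_mul, map_pow] at e3
      have uk : IsUnit ((fres hWU s.f * fres hWU t.f) ^ k) :=
        ((isUnit_fres hWU inf_le_left).mul (isUnit_fres hWU inf_le_right)).pow k
      rw [uk.mul_right_eq_zero, sub_eq_zero] at e3
      have a1 := congrArg (fres (inf_le_left : W ≤ _)) (hv s)
      have a2 := congrArg (fres (inf_le_right : W ≤ _)) (hv t)
      rw [map_mul, map_pow, fres_fres, map_one] at a1 a2
      rw [map_mul, fres_fres, map_mul, fres_fres]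
      refine (us.mul ut).mul_right_cancel ?_
      linear_combination (fres hWU t.f ^ t.n * fres hWU (φ s.x)) * a1 -
        (fres hWU s.f ^ s.n * fres hWU (φ t.x)) * a2 + e3)
  refine ⟨y, fun t => ?_⟩
  rw [hy t]
  linear_combination (- fres (S.basicOpen_le t.f) (φ t.x)) * hv t

variable (hU : IsAffineOpen U) (hE : LocalizesOn E U) (φ : Γ(E, U) →ₗ[Γ(S, U)] Γ(S, U))

lemma eq_of_fractions {V : S.Opens} (hV : V ≤ U) (e : Γ(E, V)) {y y' : Γ(S, V)}
    (h : ∀ t : Fraction E e hV, fres t.le y = fres t.le y') (hU : IsAffineOpen U)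
    (hE : LocalizesOn E U) : y = y' := by
  refine fun_ext (fun t : Fraction E e hV => S.basicOpen t.f) (fun t => t.le) ?_ h
  intro p hp
  obtain ⟨t, ht⟩ := exists_fraction hU hE hV e hp
  exact Opens.mem_iSup.mpr ⟨t, ht⟩

/-- The value of the extension of a linear form. -/
def extendFun {V : S.Opens} (hV : V ≤ U) (e : Γ(E, V)) : Γ(S, V) :=
  (exists_extension hU hE φ hV e).choose

lemma extendFun_spec {V : S.Opens} (hV : V ≤ U) (e : Γ(E, V)) (t : Fraction E e hV) :
    fres (S.basicOpen_le t.f) (φ t.x) =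
      fres (S.basicOpen_le t.f) t.f ^ t.n * fres t.le (extendFun hU hE φ hV e) :=
  (exists_extension hU hE φ hV e).choose_spec t

lemma extendFun_eq {V : S.Opens} (hV : V ≤ U) (e : Γ(E, V)) (f : Γ(S, U)) (hf : S.basicOpen f ≤ V)
    (n : ℕ) (x : Γ(E, U))
    (hx : secRes E (S.basicOpen_le f) x = fres (S.basicOpen_le f) f ^ n • secRes E hf e) :
    fres (S.basicOpen_le f) f ^ n * fres hf (extendFun hU hE φ hV e) =
      fres (S.basicOpen_le f) (φ x) :=
  (extendFun_spec hU hE φ hV e ⟨f, hf, n, x, hx⟩).symm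

lemma fun_ext_basicOpen (hU : IsAffineOpen U) {V : S.Opens} (hV : V ≤ U) {y y' : Γ(S, V)}
    (h : ∀ (f : Γ(S, U)) (hf : S.basicOpen f ≤ V), fres hf y = fres hf y') : y = y' := by
  refine fun_ext (fun f : {f : Γ(S, U) // S.basicOpen f ≤ V} => S.basicOpen f.1) (fun f => f.2)
      ?_ fun f => h f.1 f.2
  intro p hp
  obtain ⟨f, hpf, hf⟩ := exists_basicOpen_mem hU hV hp
  exact Opens.mem_iSup.mpr ⟨⟨f, hf⟩, hpf⟩

lemma extendFun_add {V : S.Opens} (hV : V ≤ U) (e e' : Γ(E, V)) :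
    extendFun hU hE φ hV (e + e') = extendFun hU hE φ hV e + extendFun hU hE φ hV e' := by
  refine fun_ext_basicOpen hU hV fun f hf => ?_
  obtain ⟨n, x, hx⟩ := (hE f).lift (secRes E hf e)
  obtain ⟨n', x', hx'⟩ := (hE f).lift (secRes E hf e')
  have h1 := extendFun_eq hU hE φ hV e f hf n x hx
  have h2 := extendFun_eq hU hE φ hV e' f hf n' x' hx'
  have h3 := extendFun_eq hU hE φ hV (e + e') f hf (n + n') (f ^ n' • x + f ^ n • x') (by
    rw [map_add, map_add, secRes_smul, secRes_smul, hx, hx', map_pow, map_pow, smul_smul,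
      smul_smul, smul_add, pow_add, mul_comm])
  rw [φ.map_add, φ.map_smul, φ.map_smul, map_add, smul_eq_mul, smul_eq_mul, map_mul, map_mul,
    map_pow, map_pow] at h3
  refine (isUnit_fres_pow (S.basicOpen_le f) le_rfl (n + n')).mul_left_cancel ?_
  rw [h3, map_add, ← h1, ← h2]
  ring

lemma extendFun_smul {V : S.Opens} (hV : V ≤ U) (r : Γ(S, V)) (e : Γ(E, V)) :
    extendFun hU hE φ hV (r • e) = r * extendFun hU hE φ hV e := by
  refine fun_ext_basicOpen hU hV fun f hf => ?_
  obtain ⟨n, x, hx⟩ := (hE f).lift (secRes E hf e)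
  have := hU.isLocalization_basicOpen f
  obtain ⟨⟨a, ⟨_, m, rfl⟩⟩, ha⟩ := IsLocalization.surj (Submonoid.powers f) (fres hf r)
  replace ha : fres hf r * fres (S.basicOpen_le f) (f ^ m) = fres (S.basicOpen_le f) a := ha
  rw [map_pow] at ha
  have h1 := extendFun_eq hU hE φ hV e f hf n x hx
  have h3 := extendFun_eq hU hE φ hV (r • e) f hf (m + n) (a • x) (by
    rw [secRes_smul, hx, ← ha, secRes_smul, smul_smul, smul_smul, pow_add]
    congr 1
    ring)
  rw [φ.map_smul, smul_eq_mul, map_mul] at h3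
  refine (isUnit_fres_pow (S.basicOpen_le f) le_rfl (m + n)).mul_left_cancel ?_
  rw [h3, map_mul, ← h1, ← ha]
  ring

/-- A linear form on the sections over an affine open extends to all smaller opens. -/
def extend {V : S.Opens} (hV : V ≤ U) : Γ(E, V) →ₗ[Γ(S, V)] Γ(S, V) where
  toFun := extendFun hU hE φ hV
  map_add' := extendFun_add hU hE φ hV
  map_smul' := extendFun_smul hU hE φ hV

lemma extend_res {V W : S.Opens} (hV : V ≤ U) (hW : W ≤ V) (e : Γ(E, V)) :
    extend hU hE φ (hW.trans hV) (secRes E hW e) = fres hW (extend hU hE φ hV e) := by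
  refine eq_of_fractions (hW.trans hV) (secRes E hW e) (fun t => ?_) hU hE
  have h1 := extendFun_spec hU hE φ _ _ t
  have h2 := extendFun_spec hU hE φ hV e ⟨t.f, t.le.trans hW, t.n, t.x, by
    rw [t.eq, secRes_secRes]⟩
  refine (isUnit_fres_pow (S.basicOpen_le t.f) le_rfl t.n).mul_left_cancel ?_
  rw [fres_fres]
  exact h1.symm.trans h2

lemma extend_self (e : Γ(E, U)) : extend hU hE φ le_rfl e = φ e := by
  refine eq_of_fractions le_rfl e (fun t => ?_) hU hE
  have h1 := extendFun_eq hU hE φ le_rfl e t.f t.le 0 e (by rw [pow_zero, one_smul])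
  rwa [pow_zero, one_mul] at h1

/-- Compatible families of linear forms are determined by their value over an affine open. -/
lemma form_ext (hU : IsAffineOpen U) (hE : LocalizesOn E U) {V : S.Opens} (hV : V ≤ U)
    (φ ψ : ∀ V : S.Opens, V ≤ U → (Γ(E, V) →ₗ[Γ(S, V)] Γ(S, V)))
    (hφ : ∀ {V W : S.Opens} (hV : V ≤ U) (hW : W ≤ V) (e : Γ(E, V)),
      φ W (hW.trans hV) (secRes E hW e) = fres hW (φ V hV e))
    (hψ : ∀ {V W : S.Opens} (hV : V ≤ U) (hW : W ≤ V) (e : Γ(E, V)),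
      ψ W (hW.trans hV) (secRes E hW e) = fres hW (ψ V hV e))
    (h : ∀ e, φ U le_rfl e = ψ U le_rfl e) (e : Γ(E, V)) : φ V hV e = ψ V hV e := by
  refine eq_of_fractions hV e (fun t => ?_) hU hE
  refine (isUnit_fres_pow (S.basicOpen_le t.f) le_rfl t.n).mul_left_cancel ?_
  rw [← hφ hV t.le, ← hψ hV t.le, ← smul_eq_mul, ← smul_eq_mul, ← (φ _ _).map_smul,
    ← (ψ _ _).map_smul, ← t.eq, hφ le_rfl (S.basicOpen_le t.f), hψ le_rfl (S.basicOpen_le t.f), h]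

end Extend

/-! ### The dual sheaf -/

section Dual

variable (E : S.Modules)

/-- Families of linear forms on the sections over the opens contained in `W`. -/
def FormFamily (W : S.Opens) : Type u :=
  ∀ V : {V : S.Opens // V ≤ W}, (Γ(E, V.1) →ₗ[Γ(S, V.1)] Γ(S, V.1))

instance (W : S.Opens) : AddCommGroup (FormFamily E W) :=
  inferInstanceAs (AddCommGroup (∀ V : {V : S.Opens // V ≤ W}, (Γ(E, V.1) →ₗ[Γ(S, V.1)] Γ(S, V.1))))

instance (W : S.Opens) : Module Γ(S, W) (FormFamily E W) where
  smul r φ := fun V => fres V.2 r • φ V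
  one_smul φ := funext fun V => by
    change fres V.2 1 • φ V = φ V
    rw [map_one, one_smul]
  mul_smul r s φ := funext fun V => by
    change fres V.2 (r * s) • φ V = fres V.2 r • fres V.2 s • φ V
    rw [map_mul, mul_smul]
  smul_zero r := funext fun V => smul_zero (fres V.2 r)
  smul_add r φ ψ := funext fun V => smul_add (fres V.2 r) (φ V) (ψ V)
  add_smul r s φ := funext fun V => by
    change fres V.2 (r + s) • φ V = fres V.2 r • φ V + fres V.2 s • φ V
    rw [map_add, add_smul]
  zero_smul φ := funext fun V => by
    change fres V.2 0 • φ V = 0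
    rw [map_zero, zero_smul]

lemma FormFamily.smul_apply {W : S.Opens} (r : Γ(S, W)) (φ : FormFamily E W)
    (V : {V : S.Opens // V ≤ W}) (e : Γ(E, V.1)) : (r • φ) V e = fres V.2 r * φ V e := rfl

lemma FormFamily.add_apply {W : S.Opens} (φ ψ : FormFamily E W)
    (V : {V : S.Opens // V ≤ W}) (e : Γ(E, V.1)) : (φ + ψ) V e = φ V e + ψ V e := rfl

/-- The compatible families of linear forms. -/
def dualSections (W : S.Opens) : Submodule Γ(S, W) (FormFamily E W) where
  carrier := {φ | ∀ (V V' : S.Opens) (hV : V ≤ W) (h : V' ≤ V) (e : Γ(E, V)),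
    φ ⟨V', h.trans hV⟩ (secRes E h e) = fres h (φ ⟨V, hV⟩ e)}
  zero_mem' V V' hV h e := by
    change (0 : Γ(S, V')) = fres h 0
    rw [map_zero]
  add_mem' hφ hψ V V' hV h e := by
    rw [FormFamily.add_apply, FormFamily.add_apply, hφ V V' hV h, hψ V V' hV h, map_add]
  smul_mem' r φ hφ V V' hV h e := by
    rw [FormFamily.smul_apply, FormFamily.smul_apply, hφ V V' hV h, map_mul, fres_fres]

/-- The sheaf data of the dual of `E`. -/
def dualData : SheafData S where
  obj W := dualSections E W
  res {U V} h :=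
    { toFun φ := ⟨fun V' => φ.1 ⟨V'.1, V'.2.trans h⟩, fun V' V'' hV' h' e =>
        φ.2 V' V'' (hV'.trans h) h' e⟩
      map_add' _ _ := rfl
      map_smul' r φ := by
        apply Subtype.ext
        funext V'
        ext e
        change fres (V'.2.trans h) r * φ.1 ⟨V'.1, V'.2.trans h⟩ e =
          fres V'.2 (fres h r) * φ.1 ⟨V'.1, V'.2.trans h⟩ e
        rw [fres_fres] }
  res_rfl _ := rfl
  res_res _ _ _ := rfl
  ext {J} V φ ψ h := by
    apply Subtype.ext
    funext W
    ext e
    refine fun_ext (fun j : J => W.1 ⊓ V j) (fun j => inf_le_left) ?_ fun j => ?_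
    · rw [← inf_iSup_eq]
      exact le_inf le_rfl W.2
    · rw [← φ.2 W.1 _ W.2 inf_le_left, ← ψ.2 W.1 _ W.2 inf_le_left]
      have := congrFun (congrArg Subtype.val (h j)) ⟨W.1 ⊓ V j, inf_le_right⟩
      exact congrArg (fun l => l (secRes E inf_le_left e)) this
  glue {J} V φ h := by
    have hco (j k : J) (W : S.Opens) (hj : W ≤ V j) (hk : W ≤ V k) (e : Γ(E, W)) :
        (φ j).1 ⟨W, hj⟩ e = (φ k).1 ⟨W, hk⟩ e :=
      congrArg (fun l => l e) (congrFun (congrArg Subtype.val (h j k)) ⟨W, le_inf hj hk⟩)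
    have hcov (W : S.Opens) (hW : W ≤ ⨆ j, V j) : W ≤ ⨆ j, W ⊓ V j := by
      rw [← inf_iSup_eq]
      exact le_inf le_rfl hW
    -- An open `W` inside the union need not lie in any single `V j`, so the value of the glued form
    -- at e is itself glued from its values on the intersections `W ⊓ V j`.
    have hex (W : S.Opens) (hW : W ≤ ⨆ j, V j) (e : Γ(E, W)) : ∃ y : Γ(S, W), ∀ j,
        fres inf_le_left y = (φ j).1 ⟨W ⊓ V j, inf_le_right⟩ (secRes E inf_le_left e) := by
      refine fun_glue (fun j => W ⊓ V j) (fun j => inf_le_left) (hcov W hW) _ fun j k => ?_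
      rw [← (φ j).2, ← (φ k).2, secRes_secRes, secRes_secRes]
      exact hco j k _ _ _ _
    choose y hy using hex
    refine ⟨⟨fun W =>
      { toFun := y W.1 W.2
        map_add' := fun e e' => ?_
        map_smul' := fun r e => ?_ }, fun W W' hW hW' e => ?_⟩, fun j => ?_⟩
    · refine fun_ext _ (fun j => inf_le_left) (hcov _ W.2) fun j => ?_
      rw [map_add, hy, hy, hy, map_add, map_add]
    · refine fun_ext _ (fun j => inf_le_left) (hcov _ W.2) fun j => ?_
      rw [hy, secRes_smul, map_smul, RingHom.id_apply, smul_eq_mul, smul_eq_mul, map_mul, hy]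
    · refine fun_ext _ (fun j => inf_le_left) (hcov _ (hW'.trans hW)) fun j => ?_
      change fres _ (y W' _ (secRes E hW' e)) = fres _ (fres hW' (y W hW e))
      rw [hy, fres_fres, secRes_secRes,
        ← fres_fres inf_le_left (inf_le_inf_right _ hW' : W' ⊓ V j ≤ W ⊓ V j), hy, ← (φ j).2,
        secRes_secRes]
    · apply Subtype.ext
      funext W
      ext e
      refine fun_ext (fun k => W.1 ⊓ V k) (fun k => inf_le_left)
        (hcov _ (W.2.trans (le_iSup V j))) fun k => ?_
      change fres _ (y W.1 _ e) = fres _ ((φ j).1 W e)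
      rw [hy, ← (φ j).2 W.1 _ W.2 inf_le_left]
      exact hco k j _ _ _ _

/-- The dual of a sheaf of modules. -/
def dual : S.Modules := (dualData E).toModules

/-- The evaluation of sections of the dual. -/
def dualEval {W : S.Opens} (φ : Γ(dual E, W)) {V : S.Opens} (h : V ≤ W) :
    Γ(E, V) →ₗ[Γ(S, V)] Γ(S, V) :=
  (show dualSections E W from φ).1 ⟨V, h⟩

variable {E}

lemma dualEval_res {W : S.Opens} (φ : Γ(dual E, W)) {V V' : S.Opens} (h : V ≤ W) (h' : V' ≤ V)
    (e : Γ(E, V)) : dualEval E φ (h'.trans h) (secRes E h' e) = fres h' (dualEval E φ h e) :=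
  (show dualSections E W from φ).2 V V' h h' e

lemma dualEval_secRes {W W' : S.Opens} (φ : Γ(dual E, W)) (hW : W' ≤ W) {V : S.Opens}
    (h : V ≤ W') (e : Γ(E, V)) :
    dualEval E (secRes (dual E) hW φ) h e = dualEval E φ (h.trans hW) e := rfl

lemma dualEval_smul {W : S.Opens} (r : Γ(S, W)) (φ : Γ(dual E, W)) {V : S.Opens} (h : V ≤ W)
    (e : Γ(E, V)) : dualEval E (r • φ) h e = fres h r * dualEval E φ h e := rfl

lemma dualEval_add {W : S.Opens} (φ ψ : Γ(dual E, W)) {V : S.Opens} (h : V ≤ W)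
    (e : Γ(E, V)) : dualEval E (φ + ψ) h e = dualEval E φ h e + dualEval E ψ h e := rfl

/-- The sections of the dual of a quasi-coherent sheaf over an affine open. -/
def dualEquiv (hE : E.IsQuasicoherent) {U : S.Opens} (hU : IsAffineOpen U) :
    Γ(dual E, U) ≃ₗ[Γ(S, U)] Module.Dual Γ(S, U) Γ(E, U) :=
  have hL : LocalizesOn E U := localizesOn_of_isQuasicoherent E hU
  LinearEquiv.ofBijective
    { toFun φ := dualEval E φ le_rfl
      map_add' φ ψ := rfl
      map_smul' r φ := by
        ext e
        rw [dualEval_smul, fres_rfl]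
        rfl } (by
    constructor
    · intro φ ψ h
      apply Subtype.ext
      funext V
      ext e
      exact form_ext hU hL V.2 (fun V hV => dualEval E φ hV) (fun V hV => dualEval E ψ hV)
        (dualEval_res φ) (dualEval_res ψ) (fun e => congrArg (fun l => l e) h) e
    · intro φ
      refine ⟨(show dualSections E U from ⟨fun V => extend hU hL φ V.2, fun V V' hV h e =>
        extend_res hU hL φ hV h e⟩), ?_⟩
      ext e
      exact extend_self hU hL φ e)

end Dual

/-! ### Invariant functionals and Reynolds operators -/

section Reynolds

open TensorProduct

variable {R A B M N : Type*} [CommRing R] [CommRing A] [Algebra R A] [CommRing B] [Algebra R B]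
  [AddCommGroup M] [Module R M] [AddCommGroup N] [Module R N]

/-- Contraction of the first factor by a functional. -/
def contr (ρ : A →ₗ[R] R) (M : Type*) [AddCommGroup M] [Module R M] : A ⊗[R] M →ₗ[R] M :=
  (TensorProduct.lid R M).toLinearMap ∘ₗ ρ.rTensor M

@[simp] lemma contr_tmul (ρ : A →ₗ[R] R) (a : A) (m : M) : contr ρ M (a ⊗ₜ m) = ρ a • m := by
  simp [contr]

lemma contr_lTensor (ρ : A →ₗ[R] R) (f : M →ₗ[R] N) (z : A ⊗[R] M) :
    contr ρ N (f.lTensor A z) = f (contr ρ M z) := by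
  induction z with
  | zero => simp
  | add x y hx hy => simp only [map_add, hx, hy]
  | tmul a m => simp

variable (Δ : A →ₐ[R] A ⊗[R] A) (σ : A →ₐ[R] A) (ρ : A →ₗ[R] R)

/-- Left invariance of a functional on a bialgebra. -/
def LeftInv : Prop := ∀ a, ρ.lTensor A (Δ a) = (1 : A) ⊗ₜ[R] ρ a

/-- Right invariance of a functional on a bialgebra. -/
def RightInv : Prop := ∀ a, contr ρ A (Δ a) = ρ a • (1 : A)

variable {Δ σ ρ}

section

variable (hσ : ∀ a, σ (σ a) = a)
  (hσΔ : ∀ a, Δ (σ a) = Algebra.TensorProduct.comm R A A (Algebra.TensorProduct.map σ σ (Δ a)))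

-- Inversion exchanges left and right translations.
include hσ hσΔ in
lemma rightInv_comp_antipode (h : LeftInv Δ ρ) : RightInv Δ (ρ ∘ₗ σ.toLinearMap) := by
  intro a
  have key (z : A ⊗[R] A) : contr (ρ ∘ₗ σ.toLinearMap) A z =
      σ (TensorProduct.rid R A (ρ.lTensor A
        (Algebra.TensorProduct.comm R A A (Algebra.TensorProduct.map σ σ z)))) := by
    induction z with
    | zero => simp
    | add x y hx hy => simp only [map_add, hx, hy]
    | tmul a b => simp [hσ]
  rw [key, ← hσΔ, h]
  simp

-- Fubini: integrate Δ a against ρ ∘ σ in the first variable and ρ in the second. Right invariance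
-- of ρ ∘ σ yields ρ(σ a), left invariance of ρ yields ρ(a); both use ρ(1) = 1.
include hσ hσΔ in
lemma comp_antipode_eq (h : LeftInv Δ ρ) (h1 : ρ 1 = 1) (a : A) : ρ (σ a) = ρ a := by
  have key (z : A ⊗[R] A) : ρ (contr (ρ ∘ₗ σ.toLinearMap) A z) =
      ρ (σ (TensorProduct.rid R A (ρ.lTensor A z))) := by
    induction z with
    | zero => simp
    | add x y hx hy => simp only [map_add, hx, hy]
    | tmul a b => simp [mul_comm]
  have := key (Δ a)
  rw [rightInv_comp_antipode hσ hσΔ h, h] at this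
  simpa [h1] using this

include hσ hσΔ in
lemma rightInv_of_leftInv (h : LeftInv Δ ρ) (h1 : ρ 1 = 1) : RightInv Δ ρ := by
  have : ρ ∘ₗ σ.toLinearMap = ρ := LinearMap.ext (comp_antipode_eq hσ hσΔ h h1)
  have h2 := rightInv_comp_antipode hσ hσΔ h
  rwa [this] at h2

end

/-- Coassociativity of a coaction. -/
def Coassoc (Δ : A →ₐ[R] A ⊗[R] A) (δ : M →ₗ[R] A ⊗[R] M) : Prop :=
  ∀ m, δ.lTensor A (δ m) = TensorProduct.assoc R A A M (Δ.toLinearMap.rTensor M (δ m))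

/-- The Reynolds operator. -/
def reynolds (ρ : A →ₗ[R] R) (δ : M →ₗ[R] A ⊗[R] M) : M →ₗ[R] M := contr ρ M ∘ₗ δ

variable {δ : M →ₗ[R] A ⊗[R] M}

/-- Averaging is constant along orbits: coassociativity turns the left side into (1 ⊗ ρ ⊗ 1)(Δ ⊗ 1)δ
m, and left invariance makes the group variable disappear. -/
lemma lTensor_reynolds (h : LeftInv Δ ρ) (hδ : Coassoc Δ δ) (m : M) :
    (reynolds ρ δ).lTensor A (δ m) = (1 : A) ⊗ₜ reynolds ρ δ m := by
  have key (z : A ⊗[R] M) : (contr ρ M).lTensor A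
      (TensorProduct.assoc R A A M (Δ.toLinearMap.rTensor M z)) = (1 : A) ⊗ₜ contr ρ M z := by
    induction z with
    | zero => simp
    | add x y hx hy => simp only [map_add, hx, hy, tmul_add]
    | tmul a m =>
      have k2 (w : A ⊗[R] A) : (contr ρ M).lTensor A (TensorProduct.assoc R A A M (w ⊗ₜ m)) =
          (TensorProduct.mk R A M).flip m (TensorProduct.rid R A (ρ.lTensor A w)) := by
        induction w with
        | zero => simp
        | add x y hx hy => simp only [map_add, add_tmul, hx, hy]
        | tmul a b => simp
      rw [LinearMap.rTensor_tmul, k2]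
      simp only [AlgHom.toLinearMap_apply, h a]
      simp
  rw [reynolds, LinearMap.lTensor_comp, LinearMap.comp_apply, hδ m, key]
  rfl

/-- The counterpart for right invariance: an average is a fixed element. -/
lemma coact_reynolds (h : RightInv Δ ρ) (hδ : Coassoc Δ δ) (m : M) :
    δ (reynolds ρ δ m) = (1 : A) ⊗ₜ reynolds ρ δ m := by
  have key (z : A ⊗[R] M) : contr ρ (A ⊗[R] M)
      (TensorProduct.assoc R A A M (Δ.toLinearMap.rTensor M z)) = (1 : A) ⊗ₜ contr ρ M z := by
    induction z with
    | zero => simp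
    | add x y hx hy => simp only [map_add, hx, hy, tmul_add]
    | tmul a m =>
      have k2 (w : A ⊗[R] A) : contr ρ (A ⊗[R] M) (TensorProduct.assoc R A A M (w ⊗ₜ m)) =
          (TensorProduct.mk R A M).flip m (contr ρ A w) := by
        induction w with
        | zero => simp
        | add x y hx hy => simp only [map_add, add_tmul, hx, hy]
        | tmul a b => simp [smul_tmul']
      rw [LinearMap.rTensor_tmul, k2]
      simp only [AlgHom.toLinearMap_apply, h a]
      simp
  rw [reynolds, LinearMap.comp_apply, ← contr_lTensor, hδ m, key]

lemma reynolds_eq_self (h1 : ρ 1 = 1) {m : M} (hm : δ m = (1 : A) ⊗ₜ m) : reynolds ρ δ m = m := by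
  simp [reynolds, hm, h1]

lemma reynolds_idem (h : RightInv Δ ρ) (hδ : Coassoc Δ δ) (h1 : ρ 1 = 1) (m : M) :
    reynolds ρ δ (reynolds ρ δ m) = reynolds ρ δ m :=
  reynolds_eq_self h1 (coact_reynolds h hδ m)

lemma reynolds_comm {δ' : N →ₗ[R] A ⊗[R] N} (f : M →ₗ[R] N)
    (hf : ∀ m, δ' (f m) = f.lTensor A (δ m)) (m : M) :
    reynolds ρ δ' (f m) = f (reynolds ρ δ m) := by
  simp only [reynolds, LinearMap.comp_apply, hf, contr_lTensor]

/-! Reynolds operators of normal subgroups -/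

section Normal

variable {ΔB : B →ₐ[R] B ⊗[R] B} {i : A →ₐ[R] B} {ρ : B →ₗ[R] R}

lemma coassoc_via (hi : ∀ a, ΔB (i a) = Algebra.TensorProduct.map i i (Δ a)) (hδ : Coassoc Δ δ) :
    Coassoc ΔB (i.toLinearMap.rTensor M ∘ₗ δ) := by
  intro m
  have k1 (z : A ⊗[R] M) : (i.toLinearMap.rTensor M ∘ₗ δ).lTensor B (i.toLinearMap.rTensor M z) =
      TensorProduct.map i.toLinearMap (i.toLinearMap.rTensor M) (δ.lTensor A z) := by
    induction z with
    | zero => simp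
    | add x y hx hy => simp only [map_add, hx, hy]
    | tmul a m => simp
  have k2 (z : A ⊗[R] M) : TensorProduct.map i.toLinearMap (i.toLinearMap.rTensor M)
      (TensorProduct.assoc R A A M (Δ.toLinearMap.rTensor M z)) =
      TensorProduct.assoc R B B M (ΔB.toLinearMap.rTensor M (i.toLinearMap.rTensor M z)) := by
    induction z with
    | zero => simp
    | add x y hx hy => simp only [map_add, hx, hy]
    | tmul a m =>
      simp only [LinearMap.rTensor_tmul, AlgHom.toLinearMap_apply, hi]
      generalize Δ a = w
      induction w with
      | zero => simp
      | add x y hx hy => simp only [map_add, add_tmul, hx, hy]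
      | tmul a b => simp
  rw [LinearMap.comp_apply, k1, hδ m, k2]

variable {θ : A ⊗[R] B →ₐ[R] B ⊗[R] A} {θ' : B ⊗[R] A →ₐ[R] A ⊗[R] B}

/-- Acting first by one group and then by the other is the action of the product. This lemma and the
next one treat the two orders of the subgroup and the ambient group, which normality will compare.
-/
lemma coassoc_left (hδ : Coassoc Δ δ) (m : M) :
    δ.lTensor B (i.toLinearMap.rTensor M (δ m)) = TensorProduct.assoc R B A M
      ((Algebra.TensorProduct.map i (AlgHom.id R A)).toLinearMap.rTensor M
        (Δ.toLinearMap.rTensor M (δ m))) := by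
  have k1 (z : A ⊗[R] M) : δ.lTensor B (i.toLinearMap.rTensor M z) =
      i.toLinearMap.rTensor (A ⊗[R] M) (δ.lTensor A z) := by
    induction z with
    | zero => simp
    | add x y hx hy => simp only [map_add, hx, hy]
    | tmul a m => simp
  have k2 (z : (A ⊗[R] A) ⊗[R] M) : i.toLinearMap.rTensor (A ⊗[R] M) (TensorProduct.assoc R A A M z)
      = TensorProduct.assoc R B A M
        ((Algebra.TensorProduct.map i (AlgHom.id R A)).toLinearMap.rTensor M z) := by
    induction z with
    | zero => simp
    | add x y hx hy => simp only [map_add, hx, hy]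
    | tmul w m =>
      induction w with
      | zero => simp
      | add x y hx hy => simp only [map_add, add_tmul, hx, hy]
      | tmul a b => simp
  rw [k1, hδ, k2]

lemma coassoc_right (hδ : Coassoc Δ δ) (m : M) :
    (i.toLinearMap.rTensor M ∘ₗ δ).lTensor A (δ m) = TensorProduct.assoc R A B M
      ((Algebra.TensorProduct.map (AlgHom.id R A) i).toLinearMap.rTensor M
        (Δ.toLinearMap.rTensor M (δ m))) := by
  have k2 (z : (A ⊗[R] A) ⊗[R] M) : (i.toLinearMap.rTensor M).lTensor A
      (TensorProduct.assoc R A A M z) = TensorProduct.assoc R A B M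
        ((Algebra.TensorProduct.map (AlgHom.id R A) i).toLinearMap.rTensor M z) := by
    induction z with
    | zero => simp
    | add x y hx hy => simp only [map_add, hx, hy]
    | tmul w m =>
      induction w with
      | zero => simp
      | add x y hx hy => simp only [map_add, add_tmul, hx, hy]
      | tmul a b => simp
  rw [LinearMap.lTensor_comp, LinearMap.comp_apply, hδ, k2]

/-- The Reynolds operator of a normal subgroup is equivariant under the ambient group. -/
theorem coact_reynolds_of_normal
    (hi : ∀ a, ΔB (i a) = Algebra.TensorProduct.map i i (Δ a)) (hδ : Coassoc Δ δ)
    (hl : LeftInv ΔB ρ) (hr : RightInv ΔB ρ) (h1 : ρ 1 = 1)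
    (hθ : ∀ a, θ (Algebra.TensorProduct.map (AlgHom.id R A) i (Δ a)) =
      Algebra.TensorProduct.map i (AlgHom.id R A) (Δ a))
    (hθ1 : ∀ a, θ (a ⊗ₜ 1) = 1 ⊗ₜ a)
    (hθ' : ∀ a, θ' (Algebra.TensorProduct.map i (AlgHom.id R A) (Δ a)) =
      Algebra.TensorProduct.map (AlgHom.id R A) i (Δ a))
    (hθ1' : ∀ a, θ' (1 ⊗ₜ a) = a ⊗ₜ 1) (m : M) :
    δ (reynolds ρ (i.toLinearMap.rTensor M ∘ₗ δ) m) =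
      (reynolds ρ (i.toLinearMap.rTensor M ∘ₗ δ)).lTensor A (δ m) := by
  set δC := i.toLinearMap.rTensor M ∘ₗ δ with hδC
  set Q := reynolds ρ δC with hQ
  have hco : Coassoc ΔB δC := coassoc_via hi hδ
  -- θ is the substitution (c, g) ↦ (g, g⁻¹cg) and θ' is (g, c) ↦ (gcg⁻¹, g). Both preserve the
  -- product in `G`, which is what these two identities of linear maps say.
  have hθL : θ.toLinearMap ∘ₗ (Algebra.TensorProduct.map (AlgHom.id R A) i).toLinearMap ∘ₗ
      Δ.toLinearMap = (Algebra.TensorProduct.map i (AlgHom.id R A)).toLinearMap ∘ₗ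
      Δ.toLinearMap := LinearMap.ext hθ
  have hθL' : θ'.toLinearMap ∘ₗ (Algebra.TensorProduct.map i (AlgHom.id R A)).toLinearMap ∘ₗ
      Δ.toLinearMap = (Algebra.TensorProduct.map (AlgHom.id R A) i).toLinearMap ∘ₗ
      Δ.toLinearMap := LinearMap.ext hθ'
  -- `Q ∘ δ` is invariant under translation of the argument by the subgroup
  have N' : (Q.lTensor A ∘ₗ δ).lTensor B (δC m) = (1 : B) ⊗ₜ[R] Q.lTensor A (δ m) := by
    have e1 (z : (B ⊗[R] A) ⊗[R] M) : (Q.lTensor A).lTensor B (TensorProduct.assoc R B A M z) =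
        TensorProduct.assoc R B A M (Q.lTensor (B ⊗[R] A) z) := by
      induction z with
      | zero => simp
      | add x y hx hy => simp only [map_add, hx, hy]
      | tmul w m =>
        induction w with
        | zero => simp
        | add x y hx hy => simp only [map_add, add_tmul, hx, hy]
        | tmul a b => simp
    have e2 (z : A ⊗[R] (B ⊗[R] M)) : TensorProduct.assoc R B A M (Q.lTensor (B ⊗[R] A)
        (θ.toLinearMap.rTensor M ((TensorProduct.assoc R A B M).symm z))) =
        TensorProduct.assoc R B A M (θ.toLinearMap.rTensor M ((TensorProduct.assoc R A B M).symm
          ((Q.lTensor B).lTensor A z))) := by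
      induction z with
      | zero => simp
      | add x y hx hy => simp only [map_add, hx, hy]
      | tmul a w =>
        induction w with
        | zero => simp
        | add x y hx hy => simp only [map_add, tmul_add, hx, hy]
        | tmul b m => simp
    have e3 (z : A ⊗[R] M) : TensorProduct.assoc R B A M (θ.toLinearMap.rTensor M
        ((TensorProduct.assoc R A B M).symm ((TensorProduct.mk R B M 1 ∘ₗ Q).lTensor A z))) =
        (1 : B) ⊗ₜ Q.lTensor A z := by
      induction z with
      | zero => simp
      | add x y hx hy => simp only [map_add, hx, hy, tmul_add]
      | tmul a m => simp [hθ1]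
    have e4 : Q.lTensor B ∘ₗ δC = TensorProduct.mk R B M 1 ∘ₗ Q :=
      LinearMap.ext fun m => lTensor_reynolds hl hco m
    rw [LinearMap.lTensor_comp, LinearMap.comp_apply, hδC, LinearMap.comp_apply,
      coassoc_left hδ, e1]
    rw [← LinearMap.comp_apply (LinearMap.rTensor M _), ← LinearMap.rTensor_comp, ← hθL,
      LinearMap.rTensor_comp, LinearMap.rTensor_comp, LinearMap.comp_apply, LinearMap.comp_apply,
      ← (TensorProduct.assoc R A B M).symm_apply_apply (LinearMap.rTensor M _ _),
      ← coassoc_right hδ, e2, ← LinearMap.comp_apply (LinearMap.lTensor A _),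
      ← LinearMap.lTensor_comp, ← hδC, e4, e3]
  -- Integrating over the subgroup variable replaces m by Q m on the left and changes nothing on the
  -- right.
  have h2 : Q.lTensor A (δ (Q m)) = Q.lTensor A (δ m) := by
    have := congrArg (contr ρ (A ⊗[R] M)) N'
    rw [contr_lTensor, contr_tmul, h1, one_smul] at this
    exact this
  -- the invariants are stable under the ambient group
  have hfix : δC (Q m) = (1 : B) ⊗ₜ Q m := coact_reynolds hr hco m
  have N : δC.lTensor A (δ (Q m)) = (TensorProduct.mk R B M 1).lTensor A (δ (Q m)) := by
    have e5 (z : A ⊗[R] M) : TensorProduct.assoc R A B M (θ'.toLinearMap.rTensor M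
        ((TensorProduct.assoc R B A M).symm ((1 : B) ⊗ₜ z))) =
        (TensorProduct.mk R B M 1).lTensor A z := by
      induction z with
      | zero => simp
      | add x y hx hy => simp only [map_add, hx, hy, tmul_add]
      | tmul a m => simp [hθ1']
    have e6 := coassoc_left (i := i) hδ (Q m)
    rw [← LinearMap.comp_apply (LinearMap.rTensor M _) δ, ← hδC, hfix, LinearMap.lTensor_tmul] at e6
    rw [hδC, coassoc_right hδ, ← LinearMap.comp_apply (LinearMap.rTensor M _),
      ← LinearMap.rTensor_comp, ← hθL', LinearMap.rTensor_comp, LinearMap.rTensor_comp,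
      LinearMap.comp_apply, LinearMap.comp_apply,
      ← (TensorProduct.assoc R B A M).symm_apply_apply (LinearMap.rTensor M _ _), ← e6, e5]
  -- The coefficients of δ (Q m) are fixed by the subgroup, so averaging them changes nothing.
  have h3 : Q.lTensor A (δ (Q m)) = δ (Q m) := by
    have := congrArg ((contr ρ M).lTensor A) N
    rw [← LinearMap.comp_apply (LinearMap.lTensor A _), ← LinearMap.lTensor_comp] at this
    refine this.trans ?_
    rw [← LinearMap.comp_apply (LinearMap.lTensor A _), ← LinearMap.lTensor_comp]
    have : contr ρ M ∘ₗ TensorProduct.mk R B M 1 = LinearMap.id := by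
      ext m
      simp [h1]
    rw [this, LinearMap.lTensor_id, LinearMap.id_apply]
  -- δ Q = (1 ⊗ Q) δ Q = (1 ⊗ Q) δ.
  rw [← h3, h2]

end Normal

end Reynolds

/-! ### Dual comodules -/

section DualComodule

open TensorProduct

variable {R A B C M N Q : Type*} [CommRing R] [CommRing A] [Algebra R A] [CommRing C] [Algebra R C]
  [CommRing Q] [Algebra R Q]
  [AddCommGroup B] [Module R B] [AddCommGroup M] [Module R M] [AddCommGroup N] [Module R N]

lemma exists_dual_basis [Module.Finite R M] [Module.Projective R M] :
    ∃ (n : ℕ) (e : Fin n → M) (e' : Fin n → Module.Dual R M), ∀ m, ∑ j, e' j m • e j = m := by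
  obtain ⟨n, f, g, -, -, h⟩ := Module.Finite.exists_comp_eq_id_of_projective R M
  refine ⟨n, fun j => f (Pi.single j 1), fun j => LinearMap.proj j ∘ₗ g, fun m => ?_⟩
  have : f (g m) = m := LinearMap.congr_fun h m
  conv_rhs => rw [← this, pi_eq_sum_univ' (g m), map_sum]
  refine Finset.sum_congr rfl fun j _ => ?_
  rw [map_smul]
  rfl

/-- Evaluation of an element of `B ⊗ M^∨` at an element of `M`. -/
def ev (κ : N →ₗ[R] Module.Dual R M) (B : Type*) [AddCommGroup B] [Module R B] :
    B ⊗[R] N →ₗ[R] M →ₗ[R] B :=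
  TensorProduct.lift (LinearMap.mk₂ R (fun b n => (κ n).smulRight b)
    (fun b b' n => by ext m; simp) (fun r b n => by ext m; simp [smul_comm r])
    (fun b n n' => by ext m; simp [add_smul]) (fun r b n => by ext m; simp [mul_smul]))

@[simp] lemma ev_tmul (κ : N →ₗ[R] Module.Dual R M) (b : B) (n : N) (m : M) :
    ev κ B (b ⊗ₜ n) m = κ n m • b := by
  simp [ev]

lemma ev_rTensor {B' : Type*} [AddCommGroup B'] [Module R B'] (κ : N →ₗ[R] Module.Dual R M)
    (f : B →ₗ[R] B') (z : B ⊗[R] N) (m : M) : ev κ B' (f.rTensor N z) m = f (ev κ B z m) := by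
  induction z with
  | zero => simp
  | add x y hx hy => simp only [map_add, LinearMap.add_apply, hx, hy]
  | tmul a m => simp

variable [Module.Finite R M] [Module.Projective R M] (κ : N ≃ₗ[R] Module.Dual R M)

-- The inverse comes from a dual basis: g ↦ ∑ g(e_j) ⊗ e'_j. The dual is replaced by a module `N`
-- identified with it through κ, so that sections of the dual sheaf can be inserted directly.
variable (B) in
lemma ev_bijective : Function.Bijective (ev κ.toLinearMap B) := by
  obtain ⟨n, e, e', h⟩ := exists_dual_basis (R := R) (M := M)
  constructor
  · refine Function.LeftInverse.injective
      (g := fun g : M →ₗ[R] B => ∑ j, g (e j) ⊗ₜ[R] κ.symm (e' j)) fun z => ?_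
    induction z with
    | zero => simp
    | add x y hx hy => simp only [map_add, LinearMap.add_apply, add_tmul, Finset.sum_add_distrib, hx, hy]
    | tmul b x =>
      simp only [ev_tmul, smul_tmul, ← tmul_sum]
      congr 1
      apply κ.injective
      ext m
      simp only [map_sum, map_smul, LinearEquiv.apply_symm_apply, LinearMap.sum_apply,
        LinearMap.smul_apply, smul_eq_mul, LinearEquiv.coe_coe]
      conv_rhs => rw [← h m]
      simp [mul_comm]
  · intro g
    refine ⟨∑ j, g (e j) ⊗ₜ κ.symm (e' j), ?_⟩
    ext m
    simp only [map_sum, LinearMap.sum_apply, ev_tmul, LinearEquiv.coe_coe,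
      LinearEquiv.apply_symm_apply]
    conv_rhs => rw [← h m]
    simp

variable (B) in
/-- `B ⊗ M^∨ ≃ Hom(M, B)` for a finite projective module `M`. -/
def evEquiv : B ⊗[R] N ≃ₗ[R] M →ₗ[R] B := LinearEquiv.ofBijective _ (ev_bijective B κ)

@[simp] lemma ev_evEquiv_symm (g : M →ₗ[R] B) :
    ev κ.toLinearMap B ((evEquiv B κ).symm g) = g :=
  (evEquiv B κ).apply_symm_apply g

lemma ev_ext {z z' : B ⊗[R] N} (h : ∀ m, ev κ.toLinearMap B z m = ev κ.toLinearMap B z' m) :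
    z = z' :=
  (ev_bijective B κ).1 (LinearMap.ext h)

/-- The coaction contracted with a linear form. -/
def coeff (δ : M →ₗ[R] A ⊗[R] M) (φ : Module.Dual R M) : M →ₗ[R] A :=
  (TensorProduct.rid R A).toLinearMap ∘ₗ φ.lTensor A ∘ₗ δ

variable (σ : A →ₐ[R] A) (δ : M →ₗ[R] A ⊗[R] M)

/-- The dual coaction. -/
def dualCoact : N →ₗ[R] A ⊗[R] N :=
  (evEquiv A κ).symm.toLinearMap ∘ₗ LinearMap.mk
    -- The contragredient action (gφ)(m) = φ(g⁻¹m): the matrix coefficient g ↦ φ(gm), composed with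
    -- inversion.
    { toFun := fun n => σ.toLinearMap ∘ₗ coeff δ (κ n)
      map_add' := fun x y => by
        ext m; simp [coeff, LinearMap.lTensor_add] }
    (fun r x => by ext m; simp [coeff, LinearMap.lTensor_smul])

@[simp] lemma ev_dualCoact (n : N) (m : M) :
    ev κ.toLinearMap A (dualCoact κ σ δ n) m = σ (coeff δ (κ n) m) := by
  simp [dualCoact]

variable {σ δ} {Δ : A →ₐ[R] A ⊗[R] A} {ε : A →ₐ[R] R}

lemma counit_dualCoact (hε : ∀ a, ε (σ a) = ε a)
    (hδ : ∀ m, TensorProduct.lid R M (ε.toLinearMap.rTensor M (δ m)) = m) (n : N) :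
    TensorProduct.lid R N (ε.toLinearMap.rTensor N (dualCoact κ σ δ n)) = n := by
  apply κ.injective
  ext m
  have k (z : A ⊗[R] N) : κ (TensorProduct.lid R N (ε.toLinearMap.rTensor N z)) m =
      ε (ev κ.toLinearMap A z m) := by
    induction z with
    | zero => simp
    | add x y hx hy => simp only [map_add, LinearMap.add_apply, hx, hy]
    | tmul a m => simp [mul_comm]
  have k2 (φ : Module.Dual R M) (z : A ⊗[R] M) : ε (TensorProduct.rid R A (φ.lTensor A z)) =
      φ (TensorProduct.lid R M (ε.toLinearMap.rTensor M z)) := by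
    induction z with
    | zero => simp
    | add x y hx hy => simp only [map_add, hx, hy]
    | tmul a m => simp [mul_comm]
  rw [k, ev_dualCoact, hε, coeff, LinearMap.comp_apply, LinearMap.comp_apply]
  exact (k2 _ _).trans (by rw [hδ])

/-- Dualizing reverses the order of a product and inversion reverses it once more. The identity is
tested by evaluating at elements of `M`. -/
lemma coassoc_dualCoact
    (hσΔ : ∀ a, Δ (σ a) = Algebra.TensorProduct.comm R A A (Algebra.TensorProduct.map σ σ (Δ a)))
    (hδ : Coassoc Δ δ) : Coassoc Δ (dualCoact κ σ δ) := by
  intro n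
  apply (TensorProduct.assoc R A A N).symm.injective
  rw [LinearEquiv.symm_apply_apply]
  apply ev_ext κ
  intro m
  rw [ev_rTensor, ev_dualCoact]
  have k1 (z : A ⊗[R] N) : ev κ.toLinearMap (A ⊗[R] A) ((TensorProduct.assoc R A A N).symm
      ((dualCoact κ σ δ).lTensor A z)) m =
      TensorProduct.comm R A A (TensorProduct.map σ.toLinearMap (ev κ.toLinearMap A z) (δ m)) := by
    induction z with
    | zero => simp
    | add x y hx hy => simp only [map_add, LinearMap.add_apply, hx, hy, TensorProduct.map_add_right]
    | tmul a n =>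
      rw [LinearMap.lTensor_tmul]
      have k2 (w : A ⊗[R] N) : ev κ.toLinearMap (A ⊗[R] A) ((TensorProduct.assoc R A A N).symm
          (a ⊗ₜ w)) m = a ⊗ₜ ev κ.toLinearMap A w m := by
        induction w with
        | zero => simp
        | add x y hx hy => simp only [map_add, tmul_add, LinearMap.add_apply, hx, hy]
        | tmul b n => simp
      rw [k2, ev_dualCoact, coeff, LinearMap.comp_apply, LinearMap.comp_apply]
      generalize δ m = v
      induction v with
      | zero => simp
      | add x y hx hy => simp only [map_add, tmul_add, hx, hy]
      | tmul b m => simp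
  have k3 : ev κ.toLinearMap A (dualCoact κ σ δ n) = σ.toLinearMap ∘ₗ coeff δ (κ n) :=
    LinearMap.ext fun m => ev_dualCoact κ σ δ n m
  rw [k1, k3]
  simp only [AlgHom.toLinearMap_apply, hσΔ]
  have k4 (v : A ⊗[R] M) : TensorProduct.map σ.toLinearMap (σ.toLinearMap ∘ₗ coeff δ (κ n)) v =
      TensorProduct.map σ.toLinearMap σ.toLinearMap
        (((TensorProduct.rid R A).toLinearMap ∘ₗ (κ n).lTensor A).lTensor A (δ.lTensor A v)) := by
    induction v with
    | zero => simp
    | add x y hx hy => simp only [map_add, hx, hy]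
    | tmul b m => simp [coeff]
  rw [k4, hδ]
  have k5 (v : A ⊗[R] M) : ((TensorProduct.rid R A).toLinearMap ∘ₗ (κ n).lTensor A).lTensor A
      (TensorProduct.assoc R A A M (Δ.toLinearMap.rTensor M v)) =
      Δ (TensorProduct.rid R A ((κ n).lTensor A v)) := by
    induction v with
    | zero => simp
    | add x y hx hy => simp only [map_add, hx, hy]
    | tmul b m =>
      simp only [LinearMap.rTensor_tmul, AlgHom.toLinearMap_apply, LinearMap.lTensor_tmul,
        rid_tmul, map_smul]
      generalize Δ b = w
      induction w with
      | zero => simp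
      | add x y hx hy => simp only [map_add, add_tmul, smul_add, hx, hy]
      | tmul b c => simp
  rw [k5]
  rfl

/-- Integration is invariant under inversion, so averaging φ(g⁻¹m) over g is the same as averaging
φ(gm): the Reynolds operator of the dual is the transpose. -/
lemma reynolds_dualCoact {i : A →ₐ[R] C} {ρ : C →ₗ[R] R} (hρ : ∀ a, ρ (i (σ a)) = ρ (i a))
    (n : N) (m : M) :
    κ (reynolds ρ (i.toLinearMap.rTensor N ∘ₗ dualCoact κ σ δ) n) m =
      κ n (reynolds ρ (i.toLinearMap.rTensor M ∘ₗ δ) m) := by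
  have k (z : A ⊗[R] N) : κ (contr ρ N (i.toLinearMap.rTensor N z)) m =
      ρ (i (ev κ.toLinearMap A z m)) := by
    induction z with
    | zero => simp
    | add x y hx hy => simp only [map_add, LinearMap.add_apply, hx, hy]
    | tmul a m => simp [mul_comm]
  have k2 (φ : Module.Dual R M) (z : A ⊗[R] M) : ρ (i (TensorProduct.rid R A (φ.lTensor A z))) =
      φ (contr ρ M (i.toLinearMap.rTensor M z)) := by
    induction z with
    | zero => simp
    | add x y hx hy => simp only [map_add, hx, hy]
    | tmul a m => simp [mul_comm]
  simp only [reynolds, LinearMap.comp_apply]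
  rw [k, ev_dualCoact, hρ]
  exact k2 _ _

/-- An equivariant map `h : M → P` to an algebra of functions defines an equivariant element of
`P ⊗ M^∨`. -/
lemma twist_eq {P P' : Type*} [CommRing P] [Algebra R P] [CommRing P'] [Algebra R P']
    (hδ : Coassoc Δ δ) (hε : ∀ m, TensorProduct.lid R M (ε.toLinearMap.rTensor M (δ m)) = m)
    (hσ : ∀ a, Algebra.TensorProduct.productMap σ (AlgHom.id R A) (Δ a) = algebraMap R A (ε a))
    (a : P →ₐ[R] Q) (g : A →ₐ[R] Q) (p : P' →ₐ[R] Q) (h : M →ₗ[R] P) (h' : M →ₗ[R] P')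
    (hh : ∀ m, a (h m) = Algebra.TensorProduct.productMap g p (h'.lTensor A (δ m)))
    (z : P ⊗[R] N) (z' : P' ⊗[R] N) (hz : ev κ.toLinearMap P z = h)
    (hz' : ev κ.toLinearMap P' z' = h') :
    (Algebra.TensorProduct.productMap a g).toLinearMap.rTensor N
      ((TensorProduct.assoc R P A N).symm ((dualCoact κ σ δ).lTensor P z)) =
      p.toLinearMap.rTensor N z' := by
  apply ev_ext κ
  intro m
  rw [ev_rTensor, ev_rTensor, hz']
  have k1 (z : P ⊗[R] N) : Algebra.TensorProduct.productMap a g (ev κ.toLinearMap (P ⊗[R] A)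
      ((TensorProduct.assoc R P A N).symm ((dualCoact κ σ δ).lTensor P z)) m) =
      Algebra.TensorProduct.productMap (g.comp σ) a
        ((ev κ.toLinearMap P z).lTensor A (δ m)) := by
    induction z with
    | zero => simp
    | add x y hx hy => simp only [map_add, LinearMap.add_apply, hx, hy, LinearMap.lTensor_add]
    | tmul x n =>
      rw [LinearMap.lTensor_tmul]
      have k2 (w : A ⊗[R] N) : ev κ.toLinearMap (P ⊗[R] A) ((TensorProduct.assoc R P A N).symm
          (x ⊗ₜ w)) m = x ⊗ₜ ev κ.toLinearMap A w m := by
        induction w with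
        | zero => simp
        | add x y hx hy => simp only [map_add, tmul_add, LinearMap.add_apply, hx, hy]
        | tmul b n => simp
      rw [k2, ev_dualCoact, coeff, LinearMap.comp_apply, LinearMap.comp_apply]
      generalize δ m = v
      induction v with
      | zero => simp
      | add x y hx hy => simp only [map_add, tmul_add, hx, hy]
      | tmul b m => simp [mul_comm]
  rw [AlgHom.toLinearMap_apply, k1, hz]
  have k3 (v : A ⊗[R] M) : Algebra.TensorProduct.productMap (g.comp σ) a (h.lTensor A v) =
      Algebra.TensorProduct.productMap (g.comp σ) (Algebra.TensorProduct.productMap g p)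
        ((h'.lTensor A).lTensor A (δ.lTensor A v)) := by
    induction v with
    | zero => simp
    | add x y hx hy => simp only [map_add, hx, hy]
    | tmul b m => simp [hh]
  have k4 (v : A ⊗[R] M) : Algebra.TensorProduct.productMap (g.comp σ)
        (Algebra.TensorProduct.productMap g p) ((h'.lTensor A).lTensor A
          (TensorProduct.assoc R A A M (Δ.toLinearMap.rTensor M v))) =
      p (h' (TensorProduct.lid R M (ε.toLinearMap.rTensor M v))) := by
    induction v with
    | zero => simp
    | add x y hx hy => simp only [map_add, hx, hy]
    | tmul b m =>
      have k5 (w : A ⊗[R] A) : Algebra.TensorProduct.productMap (g.comp σ)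
          (Algebra.TensorProduct.productMap g p) ((h'.lTensor A).lTensor A
          (TensorProduct.assoc R A A M (w ⊗ₜ m))) =
          g (Algebra.TensorProduct.productMap σ (AlgHom.id R A) w) * p (h' m) := by
        induction w with
        | zero => simp
        | add x y hx hy => simp only [map_add, add_tmul, hx, hy, add_mul]
        | tmul b c => simp [mul_assoc]
      rw [LinearMap.rTensor_tmul, AlgHom.toLinearMap_apply, k5, hσ]
      simp [Algebra.smul_def]
  -- Inserting the equivariance of h puts g⁻¹ next to g; coassociativity merges the two factors and
  -- the antipode axiom cancels them.
  rw [k3, hδ, k4, hε]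
  rfl

end DualComodule

/-! ### Tensor products and localization -/

section Localization

open TensorProduct

variable {R R' A A' M M' : Type*} [CommRing R] [CommRing R'] {τ : R →+* R'}
  [AddCommGroup A] [Module R A] [AddCommGroup A'] [Module R' A']
  [AddCommGroup M] [Module R M] [AddCommGroup M'] [Module R' M']

/-- A semilinear map exhibiting its target as the localization of its source away from `f`. -/
structure IsAwayMap (f : R) (α : A →ₛₗ[τ] A') : Prop where
  torsion (x : A) : α x = 0 → ∃ n : ℕ, f ^ n • x = 0
  lift (y : A') : ∃ (n : ℕ) (x : A), α x = τ f ^ n • y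

/-- The two elementary conditions are the injectivity and surjectivity clauses of a localization
once the target is viewed as an `R`-module through τ; invertibility of τ f supplies the remaining
clause. -/
lemma IsAwayMap.isLocalizedModule {f : R} (hf : IsUnit (τ f)) {α : A →ₛₗ[τ] A'}
    (h : IsAwayMap f α) :
    letI := Module.compHom A' τ
    IsLocalizedModule (.powers f) (M' := A')
      { toFun := α, map_add' := α.map_add, map_smul' := fun r x => α.map_smulₛₗ r x } := by
  let := Module.compHom A' τ
  refine { map_units := ?_, surj := ?_, exists_of_eq := ?_ }
  · rintro ⟨_, n, rfl⟩
    rw [Module.End.isUnit_iff]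
    have hu : IsUnit (τ f ^ n) := hf.pow n
    have key (x : A') : algebraMap R (Module.End R A') (f ^ n) x = hu.unit • x := by
      change τ (f ^ n) • x = (τ f ^ n) • x
      rw [map_pow]
    constructor
    · intro x y hxy
      have h2 : algebraMap R (Module.End R A') (f ^ n) x =
        algebraMap R (Module.End R A') (f ^ n) y := hxy
      rw [key, key] at h2
      exact smul_left_cancel _ h2
    · intro y
      refine ⟨hu.unit⁻¹ • y, ?_⟩
      change algebraMap R (Module.End R A') (f ^ n) _ = y
      rw [key, smul_inv_smul]
  · intro y
    obtain ⟨n, x, hx⟩ := h.lift y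
    refine ⟨(x, ⟨f ^ n, n, rfl⟩), ?_⟩
    change τ (f ^ n) • y = α x
    rw [hx, map_pow]
  · intro x y hxy
    obtain ⟨n, hn⟩ := h.torsion (x - y) (by
      rw [map_sub]; exact sub_eq_zero.2 hxy)
    refine ⟨⟨f ^ n, n, rfl⟩, ?_⟩
    change f ^ n • x = f ^ n • y
    rwa [smul_sub, sub_eq_zero] at hn

/-- A tensor product of localizations is a localization. -/
lemma IsAwayMap.tensor {f : R} (hR : letI := τ.toAlgebra; IsLocalization.Away f R')
    {α : A →ₛₗ[τ] A'} {β : M →ₛₗ[τ] M'} (hα : IsAwayMap f α) (hβ : IsAwayMap f β) :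
    IsAwayMap f (TensorProduct.map α β) := by
  have hf : IsUnit (τ f) := by
    let := τ.toAlgebra
    exact IsLocalization.Away.algebraMap_isUnit (S := R') f
  constructor
  · intro z hz
    let := τ.toAlgebra
    let := Module.compHom A' τ
    let := Module.compHom M' τ
    have : IsScalarTower R R' A' := ⟨fun r s x => mul_smul (τ r) s x⟩
    have : IsScalarTower R R' M' := ⟨fun r s x => mul_smul (τ r) s x⟩
    have h1 := hα.isLocalizedModule hf
    have h2 := hβ.isLocalizedModule hf
    set α' : A →ₗ[R] A' :=
      { toFun := α, map_add' := α.map_add, map_smul' := fun r x => α.map_smulₛₗ r x }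
    set β' : M →ₗ[R] M' :=
      { toFun := β, map_add' := β.map_add, map_smul' := fun r x => β.map_smulₛₗ r x }
    have h3 : IsLocalizedModule (.powers f) (TensorProduct.map α' β') := inferInstance
    -- The tensor product of the localized modules is the same over `R` as over `R'`, so the kernel
    -- is known from the tensor product of localizations over `R`.
    have h4 : TensorProduct.map α' β' z =
        IsLocalization.moduleTensorEquiv (.powers f) R' A' M' (TensorProduct.map α β z) := by
      clear hz
      induction z with
      | zero => simp
      | add x y hx hy => simp only [map_add, hx, hy]
      | tmul a m =>
        rw [TensorProduct.map_tmul, TensorProduct.map_tmul]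
        rfl
    rw [hz, map_zero] at h4
    obtain ⟨⟨_, n, rfl⟩, hn⟩ := (IsLocalizedModule.eq_zero_iff (.powers f) _).1 h4
    exact ⟨n, hn⟩
  · intro y
    induction y with
    | zero => exact ⟨0, 0, by simp⟩
    | tmul a m =>
      obtain ⟨n, x, hx⟩ := hα.lift a
      obtain ⟨k, y, hy⟩ := hβ.lift m
      refine ⟨n + k, x ⊗ₜ y, ?_⟩
      rw [TensorProduct.map_tmul, hx, hy, pow_add, mul_smul, TensorProduct.tmul_smul,
        TensorProduct.smul_tmul', smul_comm]
      rfl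
    | add x y hx hy =>
      obtain ⟨n, x', hx⟩ := hx
      obtain ⟨k, y', hy⟩ := hy
      refine ⟨n + k, f ^ k • x' + f ^ n • y', ?_⟩
      rw [map_add, map_smulₛₗ, map_smulₛₗ, hx, hy, map_pow, map_pow, smul_smul, smul_smul,
        ← pow_add, ← pow_add, add_comm k n, smul_add]

end Localization

/-! ### Functions on products -/

section Points

variable {Y Z Y' Z' : Over S} {U : S.Opens}

lemma pull_pull (k : Y' ⟶ Y) (h : Y ⟶ Z) {W : Z.left.Opens} {V : Y.left.Opens} {V' : Y'.left.Opens}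
    (hW : W ≤ Z.hom ⁻¹ᵁ U) (hV : V ≤ Y.hom ⁻¹ᵁ U) (hVW : V ≤ h.left ⁻¹ᵁ W)
    (hV' : V' ≤ Y'.hom ⁻¹ᵁ U) (hVV' : V' ≤ k.left ⁻¹ᵁ V) (hkh : V' ≤ (k ≫ h).left ⁻¹ᵁ W)
    (x : Sec Z U W hW) :
    pull k U hV hV' hVV' (pull h U hW hV hVW x) = pull (k ≫ h) U hW hV' hkh x := by
  change (h.left.appLE W V hVW ≫ k.left.appLE V V' hVV').hom x = _
  rw [Scheme.Hom.appLE_comp_appLE]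
  rfl

lemma pullCoord_pullCoord (k : Y' ⟶ Y) (h : Y ⟶ Z) (x : Coord Z U) :
    pullCoord k U (pullCoord h U x) = pullCoord (k ≫ h) U x :=
  pull_pull _ _ _ _ _ _ _ _ _

lemma pull_congr {h h' : Y ⟶ Z} (e : h = h') {W : Z.left.Opens} {V : Y.left.Opens}
    (hW : W ≤ Z.hom ⁻¹ᵁ U) (hV : V ≤ Y.hom ⁻¹ᵁ U) (hVW : V ≤ h.left ⁻¹ᵁ W)
    (hVW' : V ≤ h'.left ⁻¹ᵁ W) (x : Sec Z U W hW) :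
    pull h U hW hV hVW x = pull h' U hW hV hVW' x := by
  subst e
  rfl

lemma pull_id {W V : Z.left.Opens} (hW : W ≤ Z.hom ⁻¹ᵁ U) (hV : V ≤ Z.hom ⁻¹ᵁ U) (h : V ≤ W)
    (x : Sec Z U W hW) :
    pull (𝟙 Z) U hW hV h x = Z.left.presheaf.map (homOfLE h).op x := by
  change (Scheme.Hom.appLE (𝟙 Z.left) W V h).hom x = _
  have : Scheme.Hom.appLE (𝟙 Z.left) W V h = Z.left.presheaf.map (homOfLE h).op := by
    refine (Scheme.Hom.appLE_map (𝟙 Z.left) (U := W) (V := W) le_rfl (homOfLE h).op).symm.trans ?_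
    have e : Scheme.Hom.appLE (𝟙 Z.left) W W le_rfl = 𝟙 _ :=
      (Scheme.Hom.appLE_eq_app (𝟙 Z.left) (U := W)).trans (Scheme.Hom.id_app W)
    exact (congrArg (· ≫ Z.left.presheaf.map (homOfLE h).op) e).trans (Category.id_comp _)
  rw [this]

lemma pullCoord_id (x : Coord Z U) : pullCoord (𝟙 Z) U x = x := by
  refine (pull_id _ _ le_rfl x).trans ?_
  change Z.left.presheaf.map (𝟙 _) x = x
  rw [Z.left.presheaf.map_id]
  rfl

/-- Functions on a fibre product, over opens for which base change holds. -/
lemma productMap_bijective_of_isIso {V : Y.left.Opens} {W : Z.left.Opens}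
    (hV : V ≤ Y.hom ⁻¹ᵁ U) (hW : W ≤ Z.hom ⁻¹ᵁ U) {O : (Y ⊗ Z).left.Opens}
    (hO : O = (fst Y Z).left ⁻¹ᵁ V ⊓ (snd Y Z).left ⁻¹ᵁ W)
    (hOU : O ≤ (Y ⊗ Z).hom ⁻¹ᵁ U) (hOV : O ≤ (fst Y Z).left ⁻¹ᵁ V)
    (hOW : O ≤ (snd Y Z).left ⁻¹ᵁ W)
    (h : IsIso (pushoutSection
      (IsPullback.of_hasPullback Y.hom Z.hom : IsPullback (fst Y Z).left (snd Y Z).left Y.hom Z.hom)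
      hW hV hO)) :
    Function.Bijective (Algebra.TensorProduct.productMap
      (pull (fst Y Z) U hV hOU hOV) (pull (snd Y Z) U hW hOU hOW)) := by
  have h1 := (isIso_pushoutSection_iff _ hW hV hO).mp h
  have h2 := CommRingCat.isPushout_tensorProduct Γ(S, U) (Sec Y U V hV) (Sec Z U W hW)
  let φ : CommRingCat.of (Sec Y U V hV ⊗[Γ(S, U)] Sec Z U W hW) ⟶
      CommRingCat.of (Sec (Y ⊗ Z) U O hOU) :=
    CommRingCat.ofHom (Algebra.TensorProduct.productMap
      (pull (fst Y Z) U hV hOU hOV) (pull (snd Y Z) U hW hOU hOW)).toRingHom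
  have hφ : φ = (h2.isoIsPushout _ _ h1).hom := by
    apply h2.hom_ext
    · refine Eq.trans ?_ (h2.inl_isoIsPushout_hom _ _ h1).symm
      ext x
      change Algebra.TensorProduct.productMap (pull (fst Y Z) U hV hOU hOV)
        (pull (snd Y Z) U hW hOU hOW) (x ⊗ₜ 1) = pull (fst Y Z) U hV hOU hOV x
      simp
    · refine Eq.trans ?_ (h2.inr_isoIsPushout_hom _ _ h1).symm
      ext x
      change Algebra.TensorProduct.productMap (pull (fst Y Z) U hV hOU hOV)
        (pull (snd Y Z) U hW hOU hOW) (1 ⊗ₜ x) = pull (snd Y Z) U hW hOU hOW x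
      simp
  have hiso : IsIso φ := by rw [hφ]; exact Iso.isIso_hom _
  exact ConcreteCategory.bijective_of_isIso φ

lemma preimage_hom_tensor (Y Z : Over S) (U : S.Opens) :
    (Y ⊗ Z).hom ⁻¹ᵁ U = (fst Y Z).left ⁻¹ᵁ (Y.hom ⁻¹ᵁ U) ⊓ (snd Y Z).left ⁻¹ᵁ (Z.hom ⁻¹ᵁ U) :=
  le_antisymm (le_inf (preimage_le _ _) (preimage_le _ _))
    (inf_le_left.trans (le_of_over (fst Y Z) le_rfl le_rfl))

/-- The part of `Z` over an affine open is only assumed quasi-compact and quasi-separated, not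
affine; flat base change for functions takes the place of affineness. -/
lemma productMap_flat_bijective (Y Z : Over S) [IsAffineHom Y.hom] [Flat Y.hom] (U : S.affineOpens)
    (h1 : IsCompact (X := Z.left) (Z.hom ⁻¹ᵁ U.1))
    (h2 : IsQuasiSeparated (α := Z.left) (Z.hom ⁻¹ᵁ U.1)) :
    Function.Bijective (Algebra.TensorProduct.productMap
      (pullCoord (fst Y Z) U.1) (pullCoord (snd Y Z) U.1)) :=
  productMap_bijective_of_isIso le_rfl le_rfl (preimage_hom_tensor Y Z U.1) _ _ _
    (isIso_pushoutSection_of_isQuasiSeparated_of_flat_left _ _ _ _ U.2 (U.2.preimage Y.hom) h1 h2)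

/-- Used for test schemes, about which nothing is known: they are cut into affine opens `W`, for
which base change holds without flatness. -/
lemma productMap_affine_injective (Y Z : Over S) [IsAffineHom Y.hom] (U : S.affineOpens)
    {W : Z.left.Opens} (hW : W ≤ Z.hom ⁻¹ᵁ U.1) (hWa : IsAffineOpen W)
    (hOU : (snd Y Z).left ⁻¹ᵁ W ≤ (Y ⊗ Z).hom ⁻¹ᵁ U.1) :
    Function.Injective (Algebra.TensorProduct.productMap
      (pull (fst Y Z) U.1 le_rfl hOU (hOU.trans (preimage_le _ _)))
      (pull (snd Y Z) U.1 hW hOU le_rfl)) :=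
  (productMap_bijective_of_isIso le_rfl hW
    (le_antisymm (le_inf (hOU.trans (preimage_le _ _)) le_rfl) inf_le_right) _ _ _
    (isIso_pushoutSection_of_isAffineOpen _ _ _ _ U.2 hWa (U.2.preimage Y.hom))).1

lemma coordProd_tmul [IsAffineHom Y.hom] [IsAffineHom Z.hom] (U : S.affineOpens) (a : Coord Y U.1)
    (b : Coord Z U.1) :
    coordProd Y Z U (a ⊗ₜ b) = pullCoord (fst Y Z) U.1 a * pullCoord (snd Y Z) U.1 b := by
  exact Algebra.TensorProduct.productMap_apply_tmul _ _ _ _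

lemma pull_productMap (p : Y' ⟶ Y) (q : Y' ⟶ Z) {V : Y.left.Opens} {W : Z.left.Opens}
    {O : (Y ⊗ Z).left.Opens} {V' : Y'.left.Opens}
    (hV : V ≤ Y.hom ⁻¹ᵁ U) (hW : W ≤ Z.hom ⁻¹ᵁ U)
    (hO : O ≤ (Y ⊗ Z).hom ⁻¹ᵁ U) (hOV : O ≤ (fst Y Z).left ⁻¹ᵁ V) (hOW : O ≤ (snd Y Z).left ⁻¹ᵁ W)
    (hV' : V' ≤ Y'.hom ⁻¹ᵁ U) (h : V' ≤ (lift p q).left ⁻¹ᵁ O) (hp : V' ≤ p.left ⁻¹ᵁ V)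
    (hq : V' ≤ q.left ⁻¹ᵁ W) (z : Sec Y U V hV ⊗[Γ(S, U)] Sec Z U W hW) :
    pull (lift p q) U hO hV' h (Algebra.TensorProduct.productMap
      (pull (fst Y Z) U hV hO hOV) (pull (snd Y Z) U hW hO hOW) z) =
      Algebra.TensorProduct.productMap (pull p U hV hV' hp) (pull q U hW hV' hq) z := by
  induction z with
  | zero => simp
  | add x y hx hy => simp only [map_add, hx, hy]
  | tmul a b =>
    simp only [Algebra.TensorProduct.productMap_apply_tmul, map_mul]
    congr 1
    · rw [pull_pull (hkh := by rw [lift_fst]; exact hp)]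
      exact pull_congr (lift_fst p q) _ _ _ _ _
    · rw [pull_pull (hkh := by rw [lift_snd]; exact hq)]
      exact pull_congr (lift_snd p q) _ _ _ _ _

lemma pullCoord_coordProd [IsAffineHom Y.hom] [IsAffineHom Z.hom] (U : S.affineOpens)
    (p : Y' ⟶ Y) (q : Y' ⟶ Z) (z : Coord Y U.1 ⊗[Γ(S, U.1)] Coord Z U.1) :
    pullCoord (lift p q) U.1 (coordProd Y Z U z) =
      Algebra.TensorProduct.productMap (pullCoord p U.1) (pullCoord q U.1) z :=
  pull_productMap _ _ _ _ _ _ _ _ _ _ _ _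

end Points

/-! ### The Hopf algebra axioms -/

section Hopf

variable {G C : Over S} [GrpObj G] [GrpObj C] (U : S.affineOpens)

/-- The antipode. -/
abbrev antipode (G : Over S) [GrpObj G] (U : S.affineOpens) :
    Coord G U.1 →ₐ[Γ(S, U.1)] Coord G U.1 :=
  pullCoord (ι[G] : G ⟶ G) U.1

lemma antipode_antipode (a : Coord G U.1) : antipode G U (antipode G U a) = a := by
  rw [pullCoord_pullCoord, GrpObj.inv_comp_inv, pullCoord_id]

lemma mul_comp_inv (G : Over S) [GrpObj G] :
    (μ[G] ≫ ι[G] : G ⊗ G ⟶ G) = (snd G G ≫ ι[G]) * (fst G G ≫ ι[G]) := by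
  have h1 : (μ[G] : G ⊗ G ⟶ G) = fst G G * snd G G := by
    rw [Hom.mul_def, lift_fst_snd, Category.id_comp]
  rw [h1, ← Hom.inv_def, ← Hom.inv_def, ← Hom.inv_def, mul_inv_rev]

lemma counit_pullCoord {Y Z : Over S} [GrpObj Y] [GrpObj Z] (h : Y ⟶ Z)
    (hh : (η[Y] ≫ h : 𝟙_ (Over S) ⟶ Z) = η[Z]) (V : S.Opens) (a : Coord Z V) :
    counit Y V (pullCoord h V a) = counit Z V a := by
  change (h.left.appLE _ _ _ ≫ (unitSection Y).appLE _ _ _).hom a =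
    ((unitSection Z).appLE _ _ _).hom a
  rw [Scheme.Hom.appLE_comp_appLE]
  have : unitSection Y ≫ h.left = unitSection Z := congrArg CommaMorphism.left hh
  simp only [this]

lemma counit_antipode (a : Coord G U.1) : counit G U.1 (antipode G U a) = counit G U.1 a :=
  counit_pullCoord _ (GrpObj.one_inv) _ _

lemma pull_one {Y : Over S} {V : Y.left.Opens} (hV : V ≤ Y.hom ⁻¹ᵁ U.1)
    (h : V ≤ (1 : Y ⟶ G).left ⁻¹ᵁ (G.hom ⁻¹ᵁ U.1)) (a : Coord G U.1) :
    pull (1 : Y ⟶ G) U.1 le_rfl hV h a =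
      algebraMap Γ(S, U.1) (Sec Y U.1 V hV) (counit G U.1 a) := by
  have e : (1 : Y ⟶ G).left = Y.hom ≫ unitSection G := by
    rw [Hom.one_def, Over.comp_left]
    congr 1
  change ((1 : Y ⟶ G).left.appLE _ _ _).hom a =
    ((unitSection G).appLE _ _ _ ≫ Y.hom.appLE _ _ _).hom a
  rw [Scheme.Hom.appLE_comp_appLE]
  simp only [e]

lemma antipode_pullCoord (i : C ⟶ G) [IsMonHom i] (a : Coord G U.1) :
    pullCoord i U.1 (antipode G U a) = antipode C U (pullCoord i U.1 a) := by
  rw [pullCoord_pullCoord, pullCoord_pullCoord, GrpObj.inv_hom]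

variable [IsAffineHom G.hom] [IsAffineHom C.hom]

lemma coordProd_comul (a : Coord G U.1) :
    coordProd G G U (comul G U a) = pullCoord (μ[G] : G ⊗ G ⟶ G) U.1 a :=
  (coordProd G G U).apply_symm_apply _

/-- The value of the comultiplication at a pair of points. -/
lemma productMap_comul {Y : Over S} (p q : Y ⟶ G) (a : Coord G U.1) :
    Algebra.TensorProduct.productMap (pullCoord p U.1) (pullCoord q U.1) (comul G U a) =
      pullCoord (p * q) U.1 a := by
  rw [← pullCoord_coordProd, coordProd_comul, pullCoord_pullCoord]
  rfl

/-- Hopf algebra identities are read off from identities between points with values in a product,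
here (gh)⁻¹ = h⁻¹g⁻¹. -/
lemma comul_antipode (a : Coord G U.1) :
    comul G U (antipode G U a) = Algebra.TensorProduct.comm Γ(S, U.1) _ _
      (Algebra.TensorProduct.map (antipode G U) (antipode G U) (comul G U a)) := by
  apply (coordProd G G U).injective
  rw [coordProd_comul, pullCoord_pullCoord, mul_comp_inv, ← productMap_comul]
  generalize comul G U a = w
  induction w with
  | zero => simp
  | add x y hx hy => simp only [map_add, hx, hy]
  | tmul a b =>
    simp only [Algebra.TensorProduct.productMap_apply_tmul, Algebra.TensorProduct.map_tmul,
      Algebra.TensorProduct.comm_tmul, coordProd_tmul, pullCoord_pullCoord]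
    exact mul_comm _ _

lemma antipode_mul_id (a : Coord G U.1) :
    Algebra.TensorProduct.productMap (antipode G U) (AlgHom.id Γ(S, U.1) (Coord G U.1))
      (comul G U a) = algebraMap Γ(S, U.1) (Coord G U.1) (counit G U.1 a) := by
  have e : AlgHom.id Γ(S, U.1) (Coord G U.1) = pullCoord (𝟙 G) U.1 :=
    AlgHom.ext fun x => (pullCoord_id x).symm
  rw [e, productMap_comul]
  have : ι[G] * 𝟙 G = 1 := by
    have h := Hom.inv_def (𝟙 G)
    rw [Category.id_comp] at h
    rw [← h, inv_mul_cancel]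
  rw [this]
  exact pull_one U _ _ a

variable (i : C ⟶ G)

lemma comul_pullCoord [IsMonHom i] (a : Coord G U.1) :
    comul C U (pullCoord i U.1 a) =
      Algebra.TensorProduct.map (pullCoord i U.1) (pullCoord i U.1) (comul G U a) := by
  apply (coordProd C C U).injective
  rw [coordProd_comul, pullCoord_pullCoord, IsMonHom.mul_hom]
  have : ((i ⊗ₘ i) ≫ μ[G] : C ⊗ C ⟶ G) = (fst C C ≫ i) * (snd C C ≫ i) := by
    rw [Hom.mul_def]
    congr 1
  rw [this, ← productMap_comul]
  generalize comul G U a = w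
  induction w with
  | zero => simp
  | add x y hx hy => simp only [map_add, hx, hy]
  | tmul a b =>
    simp only [Algebra.TensorProduct.productMap_apply_tmul, Algebra.TensorProduct.map_tmul,
      coordProd_tmul, pullCoord_pullCoord]

/-- The automorphism `(c, g) ↦ (g, g⁻¹cg)` on functions, for a normal subgroup. -/
lemma exists_conj_left [IsMonHom.Normal i] :
    ∃ θ : Coord G U.1 ⊗[Γ(S, U.1)] Coord C U.1 →ₐ[Γ(S, U.1)]
        Coord C U.1 ⊗[Γ(S, U.1)] Coord G U.1,
      (∀ a, θ (Algebra.TensorProduct.map (AlgHom.id Γ(S, U.1) (Coord G U.1)) (pullCoord i U.1) (comul G U a)) =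
        Algebra.TensorProduct.map (pullCoord i U.1) (AlgHom.id Γ(S, U.1) (Coord G U.1)) (comul G U a)) ∧
      ∀ a, θ (a ⊗ₜ 1) = 1 ⊗ₜ a := by
  obtain ⟨ψ, hψ⟩ := IsMonHom.Normal.exists_comp_eq_conj i
  -- Normality supplies (g, c) ↦ gcg⁻¹; inserting the inverse of g turns it into g⁻¹cg.
  let τ₂ : C ⊗ G ⟶ C := lift (snd C G)⁻¹ (fst C G) ≫ ψ
  have hτ : τ₂ ≫ i = (snd C G)⁻¹ * (fst C G ≫ i) * snd C G := by
    rw [Category.assoc, hψ, lift_whiskerLeft_assoc, GrpObj.lift_conj_eq_mul_mul_inv, inv_inv]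
  let τ : C ⊗ G ⟶ G ⊗ C := lift (snd C G) τ₂
  refine ⟨(coordProd C G U).symm.toAlgHom.comp
    ((pullCoord τ U.1).comp (coordProd G C U).toAlgHom), fun a => ?_, fun a => ?_⟩
  · apply (coordProd C G U).injective
    change coordProd C G U ((coordProd C G U).symm _) = _
    rw [AlgEquiv.apply_symm_apply]
    change pullCoord τ U.1 (coordProd G C U _) = _
    rw [pullCoord_coordProd]
    have e1 (w : Coord G U.1 ⊗[Γ(S, U.1)] Coord G U.1) : Algebra.TensorProduct.productMap
        (pullCoord (snd C G) U.1) (pullCoord τ₂ U.1) (Algebra.TensorProduct.map (AlgHom.id Γ(S, U.1) (Coord G U.1))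
          (pullCoord i U.1) w) = Algebra.TensorProduct.productMap
        (pullCoord (snd C G) U.1) (pullCoord (τ₂ ≫ i) U.1) w := by
      induction w with
      | zero => simp
      | add x y hx hy => simp only [map_add, hx, hy]
      | tmul a b =>
        simp only [Algebra.TensorProduct.productMap_apply_tmul, Algebra.TensorProduct.map_tmul,
          pullCoord_pullCoord, AlgHom.id_apply]
    have e2 (w : Coord G U.1 ⊗[Γ(S, U.1)] Coord G U.1) : coordProd C G U
        (Algebra.TensorProduct.map (pullCoord i U.1) (AlgHom.id Γ(S, U.1) (Coord G U.1)) w) =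
        Algebra.TensorProduct.productMap (pullCoord (fst C G ≫ i) U.1)
          (pullCoord (snd C G) U.1) w := by
      induction w with
      | zero => simp
      | add x y hx hy => simp only [map_add, hx, hy]
      | tmul a b =>
        simp only [Algebra.TensorProduct.productMap_apply_tmul, Algebra.TensorProduct.map_tmul,
          coordProd_tmul, pullCoord_pullCoord, AlgHom.id_apply]
    -- What remains is the group identity g · (g⁻¹cg) = cg.
    rw [e1, e2, productMap_comul, productMap_comul, hτ]
    congr 2
    group
  · apply (coordProd C G U).injective
    change coordProd C G U ((coordProd C G U).symm _) = _
    rw [AlgEquiv.apply_symm_apply]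
    change pullCoord τ U.1 (coordProd G C U _) = _
    rw [pullCoord_coordProd, coordProd_tmul]
    simp

/-- The automorphism `(g, c) ↦ (gcg⁻¹, g)` on functions, for a normal subgroup. -/
lemma exists_conj_right [IsMonHom.Normal i] :
    ∃ θ : Coord C U.1 ⊗[Γ(S, U.1)] Coord G U.1 →ₐ[Γ(S, U.1)]
        Coord G U.1 ⊗[Γ(S, U.1)] Coord C U.1,
      (∀ a, θ (Algebra.TensorProduct.map (pullCoord i U.1) (AlgHom.id Γ(S, U.1) (Coord G U.1)) (comul G U a)) =
        Algebra.TensorProduct.map (AlgHom.id Γ(S, U.1) (Coord G U.1)) (pullCoord i U.1) (comul G U a)) ∧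
      ∀ a, θ (1 ⊗ₜ a) = a ⊗ₜ 1 := by
  obtain ⟨ψ, hψ⟩ := IsMonHom.Normal.exists_comp_eq_conj i
  have hτ : ψ ≫ i = fst G C * (snd G C ≫ i) * (fst G C)⁻¹ := by
    have : (G ◁ i : G ⊗ C ⟶ G ⊗ G) = lift (fst G C) (snd G C ≫ i) := by ext <;> simp
    rw [hψ, this, GrpObj.lift_conj_eq_mul_mul_inv]
  let τ : G ⊗ C ⟶ C ⊗ G := lift ψ (fst G C)
  refine ⟨(coordProd G C U).symm.toAlgHom.comp
    ((pullCoord τ U.1).comp (coordProd C G U).toAlgHom), fun a => ?_, fun a => ?_⟩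
  · apply (coordProd G C U).injective
    change coordProd G C U ((coordProd G C U).symm _) = _
    rw [AlgEquiv.apply_symm_apply]
    change pullCoord τ U.1 (coordProd C G U _) = _
    rw [pullCoord_coordProd]
    have e1 (w : Coord G U.1 ⊗[Γ(S, U.1)] Coord G U.1) : Algebra.TensorProduct.productMap
        (pullCoord ψ U.1) (pullCoord (fst G C) U.1) (Algebra.TensorProduct.map
          (pullCoord i U.1) (AlgHom.id Γ(S, U.1) (Coord G U.1)) w) = Algebra.TensorProduct.productMap
        (pullCoord (ψ ≫ i) U.1) (pullCoord (fst G C) U.1) w := by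
      induction w with
      | zero => simp
      | add x y hx hy => simp only [map_add, hx, hy]
      | tmul a b =>
        simp only [Algebra.TensorProduct.productMap_apply_tmul, Algebra.TensorProduct.map_tmul,
          pullCoord_pullCoord, AlgHom.id_apply]
    have e2 (w : Coord G U.1 ⊗[Γ(S, U.1)] Coord G U.1) : coordProd G C U
        (Algebra.TensorProduct.map (AlgHom.id Γ(S, U.1) (Coord G U.1)) (pullCoord i U.1) w) =
        Algebra.TensorProduct.productMap (pullCoord (fst G C) U.1)
          (pullCoord (snd G C ≫ i) U.1) w := by
      induction w with
      | zero => simp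
      | add x y hx hy => simp only [map_add, hx, hy]
      | tmul a b =>
        simp only [Algebra.TensorProduct.productMap_apply_tmul, Algebra.TensorProduct.map_tmul,
          coordProd_tmul, pullCoord_pullCoord, AlgHom.id_apply]
    rw [e1, e2, productMap_comul, productMap_comul, hτ]
    congr 2
    group
  · apply (coordProd G C U).injective
    change coordProd G C U ((coordProd G C U).symm _) = _
    rw [AlgEquiv.apply_symm_apply]
    change pullCoord τ U.1 (coordProd C G U _) = _
    rw [pullCoord_coordProd, coordProd_tmul]
    simp

/-- The Reynolds operator of a normal subgroup commutes with the coaction of the group. -/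
theorem coact_reynolds_normal [IsMonHom.Normal i] {M : Type*} [AddCommGroup M] [Module Γ(S, U.1) M]
    {δ : M →ₗ[Γ(S, U.1)] Coord G U.1 ⊗[Γ(S, U.1)] M} (hδ : Coassoc (comul G U) δ)
    {ρ : Coord C U.1 →ₗ[Γ(S, U.1)] Γ(S, U.1)} (hl : LeftInv (comul C U) ρ) (h1 : ρ 1 = 1) (m : M) :
    δ (reynolds ρ ((pullCoord i U.1).toLinearMap.rTensor M ∘ₗ δ) m) =
      (reynolds ρ ((pullCoord i U.1).toLinearMap.rTensor M ∘ₗ δ)).lTensor _ (δ m) := by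
  obtain ⟨θ, hθ, hθ1⟩ := exists_conj_left U i
  obtain ⟨θ', hθ', hθ1'⟩ := exists_conj_right U i
  exact coact_reynolds_of_normal (comul_pullCoord U i) hδ hl
    (rightInv_of_leftInv (antipode_antipode U) (comul_antipode U) hl h1) h1 hθ hθ1 hθ' hθ1' m

end Hopf

/-! ### Quasi-coherent families of submodules -/

/-- A basic open of an affine open. -/
abbrev basicAff {U : S.affineOpens} (f : Γ(S, U.1)) : S.affineOpens :=
  ⟨S.basicOpen f, U.2.basicOpen f⟩

lemma exists_affine_mem {V : S.Opens} {p : S} (hp : p ∈ V) :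
    ∃ W : S.affineOpens, p ∈ W.1 ∧ W.1 ≤ V := by
  obtain ⟨_, ⟨W, hW, rfl⟩, hpW, hWV⟩ := S.isBasis_affineOpens.exists_subset_of_mem_open hp V.2
  exact ⟨⟨W, hW⟩, hpW, hWV⟩

/-- A finite affine cover of a quasi-compact open, by basic opens of an affine open. -/
lemma exists_finite_basicOpen_cover {U : S.Opens} (hU : IsAffineOpen U) {V : S.Opens} (hV : V ≤ U)
    (hc : IsCompact (V : Set S)) :
    ∃ s : Finset Γ(S, U), (∀ f ∈ s, S.basicOpen f ≤ V) ∧ ∀ p ∈ V, ∃ f ∈ s, p ∈ S.basicOpen f := by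
  choose f hf hfV using fun p : V => exists_basicOpen_mem hU hV p.2
  obtain ⟨t, ht⟩ := hc.elim_finite_subcover (fun p : V => (S.basicOpen (f p) : Set S))
    (fun p => (S.basicOpen (f p)).2) (fun p hp => Set.mem_iUnion.2 ⟨⟨p, hp⟩, hf ⟨p, hp⟩⟩)
  classical
  refine ⟨t.image f, fun g hg => ?_, fun p hp => ?_⟩
  · obtain ⟨p, -, rfl⟩ := Finset.mem_image.1 hg
    exact hfV p
  · obtain ⟨q, hq, hpq⟩ := Set.mem_iUnion₂.1 (ht hp)
    exact ⟨f q, Finset.mem_image_of_mem f hq, hpq⟩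

/-- A family of submodules of the sections of `M` over affine opens which is quasi-coherent over
the affine opens contained in `U₀`. -/
structure IsQCSub (M : S.Modules) (U₀ : S.Opens)
    (N : ∀ U : S.affineOpens, Submodule Γ(S, U.1) Γ(M, U.1)) : Prop where
  res {U V : S.affineOpens} (hU : U.1 ≤ U₀) (h : V.1 ≤ U.1) {x : Γ(M, U.1)} :
    x ∈ N U → secRes M h x ∈ N V
  sat {U : S.affineOpens} (hU : U.1 ≤ U₀) (f : Γ(S, U.1)) (x : Γ(M, U.1)) :
    secRes M (S.basicOpen_le f) x ∈ N (basicAff f) → ∃ n : ℕ, f ^ n • x ∈ N U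

namespace IsQCSub

variable {M : S.Modules} {U₀ : S.Opens} {N : ∀ U : S.affineOpens, Submodule Γ(S, U.1) Γ(M, U.1)}

/-- The functions f over whose basic open x lies in the family generate the unit ideal, and
saturation makes a power of each of them multiply x into `N U`. -/
lemma mem_of_locally (hN : IsQCSub M U₀ N) {U : S.affineOpens} (hU : U.1 ≤ U₀) (x : Γ(M, U.1))
    (h : ∀ p ∈ U.1, ∃ (V : S.affineOpens) (hV : V.1 ≤ U.1), p ∈ V.1 ∧ secRes M hV x ∈ N V) :
    x ∈ N U := by
  let s : Set Γ(S, U.1) := {f | secRes M (S.basicOpen_le f) x ∈ N (basicAff f)}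
  have hs : Ideal.span s = ⊤ := by
    rw [← U.2.self_le_iSup_basicOpen_iff]
    intro p hp
    obtain ⟨V, hV, hpV, hxV⟩ := h p hp
    obtain ⟨f, hpf, hf⟩ := exists_basicOpen_mem U.2 hV hpV
    refine Opens.mem_iSup.2 ⟨⟨f, ?_⟩, hpf⟩
    have := hN.res (V := basicAff f) (hV.trans hU) hf hxV
    rwa [secRes_secRes] at this
  exact Submodule.mem_of_span_eq_top_of_smul_pow_mem _ s hs x fun f => hN.sat hU f.1 x f.2

/-- The subsheaf defined by a quasi-coherent family of submodules. -/
def toSubSheaf (hN : IsQCSub M ⊤ N) : SubSheaf M where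
  obj W :=
    { carrier := {x | ∀ (V : S.affineOpens) (hV : V.1 ≤ W), secRes M hV x ∈ N V}
      zero_mem' := fun V hV => by rw [map_zero]; exact zero_mem _
      add_mem' := fun hx hy V hV => by rw [map_add]; exact add_mem (hx V hV) (hy V hV)
      smul_mem' := fun r x hx V hV => by
        rw [secRes_smul]; exact Submodule.smul_mem _ _ (hx V hV) }
  res h x hx V hV := by
    rw [secRes_secRes]
    exact hx V _
  loc x h V hV := by
    refine hN.mem_of_locally le_top _ fun p hp => ?_
    obtain ⟨W, hW, hpW, hx⟩ := h p (hV hp)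
    obtain ⟨V', hpV', hV'⟩ := exists_affine_mem (V := V.1 ⊓ W) ⟨hp, hpW⟩
    refine ⟨V', hV'.trans inf_le_left, hpV', ?_⟩
    have := hx V' (hV'.trans inf_le_right)
    rwa [secRes_secRes] at this ⊢

lemma toSubSheaf_obj (hN : IsQCSub M ⊤ N) (U : S.affineOpens) : hN.toSubSheaf.obj U.1 = N U := by
  ext x
  refine ⟨fun h => ?_, fun h V hV => hN.res le_top hV h⟩
  have := h U le_rfl
  rwa [secRes_rfl] at this

lemma localizesOn (hN : IsQCSub M ⊤ N) (hM : ∀ U : S.affineOpens, LocalizesOn M U.1)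
    (U : S.affineOpens) : LocalizesOn hN.toSubSheaf.toModules U.1 := by
  intro f
  constructor
  · intro x hx
    obtain ⟨n, hn⟩ := (hM U f).torsion (hN.toSubSheaf.secEquiv U.1 x : Γ(M, U.1)) (by
      rw [← SubSheaf.secEquiv_secRes, hx]; rfl)
    exact ⟨n, (hN.toSubSheaf.secEquiv U.1).injective (Subtype.ext hn)⟩
  · intro y
    obtain ⟨n, x, hx⟩ := (hM U f).lift (hN.toSubSheaf.secEquiv _ y : Γ(M, S.basicOpen f))
    obtain ⟨k, hk⟩ := hN.sat le_top f x (by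
      rw [hx]
      refine Submodule.smul_mem _ _ ?_
      rw [← hN.toSubSheaf_obj]
      exact (hN.toSubSheaf.secEquiv _ y).2)
    rw [← hN.toSubSheaf_obj] at hk
    refine ⟨k + n, (hN.toSubSheaf.secEquiv U.1).symm ⟨_, hk⟩, ?_⟩
    apply (hN.toSubSheaf.secEquiv _).injective
    apply Subtype.ext
    rw [SubSheaf.secEquiv_secRes, LinearEquiv.apply_symm_apply, secRes_smul, hx, smul_smul,
      map_pow, ← pow_add]
    rfl

lemma isQuasicoherent (hN : IsQCSub M ⊤ N) (hM : ∀ U : S.affineOpens, LocalizesOn M U.1) :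
    hN.toSubSheaf.toModules.IsQuasicoherent :=
  isQuasicoherent_of_localizesOn _ (hN.localizesOn hM)

end IsQCSub

/-! ### Coherent extension -/

section Extension

variable {M : S.Modules}

/-- The submodules generated over the affine opens in `U` by a submodule of `M(U)`. -/
def generated {U : S.Opens} (Q : Submodule Γ(S, U) Γ(M, U)) (V : S.affineOpens) :
    Submodule Γ(S, V.1) Γ(M, V.1) :=
  Submodule.span _ {y | ∃ h : V.1 ≤ U, ∃ q ∈ Q, secRes M h q = y}

lemma secRes_mem_generated {U : S.Opens} {Q : Submodule Γ(S, U) Γ(M, U)} {V : S.affineOpens}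
    (h : V.1 ≤ U) {q : Γ(M, U)} (hq : q ∈ Q) : secRes M h q ∈ generated Q V :=
  Submodule.subset_span ⟨h, q, hq, rfl⟩

lemma generated_self {U : S.affineOpens} (Q : Submodule Γ(S, U.1) Γ(M, U.1)) :
    generated Q U = Q := by
  apply le_antisymm
  · rw [generated, Submodule.span_le]
    rintro _ ⟨h, q, hq, rfl⟩
    rw [secRes_rfl]
    exact hq
  · intro q hq
    have := secRes_mem_generated (V := U) le_rfl hq
    rwa [secRes_rfl] at this

/-- A combination over D(f) of restricted generators has coefficients with denominators powers of f.
Clearing them produces an element of the submodule generated over the larger open, equal to the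
given one up to f-power torsion. -/
lemma isQCSub_generated (hM : ∀ U : S.affineOpens, LocalizesOn M U.1) {U : S.Opens}
    (Q : Submodule Γ(S, U) Γ(M, U)) : IsQCSub M U (generated Q) where
  res {V W} hV h x hx := by
    induction hx using Submodule.span_induction with
    | mem y hy =>
      obtain ⟨h', q, hq, rfl⟩ := hy
      rw [secRes_secRes]
      exact secRes_mem_generated _ hq
    | zero => rw [map_zero]; exact zero_mem _
    | add x y _ _ hx hy => rw [map_add]; exact add_mem hx hy
    | smul r x _ hx => rw [secRes_smul]; exact Submodule.smul_mem _ _ hx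
  sat {V} hV f x hx := by
    have key : ∀ y ∈ generated Q (basicAff f), ∃ (n : ℕ), ∃ w ∈ generated Q V,
        secRes M (S.basicOpen_le f) w = fres (S.basicOpen_le f) f ^ n • y := by
      intro y hy
      induction hy using Submodule.span_induction with
      | mem y hy =>
        obtain ⟨h', q, hq, rfl⟩ := hy
        refine ⟨0, _, secRes_mem_generated hV hq, ?_⟩
        rw [secRes_secRes, pow_zero, one_smul]
      | zero => exact ⟨0, 0, zero_mem _, by simp⟩
      | add x y _ _ hx hy =>
        obtain ⟨n, x', hx', hx⟩ := hx
        obtain ⟨k, y', hy', hy⟩ := hy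
        refine ⟨n + k, f ^ k • x' + f ^ n • y',
          add_mem (Submodule.smul_mem _ _ hx') (Submodule.smul_mem _ _ hy'), ?_⟩
        rw [map_add, secRes_smul, secRes_smul, hx, hy, map_pow, map_pow, smul_smul, smul_smul,
          ← pow_add, ← pow_add, add_comm k n, smul_add]
      | smul r x _ hx =>
        obtain ⟨n, x', hx', hx⟩ := hx
        let := V.2.isLocalization_basicOpen f
        obtain ⟨k, s, hs⟩ : ∃ (k : ℕ) (s : Γ(S, V.1)),
            fres (S.basicOpen_le f) s = fres (S.basicOpen_le f) f ^ k * r := by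
          obtain ⟨⟨s, ⟨_, k, rfl⟩⟩, hs⟩ := IsLocalization.surj (.powers f) r
          refine ⟨k, s, ?_⟩
          refine hs.symm.trans ?_
          rw [mul_comm, map_pow]
          rfl
        refine ⟨k + n, s • x', Submodule.smul_mem _ _ hx', ?_⟩
        rw [secRes_smul, hs, hx, smul_smul, smul_smul, pow_add]
        congr 1
        ring
    obtain ⟨n, w, hw, h⟩ := key _ hx
    obtain ⟨k, hk⟩ := (hM V f).torsion (w - f ^ n • x) (by
      rw [map_sub, h, secRes_smul, map_pow, sub_self])
    refine ⟨k + n, ?_⟩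
    rw [pow_add, mul_smul]
    rw [smul_sub, sub_eq_zero] at hk
    rw [← hk]
    exact Submodule.smul_mem _ _ hw

/-- The sections of `N` whose restrictions into `U` lie in the submodules generated by `Q`. -/
def boundBy (N : ∀ U : S.affineOpens, Submodule Γ(S, U.1) Γ(M, U.1)) {U : S.Opens}
    (Q : Submodule Γ(S, U) Γ(M, U)) (V : S.affineOpens) : Submodule Γ(S, V.1) Γ(M, V.1) where
  carrier := {x | x ∈ N V ∧ ∀ (V' : S.affineOpens) (h : V'.1 ≤ V.1), V'.1 ≤ U →
    secRes M h x ∈ generated Q V'}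
  zero_mem' := ⟨zero_mem _, fun V' h _ => by rw [map_zero]; exact zero_mem _⟩
  add_mem' hx hy := ⟨add_mem hx.1 hy.1, fun V' h h' => by
    rw [map_add]; exact add_mem (hx.2 V' h h') (hy.2 V' h h')⟩
  smul_mem' r x hx := ⟨Submodule.smul_mem _ _ hx.1, fun V' h h' => by
    rw [secRes_smul]; exact Submodule.smul_mem _ _ (hx.2 V' h h')⟩

/-- Only saturation needs an argument: the bound must be restored on all affine opens of V ∩ U by a
single power of f. As V ∩ U is quasi-compact, finitely many basic opens control all of them. -/
lemma isQCSub_boundBy [IsNoetherian S] (hM : ∀ U : S.affineOpens, LocalizesOn M U.1)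
    {N : ∀ U : S.affineOpens, Submodule Γ(S, U.1) Γ(M, U.1)} (hN : IsQCSub M ⊤ N)
    (U : S.affineOpens) (Q : Submodule Γ(S, U.1) Γ(M, U.1)) : IsQCSub M ⊤ (boundBy N Q) where
  res {V W} hV h x hx := by
    refine ⟨hN.res hV h hx.1, fun V' h' hU => ?_⟩
    rw [secRes_secRes]
    exact hx.2 V' _ hU
  sat {V} hV f x hx := by
    have hQ := isQCSub_generated hM Q
    obtain ⟨n, hn⟩ := hN.sat hV f x hx.1
    obtain ⟨s, hs, hcov⟩ := exists_finite_basicOpen_cover V.2 (inf_le_left : V.1 ⊓ U.1 ≤ V.1)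
      (NoetherianSpace.isCompact _)
    have key (g : s) : ∃ k : ℕ, secRes M (S.basicOpen_le g.1) (f ^ k • x) ∈
        generated Q (basicAff g.1) := by
      have hgU : (basicAff g.1).1 ≤ U.1 := (hs g.1 g.2).trans inf_le_right
      obtain ⟨k, hk⟩ := hQ.sat hgU (fres (S.basicOpen_le g.1) f)
        (secRes M (S.basicOpen_le g.1) x) (by
          have h1 : S.basicOpen (fres (S.basicOpen_le g.1) f) ≤ S.basicOpen f := by
            rw [Scheme.basicOpen_res]
            exact inf_le_right
          have := hx.2 (basicAff (fres (S.basicOpen_le g.1) f)) h1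
            ((S.basicOpen_le _).trans hgU)
          rw [secRes_secRes] at this ⊢
          exact this)
      refine ⟨k, ?_⟩
      rw [secRes_smul, map_pow]
      exact hk
    choose k hk using key
    let K := Finset.univ.sup k
    -- The exponent n brings x into `N`; the exponent K, a maximum over the finite cover, brings it
    -- into the submodules generated by `Q`.
    refine ⟨K + n, ?_, fun V' h' hU => ?_⟩
    · rw [pow_add, mul_smul]
      exact Submodule.smul_mem _ _ hn
    · refine hQ.mem_of_locally hU _ fun p hp => ?_
      obtain ⟨g, hg, hpg⟩ := hcov p ⟨h' hp, hU hp⟩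
      obtain ⟨W, hpW, hW⟩ := exists_affine_mem (V := S.basicOpen g ⊓ V'.1) ⟨hpg, hp⟩
      refine ⟨W, hW.trans inf_le_right, hpW, ?_⟩
      have h1 := hQ.res (V := W) ((hs g hg).trans inf_le_right) (hW.trans inf_le_left) (hk ⟨g, hg⟩)
      obtain ⟨c, hc⟩ := Nat.exists_eq_add_of_le (Finset.le_sup (f := k) (Finset.mem_univ ⟨g, hg⟩))
      rw [secRes_secRes] at h1 ⊢
      have : K + n = (c + n) + k ⟨g, hg⟩ := by change Finset.univ.sup k + n = _; omega
      rw [this, pow_add, mul_smul, secRes_smul]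
      exact Submodule.smul_mem _ _ h1

/-- A quasi-coherent family can be shrunk to one which is finitely generated over a given affine
open and contains finitely many given sections. -/
lemma exists_fg_sub [IsNoetherian S] (hM : ∀ U : S.affineOpens, LocalizesOn M U.1)
    {N : ∀ U : S.affineOpens, Submodule Γ(S, U.1) Γ(M, U.1)} (hN : IsQCSub M ⊤ N)
    (U : S.affineOpens) {J : Type*} [Finite J] (V : J → S.affineOpens) (m : ∀ j, Γ(M, (V j).1))
    (hm : ∀ j, m j ∈ N (V j)) :
    ∃ N' : ∀ U : S.affineOpens, Submodule Γ(S, U.1) Γ(M, U.1), IsQCSub M ⊤ N' ∧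
      (∀ W, N' W ≤ N W) ∧ (N' U).FG ∧ ∀ j, m j ∈ N' (V j) := by
  choose s hs hcov using fun j => exists_finite_basicOpen_cover U.2
    (inf_le_right : (V j).1 ⊓ U.1 ≤ U.1) (NoetherianSpace.isCompact _)
  have key (j : J) (g : s j) : ∃ (n : ℕ), ∃ q ∈ N U, secRes M (S.basicOpen_le g.1) q =
      fres (S.basicOpen_le g.1) g.1 ^ n • secRes M ((hs j g.1 g.2).trans inf_le_left) (m j) := by
    obtain ⟨n, q, hq⟩ := (hM U g.1).lift (secRes M ((hs j g.1 g.2).trans inf_le_left) (m j))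
    obtain ⟨k, hk⟩ := hN.sat le_top g.1 q (by
      rw [hq]
      exact Submodule.smul_mem _ _
        (hN.res (V := basicAff g.1) le_top ((hs j g.1 g.2).trans inf_le_left) (hm j)))
    refine ⟨k + n, _, hk, ?_⟩
    rw [secRes_smul, hq, map_pow, smul_smul, ← pow_add]
  choose n q hqN hq using key
  -- `Q` is spanned by numerators over `U` of the prescribed sections, taken on a finite cover of
  -- each V_j ∩ U by basic opens of `U`. Bounding `N` by `Q` then makes it finitely generated over
  -- `U` without losing those sections.
  let Q : Submodule Γ(S, U.1) Γ(M, U.1) :=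
    Submodule.span _ (Set.range fun t : Σ j, s j => q t.1 t.2)
  have hQN : Q ≤ N U := by
    rw [Submodule.span_le]
    rintro _ ⟨t, rfl⟩
    exact hqN t.1 t.2
  have hQ := isQCSub_generated hM Q
  refine ⟨boundBy N Q, isQCSub_boundBy hM hN U Q, fun W x hx => hx.1, ?_, fun j => ⟨hm j, ?_⟩⟩
  · have : boundBy N Q U = Q := by
      apply le_antisymm
      · intro x hx
        have := hx.2 U le_rfl le_rfl
        rwa [secRes_rfl, generated_self] at this
      · intro x hx
        exact ⟨hQN hx, fun V' h _ => secRes_mem_generated h hx⟩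
    rw [this]
    exact Submodule.fg_span (Set.finite_range _)
  · intro V' h hU
    refine hQ.mem_of_locally hU _ fun p hp => ?_
    obtain ⟨g, hg, hpg⟩ := hcov j p ⟨h hp, hU hp⟩
    obtain ⟨W, hpW, hW⟩ := exists_affine_mem (V := S.basicOpen g ⊓ V'.1) ⟨hpg, hp⟩
    refine ⟨W, hW.trans inf_le_right, hpW, ?_⟩
    have h1 := secRes_mem_generated (M := M) (V := W) (hW.trans (inf_le_left.trans (S.basicOpen_le g)))
      (Submodule.subset_span ⟨⟨j, ⟨g, hg⟩⟩, rfl⟩ : q j ⟨g, hg⟩ ∈ Q)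
    have h2 := congrArg (secRes M (hW.trans inf_le_left)) (hq j ⟨g, hg⟩)
    rw [secRes_secRes, secRes_smul, map_pow, fres_fres, secRes_secRes] at h2
    rw [h2] at h1
    rw [secRes_secRes]
    -- The denominator is invertible on `W`, so the prescribed section lies in the submodule
    -- together with its numerator.
    exact (Submodule.smul_mem_iff_of_isUnit _ (isUnit_fres_pow _ (hW.trans inf_le_left) _)).1 h1

end Extension

/-! ### Finiteness and flatness on affine opens -/

section AwayMap

variable {R R' M M' : Type*} [CommRing R] [CommRing R'] {τ : R →+* R'}
  [AddCommGroup M] [Module R M] [AddCommGroup M'] [Module R' M']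

lemma IsAwayMap.finite {f : R} (hR : letI := τ.toAlgebra; IsLocalization.Away f R')
    {β : M →ₛₗ[τ] M'} (h : IsAwayMap f β) [Module.Finite R M] : Module.Finite R' M' := by
  let := τ.toAlgebra
  let := Module.compHom M' τ
  have : IsScalarTower R R' M' := ⟨fun r s x => mul_smul (τ r) s x⟩
  have := h.isLocalizedModule (IsLocalization.Away.algebraMap_isUnit (S := R') f)
  exact Module.Finite.of_isLocalizedModule (.powers f) (Rₚ := R')
    { toFun := β, map_add' := β.map_add, map_smul' := fun r x => β.map_smulₛₗ r x }

lemma IsAwayMap.flat {f : R} (hR : letI := τ.toAlgebra; IsLocalization.Away f R')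
    {β : M →ₛₗ[τ] M'} (h : IsAwayMap f β) [Module.Flat R M] : Module.Flat R' M' := by
  let := τ.toAlgebra
  let := Module.compHom M' τ
  have : IsScalarTower R R' M' := ⟨fun r s x => mul_smul (τ r) s x⟩
  have := h.isLocalizedModule (IsLocalization.Away.algebraMap_isUnit (S := R') f)
  exact Module.Flat.of_isLocalizedModule (M := M) R' (.powers f)
    { toFun := β, map_add' := β.map_add, map_smul' := fun r x => β.map_smulₛₗ r x }

-- The canonical map between the abstract localization and the target is semilinear for the ring
-- isomorphism R_f ≃ R', and freeness passes along such an equivalence.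
attribute [local instance] RingHomInvPair.of_ringEquiv in
lemma IsAwayMap.free {f : R} (hR : letI := τ.toAlgebra; IsLocalization.Away f R')
    {β : M →ₛₗ[τ] M'} (h : IsAwayMap f β)
    (hM : Module.Free (Localization (.powers f)) (LocalizedModule.Away f M)) :
    Module.Free R' M' := by
  let := τ.toAlgebra
  let := Module.compHom M' τ
  have : IsScalarTower R R' M' := ⟨fun r s x => mul_smul (τ r) s x⟩
  have := h.isLocalizedModule (IsLocalization.Away.algebraMap_isUnit (S := R') f)
  let β' : M →ₗ[R] M' :=
    { toFun := β, map_add' := β.map_add, map_smul' := fun r x => β.map_smulₛₗ r x }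
  have : IsLocalizedModule (.powers f) β' := this
  set e := (IsLocalization.algEquiv (.powers f) (Localization (.powers f)) R').toRingEquiv
  refine (Module.Free.iff_of_equiv (σ := e)
    { __ := IsLocalizedModule.iso (.powers f) β', map_smul' := ?_ }).1 hM
  intro r x
  obtain ⟨r, s, rfl⟩ := IsLocalization.exists_mk'_eq (.powers f) r
  apply ((Module.End.isUnit_iff _).mp (IsLocalizedModule.map_units β' s)).1
  simp [e, ← map_smul, ← smul_assoc]

/-- Finiteness and flatness are local. -/
lemma finite_of_isAwayMap (s : Set R) (hs : Ideal.span s = ⊤) (R' M' : s → Type*)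
    [∀ f, CommRing (R' f)] [∀ f, AddCommGroup (M' f)] [∀ f, Module (R' f) (M' f)]
    (τ : ∀ f, R →+* R' f) (hR : ∀ f, letI := (τ f).toAlgebra; IsLocalization.Away f.1 (R' f))
    (β : ∀ f, M →ₛₗ[τ f] M' f) (h : ∀ f, IsAwayMap f.1 (β f))
    (hM : ∀ f, Module.Finite (R' f) (M' f)) : Module.Finite R M := by
  let (f : s) := (τ f).toAlgebra
  let (f : s) := Module.compHom (M' f) (τ f)
  have (f : s) : IsScalarTower R (R' f) (M' f) := ⟨fun r s x => mul_smul (τ f r) s x⟩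
  have (f : s) :=
    (h f).isLocalizedModule (IsLocalization.Away.algebraMap_isUnit (S := R' f) f.1)
  exact Module.Finite.of_localizationSpan' s hs (Rₚ := R') (fun f =>
    { toFun := β f, map_add' := (β f).map_add, map_smul' := fun r x => (β f).map_smulₛₗ r x }) hM

lemma flat_of_isAwayMap (s : Set R) (hs : Ideal.span s = ⊤) (R' M' : s → Type*)
    [∀ f, CommRing (R' f)] [∀ f, AddCommGroup (M' f)] [∀ f, Module (R' f) (M' f)]
    (τ : ∀ f, R →+* R' f) (hR : ∀ f, letI := (τ f).toAlgebra; IsLocalization.Away f.1 (R' f))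
    (β : ∀ f, M →ₛₗ[τ f] M' f) (h : ∀ f, IsAwayMap f.1 (β f))
    (hM : ∀ f, Module.Flat (R' f) (M' f)) : Module.Flat R M := by
  let (f : s) := (τ f).toAlgebra
  let (f : s) := Module.compHom (M' f) (τ f)
  have (f : s) : IsScalarTower R (R' f) (M' f) := ⟨fun r s x => mul_smul (τ f r) s x⟩
  have (f : s) :=
    (h f).isLocalizedModule (IsLocalization.Away.algebraMap_isUnit (S := R' f) f.1)
  refine Module.flat_of_isLocalized_span R M s hs M' (fun f =>
    { toFun := β f, map_add' := (β f).map_add, map_smul' := fun r x => (β f).map_smulₛₗ r x })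
    fun f => ?_
  have := IsLocalization.flat (R' f) (.powers f.1)
  exact Module.Flat.trans R (R' f) (M' f)

end AwayMap

lemma LocalizesOn.isAwayMap {M : S.Modules} {U : S.Opens} (h : LocalizesOn M U) (f : Γ(S, U)) :
    IsAwayMap f (secRes M (S.basicOpen_le f)) := ⟨(h f).torsion, (h f).lift⟩

lemma isLocalization_fres {U : S.Opens} (hU : IsAffineOpen U) (f : Γ(S, U)) :
    letI := (fres (S.basicOpen_le f)).toAlgebra
    IsLocalization.Away f Γ(S, S.basicOpen f) :=
  hU.isLocalization_basicOpen f

section Sheaf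

variable {M : S.Modules} (hM : ∀ U : S.affineOpens, LocalizesOn M U.1)

include hM

/-- Finiteness of the sections on affine opens may be checked on a cover. -/
lemma finite_of_cover (h : ∀ x : S, ∃ U : S.affineOpens, x ∈ U.1 ∧
    Module.Finite Γ(S, U.1) Γ(M, U.1)) (U : S.affineOpens) : Module.Finite Γ(S, U.1) Γ(M, U.1) := by
  choose V hV hVM using h
  refine of_affine_open_cover (P := fun U => Module.Finite Γ(S, U.1) Γ(M, U.1)) V
    (eq_top_iff.2 fun x _ => Opens.mem_iSup.2 ⟨x, hV x⟩) U ?_ ?_ hVM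
  · intro U f h
    exact ((hM U).isAwayMap f).finite (isLocalization_fres U.2 f)
  · intro U s hs h
    exact finite_of_isAwayMap (s : Set _) hs (fun f => Γ(S, S.basicOpen f.1))
      (fun f => Γ(M, S.basicOpen f.1)) (fun f => fres (S.basicOpen_le f.1))
      (fun f => isLocalization_fres U.2 f.1) (fun f => secRes M (S.basicOpen_le f.1))
      (fun f => (hM U).isAwayMap f.1) h

lemma flat_of_cover (h : ∀ x : S, ∃ U : S.affineOpens, x ∈ U.1 ∧
    Module.Flat Γ(S, U.1) Γ(M, U.1)) (U : S.affineOpens) : Module.Flat Γ(S, U.1) Γ(M, U.1) := by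
  choose V hV hVM using h
  refine of_affine_open_cover (P := fun U => Module.Flat Γ(S, U.1) Γ(M, U.1)) V
    (eq_top_iff.2 fun x _ => Opens.mem_iSup.2 ⟨x, hV x⟩) U ?_ ?_ hVM
  · intro U f h
    exact ((hM U).isAwayMap f).flat (isLocalization_fres U.2 f)
  · intro U s hs h
    exact flat_of_isAwayMap (s : Set _) hs (fun f => Γ(S, S.basicOpen f.1))
      (fun f => Γ(M, S.basicOpen f.1)) (fun f => fres (S.basicOpen_le f.1))
      (fun f => isLocalization_fres U.2 f.1) (fun f => secRes M (S.basicOpen_le f.1))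
      (fun f => (hM U).isAwayMap f.1) h

/-- A finite projective module of sections is free near every point. -/
lemma exists_free_nhd [IsLocallyNoetherian S] (U : S.affineOpens)
    (h : Module.Finite Γ(S, U.1) Γ(M, U.1)) (h' : Module.Projective Γ(S, U.1) Γ(M, U.1)) {x : S}
    (hx : x ∈ U.1) : ∃ V : S.affineOpens, x ∈ V.1 ∧ V.1 ≤ U.1 ∧ Module.Free Γ(S, V.1) Γ(M, V.1) ∧
      Module.Finite Γ(S, V.1) Γ(M, V.1) := by
  have : IsNoetherianRing Γ(S, U.1) := IsLocallyNoetherian.component_noetherian U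
  have := Module.finitePresentation_of_finite Γ(S, U.1) Γ(M, U.1)
  let P := U.2.primeIdealOf ⟨x, hx⟩
  have hP : P ∈ Module.freeLocus Γ(S, U.1) Γ(M, U.1) := by
    rw [Module.freeLocus_eq_univ]; trivial
  have : Module.Free _ _ := hP
  -- A projective module is free at the prime of x, and for a finitely presented module freeness at
  -- a prime spreads to a basic open.
  obtain ⟨r, hr, hr', _⟩ := Module.FinitePresentation.exists_free_localizedModule_powers
    P.asIdeal.primeCompl (LocalizedModule.mkLinearMap P.asIdeal.primeCompl Γ(M, U.1))
    (Localization.AtPrime P.asIdeal)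
  refine ⟨basicAff r, ?_, S.basicOpen_le r, ((hM U).isAwayMap r).free (isLocalization_fres U.2 r) hr',
    ((hM U).isAwayMap r).finite (isLocalization_fres U.2 r)⟩
  have h1 : P ∈ PrimeSpectrum.basicOpen r := hr
  have h2 := U.2.fromSpec_preimage_basicOpen r
  rw [← h2] at h1
  have h3 : U.2.fromSpec P = x := U.2.fromSpec_primeIdealOf ⟨x, hx⟩
  have h4 : U.2.fromSpec P ∈ S.basicOpen r := h1
  rwa [h3] at h4

end Sheaf

/-! ### Equivariant vector bundles and finite projective modules -/

namespace EquivModule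

variable {G : Over S} [GrpObj G] [IsAffineHom G.hom]

lemma localizesOn (E : EquivModule G) (U : S.affineOpens) : LocalizesOn E.sheaf U.1 :=
  have := E.isQuasicoherent
  localizesOn_of_isQuasicoherent E.sheaf U.2

lemma IsVectorBundle.finite {E : EquivModule G} (hE : E.IsVectorBundle) (U : S.affineOpens) :
    Module.Finite Γ(S, U.1) Γ(E.sheaf, U.1) :=
  finite_of_cover E.localizesOn (fun x => (hE x).imp fun _ h => ⟨h.1, h.2.2⟩) U

/-- Freeness on a cover gives flatness over every affine open, and a finite flat module over a
noetherian ring is projective. -/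
lemma IsVectorBundle.projective [IsLocallyNoetherian S] {E : EquivModule G} (hE : E.IsVectorBundle)
    (U : S.affineOpens) : Module.Projective Γ(S, U.1) Γ(E.sheaf, U.1) := by
  have := flat_of_cover E.localizesOn
    (fun x => (hE x).imp fun V h => ⟨h.1, by
      have := h.2.1
      have : Module.Projective Γ(S, V.1) Γ(E.sheaf, V.1) := Module.Projective.of_free
      exact Module.Flat.of_projective⟩) U
  have := hE.finite U
  have : IsNoetherianRing Γ(S, U.1) := IsLocallyNoetherian.component_noetherian U
  have := Module.finitePresentation_of_finite Γ(S, U.1) Γ(E.sheaf, U.1)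
  exact Module.Flat.projective_of_finitePresentation

lemma isVectorBundle_of_projective [IsLocallyNoetherian S] {E : EquivModule G}
    (h : ∀ U : S.affineOpens, Module.Finite Γ(S, U.1) Γ(E.sheaf, U.1))
    (h' : ∀ U : S.affineOpens, Module.Projective Γ(S, U.1) Γ(E.sheaf, U.1)) :
    E.IsVectorBundle := by
  intro x
  obtain ⟨U, hxU, -⟩ := exists_affine_mem (V := (⊤ : S.Opens)) (p := x) trivial
  obtain ⟨V, hxV, -, h1, h2⟩ := exists_free_nhd E.localizesOn U (h U) (h' U) hxU
  exact ⟨V, hxV, h1, h2⟩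

end EquivModule

/-! ### Coherent submodules containing given sections -/

/-- Start from the whole sheaf and make the family finitely generated over one member of a finite
affine cover after another, never losing what has been achieved; finiteness over the cover gives
finiteness over all affine opens. -/
theorem exists_coherent_sub [IsNoetherian S] {M : S.Modules}
    (hM : ∀ U : S.affineOpens, LocalizesOn M U.1) {J : Type u} [Finite J] (V : J → S.affineOpens)
    (m : ∀ j, Γ(M, (V j).1)) :
    ∃ N : ∀ U : S.affineOpens, Submodule Γ(S, U.1) Γ(M, U.1), IsQCSub M ⊤ N ∧
      (∀ W, (N W).FG) ∧ ∀ j, m j ∈ N (V j) := by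
  have step (t : Finset S.affineOpens) : ∃ N : ∀ U : S.affineOpens, Submodule Γ(S, U.1) Γ(M, U.1),
      IsQCSub M ⊤ N ∧ (∀ W ∈ t, (N W).FG) ∧ ∀ j, m j ∈ N (V j) := by
    classical
    induction t using Finset.induction_on with
    | empty => exact ⟨fun _ => ⊤, ⟨fun _ _ _ _ => trivial, fun _ _ _ _ => ⟨0, trivial⟩⟩, by simp,
        fun _ => trivial⟩
    | insert U t hU ih =>
      obtain ⟨N, hN, hfg, hm⟩ := ih
      choose g hg using fun W : t => hfg W.1 W.2
      -- Besides the given sections, the generators over the opens already treated are retained, so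
      -- that the family does not change there.
      obtain ⟨N', hN', hle, hfg', hm'⟩ := exists_fg_sub hM hN U
        (J := J ⊕ Σ W : t, g W)
        (Sum.elim V fun w => w.1.1)
        (fun j => match j with
          | .inl j => m j
          | .inr w => w.2.1)
        (fun j => match j with
          | .inl j => hm j
          | .inr w => by
            have := Submodule.subset_span (R := Γ(S, w.1.1.1)) w.2.2
            rwa [hg] at this)
      refine ⟨N', hN', fun W hW => ?_, fun j => hm' (.inl j)⟩
      rcases Finset.mem_insert.1 hW with rfl | hW
      · exact hfg'
      · have : N' W = N W := by
          refine le_antisymm (hle W) ?_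
          rw [← hg ⟨W, hW⟩, Submodule.span_le]
          intro x hx
          exact hm' (.inr ⟨⟨W, hW⟩, ⟨x, hx⟩⟩)
        rw [this]
        exact hfg W hW
  choose A hA using fun x : S => exists_affine_mem (V := (⊤ : S.Opens)) (p := x) trivial
  obtain ⟨t, ht⟩ := (isCompact_univ (X := S)).elim_finite_subcover (fun x : S => ((A x).1 : Set S))
    (fun x => (A x).1.2) (fun x _ => Set.mem_iUnion.2 ⟨x, (hA x).1⟩)
  classical
  obtain ⟨N, hN, hfg, hm⟩ := step (t.image A)
  refine ⟨N, hN, fun W => ?_, hm⟩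
  have key (W : S.affineOpens) : (N W).FG ↔
      Module.Finite Γ(S, W.1) Γ(hN.toSubSheaf.toModules, W.1) := by
    rw [← hN.toSubSheaf_obj, ← Module.Finite.iff_fg]
    exact (Module.Finite.equiv_iff (hN.toSubSheaf.secEquiv W.1)).symm
  rw [key]
  refine finite_of_cover (hN.localizesOn hM) (fun x => ?_) W
  obtain ⟨y, hy, hxy⟩ := Set.mem_iUnion₂.1 (ht (Set.mem_univ x))
  exact ⟨A y, hxy, (key _).1 (hfg _ (Finset.mem_image_of_mem A hy))⟩

/-! ### Equivariant submodules -/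

lemma fres_basicOpen_of_qcqs {U V : S.Opens} (h1 : IsCompact (U : Set S))
    (h2 : IsQuasiSeparated (U : Set S)) (g : Γ(S, U)) (hV : V = S.basicOpen g) (h : V ≤ U) :
    (∀ x, fres h x = 0 → ∃ n : ℕ, g ^ n * x = 0) ∧
      ∀ y, ∃ (n : ℕ) (x : Γ(S, U)), fres h x = fres h g ^ n * y := by
  subst hV
  have := isLocalization_basicOpen_of_qcqs h1 h2 g
  constructor
  · intro x hx
    obtain ⟨⟨_, n, rfl⟩, hn⟩ := (IsLocalization.map_eq_zero_iff (.powers g) _ x).1 hx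
    exact ⟨n, hn⟩
  · intro y
    obtain ⟨⟨x, ⟨_, n, rfl⟩⟩, hx⟩ := IsLocalization.surj (.powers g) y
    refine ⟨n, x, ?_⟩
    rw [← map_pow, mul_comm]
    exact hx.symm

lemma smul_coord (Y : Over S) {U : S.Opens} (f : Γ(S, U)) (x : Coord Y U) :
    f • x = (show Γ(Y.left, Y.hom ⁻¹ᵁ U) from
      Y.hom.app U f * (show Γ(Y.left, Y.hom ⁻¹ᵁ U) from x)) := by
  rw [Algebra.smul_def]
  change (Y.hom.appLE U (Y.hom ⁻¹ᵁ U) le_rfl).hom f * _ = _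
  rw [Scheme.Hom.appLE_eq_app]

/-- The preimage of D(f) is the basic open of the pulled back function, so this is localization of
functions on a quasi-compact quasi-separated open. -/
lemma coordRes_isAwayMap (Y : Over S) {U : S.Opens} (f : Γ(S, U))
    (h1 : IsCompact (X := Y.left) (Y.hom ⁻¹ᵁ U)) (h2 : IsQuasiSeparated (α := Y.left) (Y.hom ⁻¹ᵁ U)) :
    IsAwayMap f (coordRes Y (S.basicOpen_le f)) := by
  obtain ⟨ht, hl⟩ := fres_basicOpen_of_qcqs h1 h2 (Y.hom.app U f)
    (Scheme.preimage_basicOpen Y.hom f) (Y.hom.preimage_mono (S.basicOpen_le f))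
  constructor
  · intro x hx
    obtain ⟨n, hn⟩ := ht x hx
    refine ⟨n, ?_⟩
    rw [smul_coord, map_pow]
    exact hn
  · intro y
    obtain ⟨n, x, hx⟩ := hl y
    refine ⟨n, x, hx.trans ?_⟩
    rw [smul_coord, map_pow]
    congr 2
    exact (ConcreteCategory.congr_hom (Y.hom.naturality (homOfLE (S.basicOpen_le f)).op) f).symm

section

variable {G : Over S} [IsAffineHom G.hom] [Flat G.hom]

instance flat_coord (U : S.affineOpens) : Module.Flat Γ(S, U.1) (Coord G U.1) :=
  Flat.flat_appLE G.hom U.2 (U.2.preimage G.hom) le_rfl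

end

lemma coordRes_isAwayMap_of_affine (G : Over S) [IsAffineHom G.hom] (U : S.affineOpens)
    (f : Γ(S, U.1)) : IsAwayMap f (coordRes G (S.basicOpen_le f)) :=
  coordRes_isAwayMap G f (U.2.preimage G.hom).isCompact (U.2.preimage G.hom).isQuasiSeparated

/-! ### Subcomodules over a flat algebra -/

section Restrict

open TensorProduct

variable {R A M N : Type*} [CommRing R] [CommRing A] [Algebra R A]
  [AddCommGroup M] [Module R M] [AddCommGroup N] [Module R N]

lemma lTensor_injective [Module.Flat R A] {j : N →ₗ[R] M} (hj : Function.Injective j) :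
    Function.Injective (j.lTensor A) :=
  Module.Flat.lTensor_preserves_injective_linearMap j hj

/-- The restriction of a coaction to a submodule. -/
def restrictCoact [Module.Flat R A] (δ : M →ₗ[R] A ⊗[R] M) (j : N →ₗ[R] M)
    (hj : Function.Injective j) (h : ∀ n, δ (j n) ∈ LinearMap.range (j.lTensor A)) :
    N →ₗ[R] A ⊗[R] N :=
  (LinearEquiv.ofInjective (j.lTensor A) (lTensor_injective hj)).symm.toLinearMap ∘ₗ
    LinearMap.codRestrict _ (δ ∘ₗ j) h

lemma lTensor_restrictCoact [Module.Flat R A] (δ : M →ₗ[R] A ⊗[R] M) (j : N →ₗ[R] M)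
    (hj : Function.Injective j) (h : ∀ n, δ (j n) ∈ LinearMap.range (j.lTensor A)) (n : N) :
    j.lTensor A (restrictCoact δ j hj h n) = δ (j n) :=
  congrArg Subtype.val ((LinearEquiv.ofInjective (j.lTensor A)
    (lTensor_injective hj)).apply_symm_apply (LinearMap.codRestrict _ (δ ∘ₗ j) h n))

lemma lTensor_assoc (j : N →ₗ[R] M) (z : (A ⊗[R] A) ⊗[R] N) :
    (j.lTensor A).lTensor A (TensorProduct.assoc R A A N z) =
      TensorProduct.assoc R A A M (j.lTensor (A ⊗[R] A) z) := by
  induction z with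
  | zero => simp
  | add x y hx hy => simp only [map_add, hx, hy]
  | tmul w m =>
    induction w with
    | zero => simp
    | add x y hx hy => simp only [map_add, add_tmul, hx, hy]
    | tmul a b => simp

/-- A tensor is a finite sum of pure tensors. Applied to coactions, this is the local finiteness of
comodules. -/
lemma exists_finset_tensor (z : A ⊗[R] M) : ∃ s : Finset M, ∀ N : Submodule R M, (∀ x ∈ s, x ∈ N) →
    z ∈ LinearMap.range (N.subtype.lTensor A) := by
  classical
  induction z with
  | zero => exact ⟨∅, fun N _ => zero_mem _⟩
  | tmul a m => exact ⟨{m}, fun N h => ⟨a ⊗ₜ ⟨m, h m (by simp)⟩, by simp⟩⟩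
  | add x y hx hy =>
    obtain ⟨s, hs⟩ := hx
    obtain ⟨t, ht⟩ := hy
    exact ⟨s ∪ t, fun N h => add_mem (hs N fun x hx => h x (Finset.mem_union_left _ hx))
      (ht N fun x hx => h x (Finset.mem_union_right _ hx))⟩

/-- The elements whose coaction has coefficients in `N` form a subcomodule. -/
lemma coact_mem_range [Module.Flat R A] {Δ : A →ₐ[R] A ⊗[R] A} {δ : M →ₗ[R] A ⊗[R] M}
    (hδ : Coassoc Δ δ) (N : Submodule R M) {m : M} (hm : δ m ∈ LinearMap.range (N.subtype.lTensor A)) :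
    δ m ∈ LinearMap.range
      ((Submodule.comap δ (LinearMap.range (N.subtype.lTensor A))).subtype.lTensor A) := by
  set F := Submodule.comap δ (LinearMap.range (N.subtype.lTensor A)) with hF
  set φ : A ⊗[R] M →ₗ[R] A ⊗[R] (M ⧸ N) := N.mkQ.lTensor A
  have hφ : Function.Exact (N.subtype.lTensor A) φ :=
    lTensor_exact A (LinearMap.exact_subtype_mkQ N) N.mkQ_surjective
  have hex : Function.Exact F.subtype (φ ∘ₗ δ) := by
    intro x
    rw [LinearMap.comp_apply, hφ (δ x)]
    simp [hF]
  -- `F` is the kernel of M → A ⊗ M/N, and flatness keeps this exact after tensoring with `A`; so it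
  -- remains to see that δ m dies in A ⊗ (A ⊗ M/N).
  have hex' := Module.Flat.lTensor_exact A hex
  refine (hex' (δ m)).1 ?_
  obtain ⟨w, hw⟩ := hm
  -- By coassociativity (1 ⊗ δ)(δ m) = (Δ ⊗ 1)(δ m), whose coefficients are still in `N`.
  rw [LinearMap.lTensor_comp, LinearMap.comp_apply, hδ, ← hw, ← LinearMap.comp_apply
    (LinearMap.rTensor M _), LinearMap.rTensor_comp_lTensor, ← LinearMap.lTensor_comp_rTensor,
    LinearMap.comp_apply, ← lTensor_assoc, ← LinearMap.comp_apply (LinearMap.lTensor A φ),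
    ← LinearMap.lTensor_comp]
  have : φ ∘ₗ N.subtype.lTensor A = 0 := LinearMap.ext fun x => hφ.apply_apply_eq_zero x
  rw [this, LinearMap.lTensor_zero, LinearMap.zero_apply]

end Restrict

/-! ### Equivariant quasi-coherent submodules -/

namespace EquivModule

variable {G : Over S} [GrpObj G] [IsAffineHom G.hom]

/-- The sections whose coaction has coefficients in `N`. -/
def core (E : EquivModule G) (N : ∀ U : S.affineOpens, Submodule Γ(S, U.1) Γ(E.sheaf, U.1))
    (U : S.affineOpens) : Submodule Γ(S, U.1) Γ(E.sheaf, U.1) :=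
  Submodule.comap (E.coact U) (LinearMap.range ((N U).subtype.lTensor (Coord G U.1)))

/-- The counit recovers x as a combination of the coefficients of its coaction. -/
lemma core_le (E : EquivModule G)
    {N : ∀ U : S.affineOpens, Submodule Γ(S, U.1) Γ(E.sheaf, U.1)} (U : S.affineOpens) :
    E.core N U ≤ N U := by
  intro x hx
  obtain ⟨w, hw⟩ := hx
  rw [← E.counit_coact U x, ← hw]
  clear hw
  induction w with
  | zero => simp
  | add x y hx hy => simp only [map_add]; exact add_mem hx hy
  | tmul a n =>
    simp only [LinearMap.lTensor_tmul, LinearMap.rTensor_tmul, TensorProduct.lid_tmul]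
    exact Submodule.smul_mem _ _ n.2

/-- The core is a preimage under the coaction of tensors with coefficients in `N`. Restriction of
tensors to D(f) is again a localization, so saturation of `N` passes to it. -/
lemma isQCSub_core (E : EquivModule G)
    {N : ∀ U : S.affineOpens, Submodule Γ(S, U.1) Γ(E.sheaf, U.1)} (hN : IsQCSub E.sheaf ⊤ N) :
    IsQCSub E.sheaf ⊤ (E.core N) where
  res {U V} hU h x hx := by
    obtain ⟨w, hw⟩ := hx
    change E.coact V (secRes E.sheaf h x) ∈
      LinearMap.range ((N V).subtype.lTensor (Coord G V.1))
    rw [E.coact_res, ← hw]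
    clear hw
    induction w with
    | zero => simp
    | add x y hx hy => simp only [map_add]; exact add_mem hx hy
    | tmul a n =>
      refine ⟨coordRes G h a ⊗ₜ ⟨secRes E.sheaf h n.1, hN.res hU h n.2⟩, ?_⟩
      rw [LinearMap.lTensor_tmul, LinearMap.lTensor_tmul, TensorProduct.map_tmul]
      rfl
  sat {U} hU f x hx := by
    have hA := coordRes_isAwayMap_of_affine G U f
    have hM := E.localizesOn U
    have key (w : Coord G (S.basicOpen f) ⊗[Γ(S, S.basicOpen f)] N (basicAff f)) :
        ∃ (n : ℕ) (v : Coord G U.1 ⊗[Γ(S, U.1)] N U),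
        TensorProduct.map (coordRes G (S.basicOpen_le f)) (secRes E.sheaf (S.basicOpen_le f))
          ((N U).subtype.lTensor (Coord G U.1) v) =
        fres (S.basicOpen_le f) f ^ n •
          (N (basicAff f)).subtype.lTensor (Coord G (S.basicOpen f)) w := by
      induction w with
      | zero => exact ⟨0, 0, by simp⟩
      | add x y hx hy =>
        obtain ⟨n, x', hx⟩ := hx
        obtain ⟨k, y', hy⟩ := hy
        refine ⟨n + k, f ^ k • x' + f ^ n • y', ?_⟩
        rw [map_add, map_smul, map_smul, map_add, map_smulₛₗ, map_smulₛₗ, hx, hy, map_pow, map_pow,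
          smul_smul, smul_smul, ← pow_add, ← pow_add, add_comm k n, map_add, smul_add]
      | tmul a n =>
        obtain ⟨k, a', ha⟩ := hA.lift a
        obtain ⟨l, m, hm⟩ := (hM f).lift n.1
        obtain ⟨l', hl'⟩ := hN.sat hU f m (by
          rw [hm]; exact Submodule.smul_mem _ _ n.2)
        refine ⟨k + (l' + l), a' ⊗ₜ ⟨_, hl'⟩, ?_⟩
        rw [LinearMap.lTensor_tmul, LinearMap.lTensor_tmul, TensorProduct.map_tmul, ha,
          Submodule.subtype_apply, secRes_smul, hm, map_pow, smul_smul, ← pow_add, pow_add _ k,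
          mul_smul, TensorProduct.tmul_smul, TensorProduct.smul_tmul', smul_comm]
        rfl
    obtain ⟨w, hw⟩ := hx
    obtain ⟨n, v, hv⟩ := key w
    -- The lifted tensor and f ^ n times the coaction of x agree over D(f), hence differ by f-power
    -- torsion.
    obtain ⟨k, hk⟩ := (hA.tensor (isLocalization_fres U.2 f) (hM.isAwayMap f)).torsion
      ((N U).subtype.lTensor (Coord G U.1) v - f ^ n • E.coact U x) (by
        rw [map_sub, hv, map_smulₛₗ, hw, map_pow, sub_eq_zero]
        congr 1
        exact E.coact_res U (basicAff f) (S.basicOpen_le f) x)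
    refine ⟨k + n, ?_⟩
    change E.coact U (f ^ (k + n) • x) ∈ LinearMap.range ((N U).subtype.lTensor (Coord G U.1))
    rw [map_smul, pow_add, mul_smul]
    rw [smul_sub, sub_eq_zero] at hk
    rw [← hk]
    exact Submodule.smul_mem _ _ ⟨v, rfl⟩

variable [Flat G.hom]

/-- An equivariant structure on a quasi-coherent subsheaf stable under the coaction. -/
def ofInjective (E : EquivModule G) (T : S.Modules) (hT : T.IsQuasicoherent) (j : T ⟶ E.sheaf)
    (hj : ∀ U : S.affineOpens, Function.Injective (homSec j U.1))
    (hδ : ∀ (U : S.affineOpens) (x : Γ(T, U.1)), E.coact U (homSec j U.1 x) ∈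
      LinearMap.range ((homSec j U.1).lTensor (Coord G U.1))) : EquivModule G where
  sheaf := T
  isQuasicoherent := hT
  coact U := restrictCoact (E.coact U) (homSec j U.1) (hj U) (hδ U)
  coact_res U V h x := by
    apply lTensor_injective (A := Coord G V.1) (hj V)
    have k (z : Coord G U.1 ⊗[Γ(S, U.1)] Γ(T, U.1)) :
        (homSec j V.1).lTensor (Coord G V.1) (TensorProduct.map (coordRes G h) (secRes T h) z) =
        TensorProduct.map (coordRes G h) (secRes E.sheaf h)
          ((homSec j U.1).lTensor (Coord G U.1) z) := by
      induction z with
      | zero => simp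
      | add x y hx hy => simp only [map_add, hx, hy]
      | tmul a m => simp [homSec_secRes]
    rw [k, lTensor_restrictCoact, lTensor_restrictCoact, homSec_secRes, E.coact_res]
  counit_coact U x := by
    apply hj U
    have k (z : Coord G U.1 ⊗[Γ(S, U.1)] Γ(T, U.1)) :
        homSec j U.1 (TensorProduct.lid _ _ ((counit G U.1).toLinearMap.rTensor _ z)) =
        TensorProduct.lid _ _ ((counit G U.1).toLinearMap.rTensor _
          ((homSec j U.1).lTensor (Coord G U.1) z)) := by
      induction z with
      | zero => simp
      | add x y hx hy => simp only [map_add, hx, hy]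
      | tmul a m => simp
    rw [k, lTensor_restrictCoact, E.counit_coact]
  coassoc U x := by
    apply lTensor_injective (A := Coord G U.1) (lTensor_injective (A := Coord G U.1) (hj U))
    rw [lTensor_assoc, ← LinearMap.comp_apply (LinearMap.lTensor _ (homSec j U.1)),
      LinearMap.lTensor_comp_rTensor, ← LinearMap.rTensor_comp_lTensor, LinearMap.comp_apply,
      lTensor_restrictCoact, ← E.coassoc, ← LinearMap.comp_apply (LinearMap.lTensor _ _),
      ← LinearMap.lTensor_comp]
    have : (homSec j U.1).lTensor (Coord G U.1) ∘ₗ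
        restrictCoact (E.coact U) (homSec j U.1) (hj U) (hδ U) = E.coact U ∘ₗ homSec j U.1 :=
      LinearMap.ext fun x => lTensor_restrictCoact _ _ _ _ _
    rw [this, LinearMap.lTensor_comp, LinearMap.comp_apply, lTensor_restrictCoact]

lemma isEquivariantHom_ofInjective (E : EquivModule G) (T : S.Modules) (hT : T.IsQuasicoherent)
    (j : T ⟶ E.sheaf) (hj : ∀ U : S.affineOpens, Function.Injective (homSec j U.1))
    (hδ : ∀ (U : S.affineOpens) (x : Γ(T, U.1)), E.coact U (homSec j U.1 x) ∈
      LinearMap.range ((homSec j U.1).lTensor (Coord G U.1))) :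
    IsEquivariantHom (E.ofInjective T hT j hj hδ) E j :=
  fun U x => (lTensor_restrictCoact (E.coact U) (homSec j U.1) (hj U) (hδ U) x).symm

/-- A quasi-coherent family of submodules stable under the coaction underlies an equivariant
submodule. -/
lemma exists_sub (E : EquivModule G) {N : ∀ U : S.affineOpens, Submodule Γ(S, U.1) Γ(E.sheaf, U.1)}
    (hN : IsQCSub E.sheaf ⊤ N)
    (hδ : ∀ (U : S.affineOpens), ∀ x ∈ N U, E.coact U x ∈
      LinearMap.range ((N U).subtype.lTensor (Coord G U.1))) :
    ∃ (F : EquivModule G) (j : F.sheaf ⟶ E.sheaf), IsEquivariantHom F E j ∧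
      (∀ U : S.affineOpens, Function.Injective (homSec j U.1)) ∧
      ∀ U : S.affineOpens, LinearMap.range (homSec j U.1) = N U := by
  let T := hN.toSubSheaf
  have hj (U : S.affineOpens) : Function.Injective (homSec T.incl U.1) := fun x y h =>
    (T.secEquiv U.1).injective (Subtype.ext h)
  have hr (U : S.affineOpens) : LinearMap.range (homSec T.incl U.1) = N U := by
    rw [← hN.toSubSheaf_obj]
    ext x
    constructor
    · rintro ⟨y, rfl⟩
      exact (T.secEquiv U.1 y).2
    · intro hx
      exact ⟨(T.secEquiv U.1).symm ⟨x, hx⟩, rfl⟩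
  refine ⟨E.ofInjective T.toModules (hN.isQuasicoherent E.localizesOn) T.incl hj fun U x => ?_,
    T.incl, isEquivariantHom_ofInjective E _ _ _ _ _, hj, hr⟩
  have hx : homSec T.incl U.1 x ∈ N U := by
    rw [← hr]
    exact ⟨x, rfl⟩
  obtain ⟨w, hw⟩ := hδ U _ hx
  rw [← hw]
  clear hw hx
  induction w with
  | zero => rw [map_zero]; exact zero_mem _
  | add x y hx hy => rw [map_add]; exact add_mem hx hy
  | tmul a n =>
    obtain ⟨y, hy⟩ : (n : Γ(E.sheaf, U.1)) ∈ LinearMap.range (homSec T.incl U.1) :=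
      (hr U).symm ▸ n.2
    exact ⟨a ⊗ₜ y, by rw [LinearMap.lTensor_tmul, LinearMap.lTensor_tmul, hy]; rfl⟩

/-- Finitely many sections of an equivariant module lie in a coherent equivariant submodule. -/
theorem exists_coherent_sub [IsNoetherian S] (E : EquivModule G) {J : Type u} [Finite J]
    (V : J → S.affineOpens) (m : ∀ j, Γ(E.sheaf, (V j).1)) :
    ∃ (F : EquivModule G) (h : F.sheaf ⟶ E.sheaf), F.IsCoherent ∧ IsEquivariantHom F E h ∧
      ∀ j, ∃ y : Γ(F.sheaf, (V j).1), homSec h (V j).1 y = m j := by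
  -- Take a coherent `N` containing all coefficients of the coactions of the given sections. Its
  -- core contains these sections, is stable under the coaction, and lies in `N`, hence is coherent
  -- as the base is noetherian.
  choose s hs using fun j => exists_finset_tensor (E.coact (V j) (m j))
  obtain ⟨N, hN, hfg, hm⟩ := GeomConc.exists_coherent_sub E.localizesOn
    (J := Σ j, s j) (fun t => V t.1) (fun t => t.2.1)
  obtain ⟨F, h, hF, hinj, hr⟩ := E.exists_sub (E.isQCSub_core hN) fun U x hx =>
    coact_mem_range (E.coassoc U) (N U) hx
  refine ⟨F, h, fun U => ?_, hF, fun j => ?_⟩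
  · have : IsNoetherianRing Γ(S, U.1) := IsLocallyNoetherian.component_noetherian U
    have : Module.Finite Γ(S, U.1) (N U) := Module.Finite.iff_fg.2 (hfg U)
    let e : Γ(F.sheaf, U.1) →ₗ[Γ(S, U.1)] N U := LinearMap.codRestrict _ (homSec h U.1) fun x =>
      E.core_le U (by rw [← hr]; exact ⟨x, rfl⟩)
    exact Module.Finite.of_injective e fun x y hxy => hinj U (congrArg Subtype.val hxy)
  · have : m j ∈ LinearMap.range (homSec h (V j).1) := by
      rw [hr]
      exact hs j (N (V j)) fun x hx => hm ⟨j, ⟨x, hx⟩⟩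
    exact this

end EquivModule

/-! ### The algebra of functions on a scheme with an action -/

lemma coordRes_coordRes (Y : Over S) {U V W : S.Opens} (h : V ≤ U) (h' : W ≤ V) (x : Coord Y U) :
    coordRes Y h' (coordRes Y h x) = coordRes Y (h'.trans h) x :=
  fres_fres (Y.hom.preimage_mono h) (Y.hom.preimage_mono h') x

/-- The sheaf data of the direct image of the structure sheaf. -/
def coordData (Y : Over S) : SheafData S where
  obj U := Coord Y U
  res h := coordRes Y h
  res_rfl x := fres_rfl (S := Y.left) x
  res_res h h' x := coordRes_coordRes Y h h' x
  ext V _ _ h := fun_ext (S := Y.left) (fun j => Y.hom ⁻¹ᵁ V j)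
    (fun j => Y.hom.preimage_mono (le_iSup V j)) (Scheme.Hom.preimage_iSup Y.hom V).le h
  glue V x h := fun_glue (S := Y.left) (fun j => Y.hom ⁻¹ᵁ V j)
    (fun j => Y.hom.preimage_mono (le_iSup V j)) (Scheme.Hom.preimage_iSup Y.hom V).le x h

/-- The direct image of the structure sheaf of an `S`-scheme. -/
def coordSheaf (Y : Over S) : S.Modules := (coordData Y).toModules

/-- The sections of `coordSheaf Y`. -/
def coordSec (Y : Over S) (U : S.Opens) : Γ(coordSheaf Y, U) ≃ₗ[Γ(S, U)] Coord Y U :=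
  (coordData Y).secEquiv U

lemma coordSec_secRes (Y : Over S) {U V : S.Opens} (h : V ≤ U) (x : Γ(coordSheaf Y, U)) :
    coordSec Y V (secRes (coordSheaf Y) h x) = coordRes Y h (coordSec Y U x) := rfl

lemma localizesOn_coordSheaf (Y : Over S) (U : S.Opens)
    (h1 : IsCompact (X := Y.left) (Y.hom ⁻¹ᵁ U))
    (h2 : IsQuasiSeparated (α := Y.left) (Y.hom ⁻¹ᵁ U)) : LocalizesOn (coordSheaf Y) U := fun f =>
  ⟨(coordRes_isAwayMap Y f h1 h2).torsion, (coordRes_isAwayMap Y f h1 h2).lift⟩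

lemma pullCoord_coordRes {Y Z : Over S} (k : Y ⟶ Z) {U V : S.Opens} (h : V ≤ U) (x : Coord Z U) :
    pullCoord k V (coordRes Z h x) = coordRes Y h (pullCoord k U x) := by
  change (Z.left.presheaf.map _ ≫ k.left.appLE _ _ _).hom x =
    (k.left.appLE _ _ _ ≫ Y.left.presheaf.map _).hom x
  rw [Scheme.Hom.map_appLE, Scheme.Hom.appLE_map]

lemma coordRes_mul (Y : Over S) {U V : S.Opens} (h : V ≤ U) (x y : Coord Y U) :
    coordRes Y h (x * y) = coordRes Y h x * coordRes Y h y :=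
  map_mul (Y.left.presheaf.map (homOfLE (Y.hom.preimage_mono h)).op).hom _ _

lemma coordRes_productMap {Y Z Y' : Over S} (p : Y' ⟶ Y) (q : Y' ⟶ Z) {U V : S.Opens} (h : V ≤ U)
    (z : Coord Y U ⊗[Γ(S, U)] Coord Z U) :
    Algebra.TensorProduct.productMap (pullCoord p V) (pullCoord q V)
      (TensorProduct.map (coordRes Y h) (coordRes Z h) z) =
    coordRes Y' h (Algebra.TensorProduct.productMap (pullCoord p U) (pullCoord q U) z) := by
  induction z with
  | zero => simp
  | add x y hx hy => simp only [map_add, hx, hy]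
  | tmul a b =>
    rw [TensorProduct.map_tmul, Algebra.TensorProduct.productMap_apply_tmul,
      Algebra.TensorProduct.productMap_apply_tmul, coordRes_mul, pullCoord_coordRes,
      pullCoord_coordRes]

section Action

variable {G X : Over S} [GrpObj G] [ModObj G X]

lemma lift_one_act {Y : Over S} (x : Y ⟶ X) : lift (1 : Y ⟶ G) x ≫ act G X = x := by
  have h := ModObj.one_smul (M := G) X
  have h1 : (η[G] ▷ X ≫ act G X : 𝟙_ (Over S) ⊗ X ⟶ X) = snd _ _ := h.trans (leftUnitor_hom X)
  have h2 : lift (1 : Y ⟶ G) x = lift (toUnit Y) x ≫ η[G] ▷ X := by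
    rw [lift_whiskerRight, Hom.one_def]
  rw [h2, Category.assoc, h1, lift_snd]

lemma lift_mul_act {Y : Over S} (g h : Y ⟶ G) (x : Y ⟶ X) :
    lift (g * h) x ≫ act G X = lift g (lift h x ≫ act G X) ≫ act G X := by
  have e := ModObj.mul_smul (M := G) X
  have h1 : (μ[G] ▷ X ≫ act G X : (G ⊗ G) ⊗ X ⟶ X) = (α_ G G X).hom ≫ G ◁ act G X ≫ act G X := e
  have h2 : lift (g * h) x = lift (lift g h) x ≫ μ[G] ▷ X := by
    rw [lift_whiskerRight, Hom.mul_def]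
  rw [h2, Category.assoc, h1, lift_lift_associator_hom_assoc, lift_whiskerLeft_assoc]

variable [IsAffineHom G.hom] [Flat G.hom]

section Coact

variable (U : S.affineOpens) (h1 : IsCompact (X := X.left) (X.hom ⁻¹ᵁ U.1))
  (h2 : IsQuasiSeparated (α := X.left) (X.hom ⁻¹ᵁ U.1))

/-- Functions on `G × X` over an affine open of `S`. -/
def prodEquiv (G X : Over S) [IsAffineHom G.hom] [Flat G.hom] (U : S.affineOpens)
    (h1 : IsCompact (X := X.left) (X.hom ⁻¹ᵁ U.1))
    (h2 : IsQuasiSeparated (α := X.left) (X.hom ⁻¹ᵁ U.1)) :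
    Coord G U.1 ⊗[Γ(S, U.1)] Coord X U.1 ≃ₐ[Γ(S, U.1)] Coord (G ⊗ X) U.1 :=
  AlgEquiv.ofBijective _ (productMap_flat_bijective G X U h1 h2)

variable (G X) in
/-- The coaction of `𝒪_S[G]` on the functions on `X`. -/
def funCoact : Coord X U.1 →ₗ[Γ(S, U.1)] Coord G U.1 ⊗[Γ(S, U.1)] Coord X U.1 :=
  (prodEquiv G X U h1 h2).symm.toLinearMap ∘ₗ (pullCoord (act G X) U.1).toLinearMap

lemma prodEquiv_funCoact (f : Coord X U.1) :
    Algebra.TensorProduct.productMap (pullCoord (fst G X) U.1) (pullCoord (snd G X) U.1)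
      (funCoact G X U h1 h2 f) = pullCoord (act G X) U.1 f :=
  (prodEquiv G X U h1 h2).apply_symm_apply _

/-- The value of the coaction at a point of `G × X`. -/
lemma productMap_funCoact_open {Y : Over S} (g : Y ⟶ G) (x : Y ⟶ X) {V : Y.left.Opens}
    (hV : V ≤ Y.hom ⁻¹ᵁ U.1) (f : Coord X U.1) :
    Algebra.TensorProduct.productMap (pull g U.1 le_rfl hV (hV.trans (preimage_le _ _)))
      (pull x U.1 le_rfl hV (hV.trans (preimage_le _ _))) (funCoact G X U h1 h2 f) =
      pull (lift g x ≫ act G X) U.1 le_rfl hV (hV.trans (preimage_le _ _)) f := by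
  rw [← pull_pull (lift g x) (act G X) le_rfl le_rfl (preimage_le _ _) hV
    (hV.trans (preimage_le _ _))]
  have := prodEquiv_funCoact (G := G) U h1 h2 f
  unfold pullCoord at this
  rw [← this]
  exact (pull_productMap g x le_rfl le_rfl le_rfl _ _ hV _ _ _ _).symm

lemma productMap_funCoact {Y : Over S} (g : Y ⟶ G) (x : Y ⟶ X) (f : Coord X U.1) :
    Algebra.TensorProduct.productMap (pullCoord g U.1) (pullCoord x U.1)
      (funCoact G X U h1 h2 f) = pullCoord (lift g x ≫ act G X) U.1 f := by
  rw [← pullCoord_pullCoord, ← prodEquiv_funCoact U h1 h2]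
  exact (pull_productMap g x le_rfl le_rfl le_rfl _ _ le_rfl _ _ _ _).symm

lemma counit_funCoact (f : Coord X U.1) :
    TensorProduct.lid Γ(S, U.1) (Coord X U.1)
      ((counit G U.1).toLinearMap.rTensor (Coord X U.1) (funCoact G X U h1 h2 f)) = f := by
  have k (z : Coord G U.1 ⊗[Γ(S, U.1)] Coord X U.1) : TensorProduct.lid Γ(S, U.1) (Coord X U.1)
      ((counit G U.1).toLinearMap.rTensor (Coord X U.1) z) =
      Algebra.TensorProduct.productMap (pullCoord (1 : X ⟶ G) U.1) (pullCoord (𝟙 X) U.1) z := by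
    induction z with
    | zero => simp
    | add x y hx hy => simp only [map_add, hx, hy]
    | tmul a b =>
      rw [LinearMap.rTensor_tmul, TensorProduct.lid_tmul,
        Algebra.TensorProduct.productMap_apply_tmul, pullCoord_id, pull_one, Algebra.smul_def]
      rfl
  rw [k, productMap_funCoact, lift_one_act, pullCoord_id]

/-- Both sides are compared as functions on G × (G × X), into which the triple tensor product
embeds; there both are f evaluated at (gh)x = g(hx). -/
lemma coassoc_funCoact (h3 : IsCompact (X := (G ⊗ X).left) ((G ⊗ X).hom ⁻¹ᵁ U.1))
    (h4 : IsQuasiSeparated (α := (G ⊗ X).left) ((G ⊗ X).hom ⁻¹ᵁ U.1)) :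
    Coassoc (comul G U) (funCoact G X U h1 h2) := by
  intro f
  let Φ := (prodEquiv G (G ⊗ X) U h3 h4).toLinearMap ∘ₗ
    (prodEquiv G X U h1 h2).toLinearMap.lTensor (Coord G U.1)
  have hΦ : Function.Injective Φ := (prodEquiv G (G ⊗ X) U h3 h4).injective.comp
    (LinearEquiv.lTensor (Coord G U.1) (prodEquiv G X U h1 h2).toLinearEquiv).injective
  have hΦt (a b : Coord G U.1) (c : Coord X U.1) : Φ (a ⊗ₜ (b ⊗ₜ c)) =
      pullCoord (fst G (G ⊗ X)) U.1 a * (pullCoord (snd G (G ⊗ X) ≫ fst G X) U.1 b *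
        pullCoord (snd G (G ⊗ X) ≫ snd G X) U.1 c) := by
    have e1 : prodEquiv G X U h1 h2 (b ⊗ₜ c) = pullCoord (fst G X) U.1 b * pullCoord (snd G X) U.1 c :=
      Algebra.TensorProduct.productMap_apply_tmul _ _ _ _
    have e2 : Φ (a ⊗ₜ (b ⊗ₜ c)) = pullCoord (fst G (G ⊗ X)) U.1 a *
        pullCoord (snd G (G ⊗ X)) U.1 (prodEquiv G X U h1 h2 (b ⊗ₜ c)) :=
      Algebra.TensorProduct.productMap_apply_tmul _ _ _ _
    rw [e2, e1, map_mul, pullCoord_pullCoord, pullCoord_pullCoord]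
  apply hΦ
  have k1 (z : Coord G U.1 ⊗[Γ(S, U.1)] Coord X U.1) :
      Φ ((funCoact G X U h1 h2).lTensor (Coord G U.1) z) =
      Algebra.TensorProduct.productMap (pullCoord (fst G (G ⊗ X)) U.1)
        (pullCoord (snd G (G ⊗ X) ≫ act G X) U.1) z := by
    induction z with
    | zero => simp
    | add x y hx hy => simp only [map_add, hx, hy]
    | tmul a b =>
      have e1 : prodEquiv G X U h1 h2 (funCoact G X U h1 h2 b) = pullCoord (act G X) U.1 b :=
        prodEquiv_funCoact U h1 h2 b
      have e2 : Φ (a ⊗ₜ funCoact G X U h1 h2 b) = pullCoord (fst G (G ⊗ X)) U.1 a *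
          pullCoord (snd G (G ⊗ X)) U.1 (prodEquiv G X U h1 h2 (funCoact G X U h1 h2 b)) :=
        Algebra.TensorProduct.productMap_apply_tmul _ _ _ _
      rw [LinearMap.lTensor_tmul, e2, e1, pullCoord_pullCoord,
        Algebra.TensorProduct.productMap_apply_tmul]
  have k2 (z : Coord G U.1 ⊗[Γ(S, U.1)] Coord X U.1) :
      Φ (TensorProduct.assoc Γ(S, U.1) (Coord G U.1) (Coord G U.1) (Coord X U.1)
        ((comul G U).toLinearMap.rTensor (Coord X U.1) z)) =
      Algebra.TensorProduct.productMap
        (pullCoord (fst G (G ⊗ X) * (snd G (G ⊗ X) ≫ fst G X)) U.1)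
        (pullCoord (snd G (G ⊗ X) ≫ snd G X) U.1) z := by
    induction z with
    | zero => simp
    | add x y hx hy => simp only [map_add, hx, hy]
    | tmul a b =>
      rw [LinearMap.rTensor_tmul, AlgHom.toLinearMap_apply,
        Algebra.TensorProduct.productMap_apply_tmul, ← productMap_comul]
      generalize comul G U a = w
      induction w with
      | zero => simp
      | add x y hx hy => simp only [map_add, TensorProduct.add_tmul, add_mul, hx, hy]
      | tmul c d =>
        rw [TensorProduct.assoc_tmul, hΦt, Algebra.TensorProduct.productMap_apply_tmul, mul_assoc]
  rw [k1, k2, productMap_funCoact, productMap_funCoact, lift_mul_act]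
  congr 2
  congr 1
  ext
  · simp
  · simp only [lift_snd]
    congr 1
    ext
    simp

end Coact

end Action

lemma isCompact_preimage (X : Over S) [IsNoetherian X.left] (U : S.Opens) :
    IsCompact (X := X.left) (X.hom ⁻¹ᵁ U) :=
  NoetherianSpace.isCompact _

lemma isQuasiSeparated_preimage (X : Over S) [IsAffine X.left] (U : S.Opens) :
    IsQuasiSeparated (α := X.left) (X.hom ⁻¹ᵁ U) :=
  IsQuasiSeparated.of_quasiSeparatedSpace _

instance isAffineHom_snd (G X : Over S) [IsAffineHom G.hom] : IsAffineHom (snd G X).left :=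
  isAffineHom_isStableUnderBaseChange.of_isPullback (IsPullback.of_hasPullback G.hom X.hom)
    inferInstance

lemma isCompact_tensor (G X : Over S) [IsAffineHom G.hom] [IsNoetherian X.left] (U : S.Opens) :
    IsCompact (X := (G ⊗ X).left) ((G ⊗ X).hom ⁻¹ᵁ U) := by
  have : (G ⊗ X).hom ⁻¹ᵁ U = (snd G X).left ⁻¹ᵁ (X.hom ⁻¹ᵁ U) :=
    le_antisymm (preimage_le _ _) (le_of_over (snd G X) le_rfl le_rfl)
  rw [this]
  exact QuasiCompact.isCompact_preimage _ (X.hom ⁻¹ᵁ U).2 (isCompact_preimage X U)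

lemma isQuasiSeparated_tensor (G X : Over S) [IsAffineHom G.hom] [IsAffine X.left] (U : S.Opens) :
    IsQuasiSeparated (α := (G ⊗ X).left) ((G ⊗ X).hom ⁻¹ᵁ U) := by
  have : IsAffine (G ⊗ X).left := isAffine_of_isAffineHom (snd G X).left
  exact IsQuasiSeparated.of_quasiSeparatedSpace _

/-! ### The equivariant module of functions on `X` -/

section FunModule

variable (G X : Over S) [GrpObj G] [ModObj G X] [IsAffineHom G.hom] [Flat G.hom]
  [IsAffine X.left] [IsNoetherian X.left]

/-- The coaction on functions on a noetherian affine scheme. -/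
abbrev funCoact' (U : S.affineOpens) :
    Coord X U.1 →ₗ[Γ(S, U.1)] Coord G U.1 ⊗[Γ(S, U.1)] Coord X U.1 :=
  funCoact G X U (isCompact_preimage X U.1) (isQuasiSeparated_preimage X U.1)

lemma funCoact_res {U V : S.affineOpens} (h : V.1 ≤ U.1) (x : Coord X U.1) :
    funCoact' G X V (coordRes X h x) =
      TensorProduct.map (coordRes G h) (coordRes X h) (funCoact' G X U x) := by
  apply (prodEquiv G X V (isCompact_preimage X V.1) (isQuasiSeparated_preimage X V.1)).injective
  refine (prodEquiv_funCoact V _ _ _).trans ?_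
  refine Eq.trans ?_ (coordRes_productMap (fst G X) (snd G X) h _).symm
  rw [prodEquiv_funCoact, pullCoord_coordRes]

/-- The functions on `X` as an equivariant module. -/
def funModule : EquivModule G where
  sheaf := coordSheaf X
  isQuasicoherent := isQuasicoherent_of_localizesOn _ fun U =>
    localizesOn_coordSheaf X U.1 (isCompact_preimage X U.1) (isQuasiSeparated_preimage X U.1)
  coact U := funCoact' G X U
  coact_res _ _ h x := funCoact_res G X h x
  counit_coact U x := counit_funCoact U _ _ x
  coassoc U x := coassoc_funCoact U _ _ (isCompact_tensor G X U.1) (isQuasiSeparated_tensor G X U.1) x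

end FunModule

/-! ### Reynolds operators on equivariant modules -/

section Reynolds

variable {G C : Over S} [GrpObj G] [IsAffineHom G.hom] (i : C ⟶ G)

namespace EquivModule

/-- The Reynolds operator of a subgroup. -/
abbrev rey (ρ : ∀ U : S.affineOpens, Coord C U.1 →ₗ[Γ(S, U.1)] Γ(S, U.1)) (E : EquivModule G)
    (U : S.affineOpens) : Γ(E.sheaf, U.1) →ₗ[Γ(S, U.1)] Γ(E.sheaf, U.1) :=
  reynolds (ρ U) (E.coactVia i U)

lemma rey_hom {ρ : ∀ U : S.affineOpens, Coord C U.1 →ₗ[Γ(S, U.1)] Γ(S, U.1)} {E F : EquivModule G} {φ : E.sheaf ⟶ F.sheaf} (hφ : IsEquivariantHom E F φ)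
    (U : S.affineOpens) (x : Γ(E.sheaf, U.1)) :
    F.rey i ρ U (homSec φ U.1 x) = homSec φ U.1 (E.rey i ρ U x) := by
  refine reynolds_comm (homSec φ U.1) (fun m => ?_) x
  change (pullCoord i U.1).toLinearMap.rTensor _ (F.coact U _) = _
  rw [hφ U m]
  change ((pullCoord i U.1).toLinearMap.rTensor _ ∘ₗ (homSec φ U.1).lTensor _) (E.coact U m) =
    ((homSec φ U.1).lTensor _ ∘ₗ (pullCoord i U.1).toLinearMap.rTensor _) (E.coact U m)
  rw [LinearMap.rTensor_comp_lTensor, LinearMap.lTensor_comp_rTensor]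

end EquivModule

variable [GrpObj C] [IsAffineHom C.hom]

/-- A family of invariant retractions `𝒪_S[C] → 𝒪_S`, as in the definition of linear
reductivity. -/
structure IsRetraction (ρ : ∀ U : S.affineOpens, Coord C U.1 →ₗ[Γ(S, U.1)] Γ(S, U.1)) : Prop where
  res (U V : S.affineOpens) (h : V.1 ≤ U.1) (a : Coord C U.1) :
    ρ V (coordRes C h a) = fres h (ρ U a)
  one (U : S.affineOpens) : ρ U 1 = 1
  inv (U : S.affineOpens) : LeftInv (comul C U) (ρ U)

lemma IsLinearlyReductive.exists_retraction (hC : IsLinearlyReductive C) :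
    ∃ ρ : ∀ U : S.affineOpens, Coord C U.1 →ₗ[Γ(S, U.1)] Γ(S, U.1), IsRetraction ρ := by
  obtain ⟨ρ, h1, h2, h3⟩ := hC
  refine ⟨ρ, h1, fun U => ?_, h3⟩
  have := h2 U 1
  rwa [map_one] at this

variable {ρ : ∀ U : S.affineOpens, Coord C U.1 →ₗ[Γ(S, U.1)] Γ(S, U.1)}

lemma IsRetraction.rightInv (hρ : IsRetraction ρ) (U : S.affineOpens) :
    RightInv (comul C U) (ρ U) :=
  rightInv_of_leftInv (antipode_antipode U) (comul_antipode U) (hρ.inv U) (hρ.one U)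

namespace EquivModule

lemma rey_res (hρ : IsRetraction ρ) (E : EquivModule G) {U V : S.affineOpens} (h : V.1 ≤ U.1)
    (x : Γ(E.sheaf, U.1)) : E.rey i ρ V (secRes E.sheaf h x) = secRes E.sheaf h (E.rey i ρ U x) := by
  change contr (ρ V) _ ((pullCoord i V.1).toLinearMap.rTensor _ (E.coact V _)) =
    secRes E.sheaf h (contr (ρ U) _ ((pullCoord i U.1).toLinearMap.rTensor _ (E.coact U x)))
  rw [E.coact_res U V h]
  generalize E.coact U x = z
  induction z with
  | zero => simp
  | add x y hx hy => simp only [map_add, hx, hy]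
  | tmul a m =>
    rw [TensorProduct.map_tmul, LinearMap.rTensor_tmul, LinearMap.rTensor_tmul, contr_tmul,
      contr_tmul, secRes_smul, AlgHom.toLinearMap_apply, pullCoord_coordRes, hρ.res]
    rfl

lemma coassoc_coactVia [IsMonHom i] (E : EquivModule G) (U : S.affineOpens) :
    Coassoc (comul C U) (E.coactVia i U) :=
  coassoc_via (comul_pullCoord U i) (E.coassoc U)

lemma rey_rey [IsMonHom i] (hρ : IsRetraction ρ) (E : EquivModule G) (U : S.affineOpens)
    (x : Γ(E.sheaf, U.1)) : E.rey i ρ U (E.rey i ρ U x) = E.rey i ρ U x :=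
  reynolds_idem (hρ.rightInv U) (E.coassoc_coactVia i U) (hρ.one U) x

/-- The Reynolds operator commutes with restriction, so its kernel is saturated because sections
that vanish on D(f) are f-power torsion. -/
lemma isQCSub_ker_rey (hρ : IsRetraction ρ) (E : EquivModule G) :
    IsQCSub E.sheaf ⊤ fun U => LinearMap.ker (E.rey i ρ U) where
  res {U V} _ h x hx := by
    rw [LinearMap.mem_ker] at hx ⊢
    rw [rey_res i hρ, hx, map_zero]
  sat {U} _ f x hx := by
    rw [LinearMap.mem_ker] at hx
    have h := rey_res i hρ E (V := basicAff f) (S.basicOpen_le f) x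
    obtain ⟨n, hn⟩ := (E.localizesOn U f).torsion (E.rey i ρ U x) (h.symm.trans hx)
    exact ⟨n, by rw [LinearMap.mem_ker, map_smul, hn]⟩

/-- The complement of the fixed sections of a normal subgroup in an equivariant vector bundle. -/
lemma exists_ker_rey [IsLocallyNoetherian S] [Flat G.hom] [IsMonHom.Normal i] (hρ : IsRetraction ρ)
    {E : EquivModule G} (hE : E.IsVectorBundle) :
    ∃ (F : EquivModule G) (j : F.sheaf ⟶ E.sheaf), F.IsVectorBundle ∧ IsEquivariantHom F E j ∧
      (∀ U, F.rey i ρ U = 0) ∧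
      ∀ U : S.affineOpens, LinearMap.range (homSec j U.1) = LinearMap.ker (E.rey i ρ U) := by
  obtain ⟨F, j, hj, hinj, hr⟩ := E.exists_sub (E.isQCSub_ker_rey i hρ) fun U x hx => by
    rw [LinearMap.mem_ker] at hx
    have h1 := coact_reynolds_normal U i (E.coassoc U) (hρ.inv U) (hρ.one U) x
    change E.coact U (E.rey i ρ U x) = (E.rey i ρ U).lTensor _ (E.coact U x) at h1
    rw [hx, map_zero] at h1
    -- 1 - Q projects onto the kernel of Q. For Qx = 0 normality gives (1 ⊗ Q)(δ x) = δ(Qx) = 0, so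
    -- applying 1 ⊗ (1 - Q) leaves δ x unchanged and shows that its coefficients are in the kernel.
    let q : Γ(E.sheaf, U.1) →ₗ[Γ(S, U.1)] LinearMap.ker (E.rey i ρ U) :=
      LinearMap.codRestrict _ (LinearMap.id - E.rey i ρ U) fun y => by
        rw [LinearMap.mem_ker, LinearMap.sub_apply, LinearMap.id_apply, map_sub, rey_rey i hρ,
          sub_self]
    refine ⟨q.lTensor _ (E.coact U x), ?_⟩
    rw [← LinearMap.comp_apply, ← LinearMap.lTensor_comp]
    have : (LinearMap.ker (E.rey i ρ U)).subtype ∘ₗ q = LinearMap.id - E.rey i ρ U := rfl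
    rw [this, LinearMap.lTensor_sub, LinearMap.sub_apply, ← h1, LinearMap.lTensor_id, sub_zero]
    rfl
  -- The same projection splits the inclusion, so the kernel is a direct summand and inherits
  -- finiteness and projectivity.
  have hproj (U : S.affineOpens) : ∃ q : Γ(E.sheaf, U.1) →ₗ[Γ(S, U.1)] Γ(F.sheaf, U.1),
      q ∘ₗ homSec j U.1 = LinearMap.id := by
    let e := LinearEquiv.ofInjective (homSec j U.1) (hinj U)
    let q : Γ(E.sheaf, U.1) →ₗ[Γ(S, U.1)] LinearMap.range (homSec j U.1) :=
      LinearMap.codRestrict _ (LinearMap.id - E.rey i ρ U) fun y => by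
        rw [hr, LinearMap.mem_ker, LinearMap.sub_apply, LinearMap.id_apply, map_sub, rey_rey i hρ,
          sub_self]
    refine ⟨e.symm.toLinearMap ∘ₗ q, LinearMap.ext fun x => ?_⟩
    apply e.injective
    apply Subtype.ext
    rw [LinearMap.comp_apply, LinearMap.comp_apply, LinearEquiv.coe_coe, e.apply_symm_apply]
    have hx : homSec j U.1 x ∈ LinearMap.ker (E.rey i ρ U) := by rw [← hr]; exact ⟨x, rfl⟩
    rw [LinearMap.mem_ker] at hx
    change homSec j U.1 x - E.rey i ρ U (homSec j U.1 x) = homSec j U.1 x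
    rw [hx, sub_zero]
  refine ⟨F, j, isVectorBundle_of_projective (fun U => ?_) (fun U => ?_), hj, fun U => ?_, hr⟩
  · obtain ⟨q, hq⟩ := hproj U
    have := hE.finite U
    exact Module.Finite.of_surjective q fun x => ⟨homSec j U.1 x, LinearMap.congr_fun hq x⟩
  · obtain ⟨q, hq⟩ := hproj U
    have := hE.projective U
    exact Module.Projective.of_split (homSec j U.1) q hq
  · ext x
    apply hinj U
    have hx : homSec j U.1 x ∈ LinearMap.ker (E.rey i ρ U) := by rw [← hr]; exact ⟨x, rfl⟩
    rw [LinearMap.mem_ker, rey_hom i hj] at hx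
    rw [hx, LinearMap.zero_apply, map_zero]

/-- By the resolution property, the images of finitely many sections under the complementary
projection of the Reynolds operator come, locally, from an equivariant vector bundle without fixed
sections. -/
theorem exists_bundle_over [IsNoetherian S] [Flat G.hom] [IsMonHom.Normal i] (hρ : IsRetraction ρ)
    (hG : HasResolutionProperty G) (M : EquivModule G) {J : Type u} [Finite J]
    (V : J → S.affineOpens) (m : ∀ j, Γ(M.sheaf, (V j).1)) :
    ∃ (E : EquivModule G) (h : E.sheaf ⟶ M.sheaf), E.IsVectorBundle ∧ IsEquivariantHom E M h ∧
      (∀ U, E.rey i ρ U = 0) ∧ ∀ j, ∀ p ∈ (V j).1, ∃ (W : S.affineOpens) (hW : W.1 ≤ (V j).1),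
        p ∈ W.1 ∧ ∃ e : Γ(E.sheaf, W.1),
          homSec h W.1 e = secRes M.sheaf hW (m j - M.rey i ρ (V j) (m j)) := by
  -- The chain E ⊆ E₀ ↠ F ⊆ M: a coherent equivariant F containing the sections, a bundle E₀ onto
  -- it, and the kernel E of the Reynolds operator on E₀.
  obtain ⟨F, a, hF, ha, hm⟩ := M.exists_coherent_sub V m
  obtain ⟨E₀, b, hE₀, hb, hb'⟩ := hG F hF
  obtain ⟨E, c, hE, hc, hc0, hcr⟩ := exists_ker_rey i hρ hE₀
  refine ⟨E, c ≫ b ≫ a, hE, fun U x => ?_, hc0, fun j p hp => ?_⟩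
  · change M.coact U (homSec a U.1 (homSec b U.1 (homSec c U.1 x))) = _
    rw [ha U, hb' U, hc U, ← LinearMap.comp_apply (LinearMap.lTensor _ (homSec b U.1)),
      ← LinearMap.lTensor_comp, ← LinearMap.comp_apply (LinearMap.lTensor _ (homSec a U.1)),
      ← LinearMap.lTensor_comp]
    rfl
  · obtain ⟨y, hy⟩ := hm j
    obtain ⟨W', hW', hpW', x, hx⟩ := exists_local_preimage b y p hp
    obtain ⟨W, hpW, hW⟩ := exists_affine_mem hpW'
    set x' := secRes E₀.sheaf hW x
    have hx' : homSec b W.1 x' = secRes F.sheaf (hW.trans hW') y := by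
      rw [homSec_secRes, hx, secRes_secRes]
    -- If x' lifts m_j, then x' - Qx' lies in E and by naturality of Q maps to m_j - Q m_j.
    have : x' - E₀.rey i ρ W x' ∈ LinearMap.range (homSec c W.1) := by
      rw [hcr, LinearMap.mem_ker, map_sub, rey_rey i hρ, sub_self]
    obtain ⟨e, he⟩ := this
    refine ⟨W, hW.trans hW', hpW, e, ?_⟩
    change homSec a W.1 (homSec b W.1 (homSec c W.1 e)) = _
    rw [he, map_sub, map_sub, ← rey_hom i hb', ← rey_hom i ha, hx', homSec_secRes, hy, map_sub,
      rey_res i hρ]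

end EquivModule

end Reynolds

/-! ### Fixed points and the Reynolds operator on functions -/

lemma exists_finite_affine_cover {V : S.Opens} (hc : IsCompact (V : Set S)) :
    ∃ (n : ℕ) (A : Fin n → S.affineOpens), (∀ k, (A k).1 ≤ V) ∧ ∀ p ∈ V, ∃ k, p ∈ (A k).1 := by
  choose A hA hAV using fun p : V => exists_affine_mem p.2
  obtain ⟨t, ht⟩ := hc.elim_finite_subcover (fun p : V => ((A p).1 : Set S))
    (fun p => (A p).1.2) (fun p hp => Set.mem_iUnion.2 ⟨⟨p, hp⟩, hA ⟨p, hp⟩⟩)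
  refine ⟨t.card, fun k => A (t.equivFin.symm k), fun k => hAV _, fun p hp => ?_⟩
  obtain ⟨q, hq, hpq⟩ := Set.mem_iUnion₂.1 (ht hp)
  exact ⟨t.equivFin ⟨q, hq⟩, by simpa using hpq⟩

lemma pull_res {Y Z : Over S} (k : Y ⟶ Z) {U : S.Opens} {W W' : Z.left.Opens} {V V' : Y.left.Opens}
    (hW : W ≤ Z.hom ⁻¹ᵁ U) (hV : V ≤ Y.hom ⁻¹ᵁ U) (hVW : V ≤ k.left ⁻¹ᵁ W)
    (h : W' ≤ W) (h' : V' ≤ V) (hVW' : V' ≤ k.left ⁻¹ᵁ W') (x : Sec Z U W hW) :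
    (k.left.appLE W' V' hVW').hom (fres h x) = fres h' (pull k U hW hV hVW x) := by
  change (Z.left.presheaf.map _ ≫ k.left.appLE _ _ _).hom x =
    (k.left.appLE _ _ _ ≫ Y.left.presheaf.map _).hom x
  rw [Scheme.Hom.map_appLE, Scheme.Hom.appLE_map]

section Fixed

variable {G C X : Over S} [GrpObj G] (i : C ⟶ G) [ModObj G X]

lemma tensorHom_act {Y : Over S} (t : Y ⟶ X) :
    (i ⊗ₘ t) ≫ act G X = lift (fst C Y ≫ i) (snd C Y ≫ t) ≫ act G X := by
  congr 1

variable [IsAffineHom G.hom] [Flat G.hom] [IsAffine X.left] [IsNoetherian X.left]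

/-- The coaction of a subgroup on functions. -/
abbrev funCoactVia (U : S.affineOpens) :
    Coord X U.1 →ₗ[Γ(S, U.1)] Coord C U.1 ⊗[Γ(S, U.1)] Coord X U.1 :=
  (pullCoord i U.1).toLinearMap.rTensor (Coord X U.1) ∘ₗ funCoact' G X U

lemma productMap_funCoactVia (U : S.affineOpens) {Y : Over S} (c : Y ⟶ C) (x : Y ⟶ X)
    {V : Y.left.Opens} (hV : V ≤ Y.hom ⁻¹ᵁ U.1) (f : Coord X U.1) :
    Algebra.TensorProduct.productMap (pull c U.1 le_rfl hV (hV.trans (preimage_le _ _)))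
      (pull x U.1 le_rfl hV (hV.trans (preimage_le _ _))) (funCoactVia i U f) =
      pull (lift (c ≫ i) x ≫ act G X) U.1 le_rfl hV (hV.trans (preimage_le _ _)) f := by
  refine Eq.trans ?_ (productMap_funCoact_open U (isCompact_preimage X U.1)
    (isQuasiSeparated_preimage X U.1) (c ≫ i) x hV f)
  rw [LinearMap.comp_apply]
  generalize funCoact' G X U f = z
  induction z with
  | zero => simp
  | add x y hx hy => simp only [map_add, hx, hy]
  | tmul a b =>
    rw [LinearMap.rTensor_tmul, Algebra.TensorProduct.productMap_apply_tmul,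
      Algebra.TensorProduct.productMap_apply_tmul, AlgHom.toLinearMap_apply, pull_pull]

variable [GrpObj C] [IsAffineHom C.hom] {ρ : ∀ U : S.affineOpens, Coord C U.1 →ₗ[Γ(S, U.1)] Γ(S, U.1)}

/-- Functions pulled back along a fixed point agree with their averages. -/
lemma pull_rey_of_isFixedPoint (hρ : IsRetraction ρ) {Y : Over S} {t : Y ⟶ X}
    (ht : IsFixedPoint (G := G) i t) (U : S.affineOpens) (f : Coord X U.1) :
    pullCoord t U.1 (reynolds (ρ U) (funCoactVia i U) f) = pullCoord t U.1 f := by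
  -- The test scheme is cut into affine opens `W`, over which functions on C × W contain the tensor
  -- product.
  refine fun_ext (S := Y.left)
    (fun W : {W : Y.left.affineOpens // W.1 ≤ Y.hom ⁻¹ᵁ U.1} => W.1.1) (fun W => W.2) ?_ fun W => ?_
  · intro p hp
    obtain ⟨W, hpW, hW⟩ := exists_affine_mem hp
    exact Opens.mem_iSup.2 ⟨⟨W, hW⟩, hpW⟩
  obtain ⟨W, hW⟩ := W
  let T := pull t U.1 le_rfl hW (hW.trans (preimage_le t U.1))
  have hT (g : Coord X U.1) : fres hW (pullCoord t U.1 g) = T g := by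
    change (t.left.appLE _ _ _ ≫ Y.left.presheaf.map _).hom g = (t.left.appLE _ _ _).hom g
    rw [Scheme.Hom.appLE_map]
  refine (hT _).trans (Eq.trans ?_ (hT _).symm)
  have hOU : (snd C Y).left ⁻¹ᵁ W.1 ≤ (C ⊗ Y).hom ⁻¹ᵁ U.1 := le_of_over (snd C Y) hW le_rfl
  have hinj := productMap_affine_injective C Y U hW W.2 hOU
  -- As t is fixed, the function (c, y) ↦ f(c·t(y)) does not depend on c; integrating over c then
  -- compares the average with the value.
  have key : T.toLinearMap.lTensor (Coord C U.1) (funCoactVia i U f) = 1 ⊗ₜ T f := by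
    apply hinj
    have k (z : Coord C U.1 ⊗[Γ(S, U.1)] Coord X U.1) :
        Algebra.TensorProduct.productMap
          (pull (fst C Y) U.1 le_rfl hOU (hOU.trans (preimage_le _ _)))
          (pull (snd C Y) U.1 hW hOU le_rfl) (T.toLinearMap.lTensor (Coord C U.1) z) =
        Algebra.TensorProduct.productMap
          (pull (fst C Y) U.1 le_rfl hOU (hOU.trans (preimage_le _ _)))
          (pull (snd C Y ≫ t) U.1 le_rfl hOU (hOU.trans (preimage_le _ _))) z := by
      induction z with
      | zero => rw [map_zero, map_zero, map_zero]
      | add x y hx hy => simp only [map_add, hx, hy]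
      | tmul a b =>
        rw [LinearMap.lTensor_tmul, Algebra.TensorProduct.productMap_apply_tmul,
          Algebra.TensorProduct.productMap_apply_tmul, AlgHom.toLinearMap_apply, pull_pull]
    rw [k, productMap_funCoactVia, Algebra.TensorProduct.productMap_apply_tmul, map_one, one_mul,
      pull_pull (hkh := hOU.trans (preimage_le _ _))]
    exact pull_congr ((tensorHom_act i t).symm.trans ht) _ _ _ _ _
  have := congrArg (contr (ρ U) _) key
  rw [contr_lTensor, contr_tmul, hρ.one, one_smul] at this
  exact this

/-- A point along which functions agree with their averages is fixed. -/
lemma isFixedPoint_of_pull_rey [IsMonHom i] (hρ : IsRetraction ρ) {Y : Over S} {t : Y ⟶ X}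
    {J : Type*} (U : J → S.affineOpens) (hU : ∀ p : S, ∃ j, p ∈ (U j).1)
    (h : ∀ j (f : Coord X (U j).1),
      pullCoord t (U j).1 (reynolds (ρ (U j)) (funCoactVia i (U j)) f) = pullCoord t (U j).1 f) :
    IsFixedPoint (G := G) i t := by
  have key (j : J) (f : Coord X (U j).1) : pullCoord ((i ⊗ₘ t) ≫ act G X) (U j).1 f =
      pullCoord (snd C Y ≫ t) (U j).1 f := by
    have h0 := productMap_funCoactVia (G := G) i (U j) (fst C Y) (snd C Y ≫ t) le_rfl f
    have h1 : pullCoord ((i ⊗ₘ t) ≫ act G X) (U j).1 f =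
        Algebra.TensorProduct.productMap (pullCoord (fst C Y) (U j).1)
          (pullCoord (snd C Y ≫ t) (U j).1) (funCoactVia i (U j) f) := by
      rw [tensorHom_act]
      exact h0.symm
    -- Along t every function may be replaced by its average. The average of f(c·x) over `C` does
    -- not depend on c, so f(c·t(y)) = (Qf)(t(y)) = f(t(y)).
    have k (z : Coord C (U j).1 ⊗[Γ(S, (U j).1)] Coord X (U j).1) :
        Algebra.TensorProduct.productMap (pullCoord (fst C Y) (U j).1)
          (pullCoord (snd C Y ≫ t) (U j).1) z =
        Algebra.TensorProduct.productMap (pullCoord (fst C Y) (U j).1)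
          (pullCoord (snd C Y ≫ t) (U j).1)
          ((reynolds (ρ (U j)) (funCoactVia i (U j))).lTensor (Coord C (U j).1) z) := by
      induction z with
      | zero => simp
      | add x y hx hy => simp only [map_add, hx, hy]
      | tmul a b =>
        rw [LinearMap.lTensor_tmul, Algebra.TensorProduct.productMap_apply_tmul,
          Algebra.TensorProduct.productMap_apply_tmul, ← pullCoord_pullCoord,
          ← pullCoord_pullCoord, h]
    have hco : Coassoc (comul C (U j)) (funCoactVia (X := X) i (U j)) :=
      (funModule G X).coassoc_coactVia i (U j)
    rw [h1, k, lTensor_reynolds (hρ.inv (U j)) hco, Algebra.TensorProduct.productMap_apply_tmul,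
      map_one, one_mul, ← pullCoord_pullCoord, h, pullCoord_pullCoord]
  -- Since `X` is affine, the two morphisms are equal once they agree on global functions, which is
  -- tested over the preimages of the cover of `S`.
  apply Over.OverMorphism.ext
  apply ext_of_isAffine
  ext F
  refine fun_ext (S := (C ⊗ Y).left) (fun j => (C ⊗ Y).hom ⁻¹ᵁ (U j).1) (fun j => le_top) ?_
    fun j => ?_
  · intro p _
    obtain ⟨j, hj⟩ := hU ((C ⊗ Y).hom p)
    exact Opens.mem_iSup.2 ⟨j, hj⟩
  · have h2 (k : C ⊗ Y ⟶ X) : fres (le_top : (C ⊗ Y).hom ⁻¹ᵁ (U j).1 ≤ ⊤) (k.left.appTop F) =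
        pullCoord k (U j).1 (fres (le_top : X.hom ⁻¹ᵁ (U j).1 ≤ ⊤) F) := by
      change (k.left.appLE ⊤ _ le_top).hom F = (X.left.presheaf.map _ ≫ k.left.appLE _ _ _).hom F
      rw [Scheme.Hom.map_appLE]
    exact (h2 _).trans ((key j _).trans (h2 _).symm)

/-- There is an equivariant vector bundle without fixed sections, with an equivariant morphism to
the functions on `X` whose image cuts out the fixed points. -/
theorem exists_bundle_fixed [IsNoetherian S] [IsMonHom.Normal i] (hρ : IsRetraction ρ)
    (hG : HasResolutionProperty G) :
    ∃ (E : EquivModule G) (h : E.sheaf ⟶ coordSheaf X), E.IsVectorBundle ∧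
      EquivModule.IsEquivariantHom E (funModule G X) h ∧ (∀ U, E.rey i ρ U = 0) ∧
      ∀ (Y : Over S) (t : Y ⟶ X), IsFixedPoint (G := G) i t ↔
        ∀ (U : S.affineOpens) (e : Γ(E.sheaf, U.1)),
          pullCoord t U.1 (coordSec X U.1 (homSec h U.1 e)) = 0 := by
  -- The functions f - Qf, which cut out the fixed locus.
  let D (U : S.affineOpens) : Coord X U.1 →ₗ[Γ(S, U.1)] Coord X U.1 :=
    LinearMap.id - reynolds (ρ U) (funCoactVia (G := G) i U)
  obtain ⟨n, A, -, hA⟩ := exists_finite_affine_cover (S := S) (V := ⊤) isCompact_univ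
  choose l W hWA hW using fun k => exists_finite_affine_cover (isCompact_preimage X (A k).1)
  -- The preimage of `A k` in `X` need not be affine, so it is covered by finitely many affine
  -- opens. On each, noetherianity selects finitely many of the functions f - Qf that generate the
  -- same ideal as all of them.
  have hfg (k : Fin n) (j : Fin (l k)) : ∃ g : Finset Γ(X.left, (W k j).1),
      (g : Set Γ(X.left, (W k j).1)) ⊆ Set.range (fun f => fres (hWA k j) (D (A k) f)) ∧
      Ideal.span (Set.range (fun f => fres (hWA k j) (D (A k) f))) = Ideal.span g := by
    have : IsNoetherianRing Γ(X.left, (W k j).1) :=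
      IsLocallyNoetherian.component_noetherian (W k j)
    exact (Submodule.fg_span_iff_fg_span_finset_subset _).1 (IsNoetherian.noetherian _)
  choose g hgr hgs using hfg
  choose y hy using fun (k : Fin n) (j : Fin (l k)) (x : g k j) => hgr k j x.2
  obtain ⟨E, h, hE, hh, hr, hloc⟩ := EquivModule.exists_bundle_over i hρ hG (funModule G X)
    (J := Σ (k : Fin n) (j : Fin (l k)), g k j) (fun t => A t.1) (fun t => y t.1 t.2.1 t.2.2)
  refine ⟨E, h, hE, hh, hr, fun Y t => ⟨fun ht U e => ?_, fun ht => ?_⟩⟩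
  -- Q vanishes on E, so every function coming from E has average 0; along a fixed point it equals
  -- its average.
  · have h1 := EquivModule.rey_hom i (ρ := ρ) hh U e
    rw [hr, LinearMap.zero_apply, map_zero] at h1
    have h2 := pull_rey_of_isFixedPoint i hρ ht U (coordSec X U.1 (homSec h U.1 e))
    refine h2.symm.trans ?_
    have h3 : reynolds (ρ U) (funCoactVia (G := G) i U) (coordSec X U.1 (homSec h U.1 e)) = 0 := h1
    exact (congrArg (pullCoord t U.1) h3).trans (map_zero _)
  · refine isFixedPoint_of_pull_rey i hρ A (fun p => hA p trivial) fun k f => ?_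
    have hD (f : Coord X (A k).1) (hf : pullCoord t (A k).1 (D (A k) f) = 0) :
        pullCoord t (A k).1 (reynolds (ρ (A k)) (funCoactVia i (A k)) f) =
          pullCoord t (A k).1 f := by
      rw [LinearMap.sub_apply, LinearMap.id_apply, map_sub, sub_eq_zero] at hf
      exact hf.symm
    apply hD
    -- the generators vanish along `t`
    have hgen (j : Fin (l k)) (x : g k j) : pullCoord t (A k).1 (D (A k) (y k j x)) = 0 := by
      choose V hVA hpV e he using hloc ⟨k, j, x⟩
      refine fun_ext (S := Y.left)
        (fun p : {p : Y.left // Y.hom p ∈ (A k).1} => Y.hom ⁻¹ᵁ (V (Y.hom p.1) p.2).1)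
        (fun p => Y.hom.preimage_mono (hVA _ _)) ?_ fun p => ?_
      · intro p hp
        exact Opens.mem_iSup.2 ⟨⟨p, hp⟩, hpV _ _⟩
      · have h1 := ht (V (Y.hom p.1) p.2) (e (Y.hom p.1) p.2)
        have h2 : pullCoord t (V (Y.hom p.1) p.2).1
            (coordRes X (hVA (Y.hom p.1) p.2) (D (A k) (y k j x))) = 0 :=
          (congrArg (fun z => pullCoord t _ (coordSec X _ z)) (he (Y.hom p.1) p.2)).symm.trans h1
        rw [pullCoord_coordRes] at h2
        refine Eq.trans h2 ?_
        exact (map_zero _).symm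
    -- The finitely many generators vanish along t, being locally in the image of E; so does the
    -- ideal they generate, which contains every f - Qf.
    refine fun_ext (S := Y.left) (fun j : Fin (l k) => t.left ⁻¹ᵁ (W k j).1)
      (fun j => le_of_over t (hWA k j) le_rfl) ?_ fun j => ?_
    · intro p hp
      obtain ⟨j, hj⟩ := hW k (t.left p) (preimage_le t _ hp)
      exact Opens.mem_iSup.2 ⟨j, hj⟩
    · let T : Γ(X.left, (W k j).1) →+* Γ(Y.left, t.left ⁻¹ᵁ (W k j).1) :=
        (t.left.appLE _ _ le_rfl).hom
      have hT (d : Coord X (A k).1) : T (fres (hWA k j) d) =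
          fres (le_of_over t (hWA k j) le_rfl) (pullCoord t (A k).1 d) :=
        pull_res t le_rfl le_rfl (preimage_le t _) (hWA k j) _ le_rfl d
      have hker : Ideal.span (g k j : Set _) ≤ RingHom.ker T := by
        rw [Ideal.span_le]
        intro x hx
        have h1 : fres (hWA k j) (D (A k) (y k j ⟨x, hx⟩)) = x := hy k j ⟨x, hx⟩
        have h2 := hT (D (A k) (y k j ⟨x, hx⟩))
        rw [hgen] at h2
        exact (congrArg T h1).symm.trans (h2.trans (map_zero _))
      have hmem : fres (hWA k j) (D (A k) f) ∈ RingHom.ker T := by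
        apply hker
        rw [← hgs]
        exact Ideal.subset_span ⟨f, rfl⟩
      refine (hT _).symm.trans (Eq.trans hmem ?_)
      exact (map_zero _).symm

end Fixed

/-! ### Duals of equivariant vector bundles -/

/-- The sections over an affine open generate those over a smaller affine open. -/
lemma span_range_secRes {M : S.Modules} {U V : S.affineOpens} (hU : LocalizesOn M U.1)
    (hV : LocalizesOn M V.1) (h : V.1 ≤ U.1) :
    Submodule.span Γ(S, V.1) (Set.range (secRes M h)) = ⊤ := by
  rw [eq_top_iff]
  rintro x -
  set N := Submodule.span Γ(S, V.1) (Set.range (secRes M h))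
  -- The ideal of functions that multiply x into the span. Basic opens of `U` contained in `V` cover
  -- `V`, and a power of each defining function lies in I; so its radical, and hence I itself, is
  -- the unit ideal.
  set I : Ideal Γ(S, V.1) := N.comap (LinearMap.toSpanSingleton _ _ x)
  have key (p : S) (hp : p ∈ V.1) : ∃ g : Γ(S, V.1), p ∈ S.basicOpen g ∧ g ∈ I.radical := by
    obtain ⟨g, hpg, hgV⟩ := exists_basicOpen_mem U.2 h hp
    have e : S.basicOpen (fres h g) = S.basicOpen g := by
      rw [Scheme.basicOpen_res]
      exact inf_eq_right.2 hgV
    obtain ⟨n, y, hy⟩ := (hU g).lift (secRes M hgV x)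
    obtain ⟨m, hm⟩ := (hV (fres h g)).torsion (fres h g ^ n • x - secRes M h y) (by
      rw [map_sub, secRes_smul, sub_eq_zero, secRes_secRes]
      have := congrArg (secRes M e.le) hy
      rw [secRes_secRes, secRes_smul, secRes_secRes] at this
      rw [this, map_pow, map_pow, fres_fres, fres_fres])
    refine ⟨fres h g, e ▸ hpg, m + n, ?_⟩
    rw [smul_sub, sub_eq_zero, ← mul_smul, ← pow_add] at hm
    change fres h g ^ (m + n) • x ∈ N
    rw [hm]
    exact N.smul_mem _ (Submodule.subset_span ⟨y, rfl⟩)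
  have hI : Ideal.span (I.radical : Set Γ(S, V.1)) = ⊤ := by
    rw [← V.2.iSup_basicOpen_eq_self_iff]
    refine le_antisymm (iSup_le fun _ => S.basicOpen_le _) fun p hp => ?_
    obtain ⟨g, hpg, hg⟩ := key p hp
    exact Opens.mem_iSup.2 ⟨⟨g, hg⟩, hpg⟩
  rw [Ideal.span_eq, Ideal.radical_eq_top] at hI
  have : (1 : Γ(S, V.1)) ∈ I := hI ▸ Submodule.mem_top
  have h1 : (1 : Γ(S, V.1)) • x ∈ N := this
  rwa [one_smul] at h1

lemma linearMap_ext_secRes {M : S.Modules} {U V : S.affineOpens} (hU : LocalizesOn M U.1)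
    (hV : LocalizesOn M V.1) (h : V.1 ≤ U.1) {P : Type*} [AddCommGroup P] [Module Γ(S, V.1) P]
    {α β : Γ(M, V.1) →ₗ[Γ(S, V.1)] P} (H : ∀ x, α (secRes M h x) = β (secRes M h x)) : α = β :=
  LinearMap.ext_on_range (span_range_secRes hU hV h) H

/-- Sections of the dual over an affine open as linear forms. -/
def formEquiv {E : S.Modules} (hE : E.IsQuasicoherent) (U : S.affineOpens) :
    Γ(dual E, U.1) ≃ₗ[Γ(S, U.1)] Module.Dual Γ(S, U.1) Γ(E, U.1) :=
  dualEquiv hE U.2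

lemma formEquiv_apply {E : S.Modules} (hE : E.IsQuasicoherent) (U : S.affineOpens)
    (φ : Γ(dual E, U.1)) (e : Γ(E, U.1)) : formEquiv hE U φ e = dualEval E φ le_rfl e := rfl

/-- With a dual basis a linear form amounts to its finitely many values on the e_j, so torsion and
lifting reduce to functions, with one exponent serving all j. -/
lemma localizesOn_dual {E : S.Modules} (hE : E.IsQuasicoherent) (U : S.affineOpens)
    [Module.Finite Γ(S, U.1) Γ(E, U.1)] [Module.Projective Γ(S, U.1) Γ(E, U.1)] :
    LocalizesOn (dual E) U.1 := by
  intro f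
  have hL (U : S.affineOpens) : LocalizesOn E U.1 := localizesOn_of_isQuasicoherent E U.2
  obtain ⟨n, e, e', he⟩ := exists_dual_basis (R := Γ(S, U.1)) (M := Γ(E, U.1))
  have hloc := isLocalization_fres U.2 f
  let := (fres (S.basicOpen_le f)).toAlgebra
  constructor
  · intro φ hφ
    have h1 (j : Fin n) : ∃ k : ℕ, f ^ k * dualEval E φ le_rfl (e j) = 0 := by
      have h2 : fres (S.basicOpen_le f) (dualEval E φ le_rfl (e j)) = 0 := by
        rw [← dualEval_res φ le_rfl (S.basicOpen_le f), ← dualEval_secRes φ (S.basicOpen_le f) le_rfl,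
          hφ]
        rfl
      obtain ⟨⟨_, k, rfl⟩, hk⟩ := (IsLocalization.map_eq_zero_iff (.powers f) _ _).1 h2
      exact ⟨k, hk⟩
    choose k hk using h1
    refine ⟨∑ j, k j, (formEquiv hE U).injective ?_⟩
    rw [map_zero]
    ext m
    rw [map_smul, LinearMap.smul_apply, formEquiv_apply, ← he m, map_sum, Finset.smul_sum,
      LinearMap.zero_apply]
    refine Finset.sum_eq_zero fun j _ => ?_
    rw [map_smul, smul_eq_mul, smul_eq_mul, mul_left_comm,
      ← Finset.add_sum_erase _ _ (Finset.mem_univ j), add_comm, pow_add, mul_assoc, hk, mul_zero,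
      mul_zero]
  · intro ψ
    have h1 (j : Fin n) := IsLocalization.Away.surj f
      (dualEval E ψ le_rfl (secRes E (S.basicOpen_le f) (e j)))
    choose k a ha using h1
    let N := ∑ j, k j
    have ha' (j : Fin n) : ∃ b : Γ(S, U.1), fres (S.basicOpen_le f) b =
        fres (S.basicOpen_le f) f ^ N *
          dualEval E ψ le_rfl (secRes E (S.basicOpen_le f) (e j)) := by
      -- The extra power of f brings the numerator with exponent `k j` to the common exponent N.
      refine ⟨f ^ (∑ j ∈ Finset.univ.erase j, k j) * a j, ?_⟩
      have h2 : fres (S.basicOpen_le f) (a j) = dualEval E ψ le_rfl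
        (secRes E (S.basicOpen_le f) (e j)) * fres (S.basicOpen_le f) f ^ k j := (ha j).symm
      have h3 : N = (∑ j ∈ Finset.univ.erase j, k j) + k j :=
        (Finset.sum_erase_add _ _ (Finset.mem_univ j)).symm
      rw [map_mul, h2, map_pow, h3, pow_add]
      ring
    choose b hb using ha'
    refine ⟨N, (formEquiv hE U).symm (∑ j, b j • e' j), ?_⟩
    apply (formEquiv hE (basicAff f)).injective
    refine linearMap_ext_secRes (hL U) (hL (basicAff f)) (S.basicOpen_le f) fun m => ?_
    rw [formEquiv_apply, dualEval_secRes, dualEval_res _ le_rfl, ← formEquiv_apply hE U,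
      LinearEquiv.apply_symm_apply, map_smul, LinearMap.smul_apply, formEquiv_apply]
    conv_rhs => rw [← he m]
    simp only [LinearMap.sum_apply, LinearMap.smul_apply, map_sum, smul_eq_mul, secRes_smul,
      map_smul, map_mul, hb, Finset.mul_sum]
    exact Finset.sum_congr rfl fun j _ => by ring

namespace EquivModule

variable {G : Over S} [GrpObj G] [IsAffineHom G.hom] {E : EquivModule G}

/-- Sections of the dual as linear forms. -/
abbrev dualForm (E : EquivModule G) (U : S.affineOpens) :
    Γ(dual E.sheaf, U.1) ≃ₗ[Γ(S, U.1)] Module.Dual Γ(S, U.1) Γ(E.sheaf, U.1) :=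
  formEquiv E.isQuasicoherent U

lemma dualForm_secRes {U V : S.affineOpens} (h : V.1 ≤ U.1) (φ : Γ(dual E.sheaf, U.1))
    (e : Γ(E.sheaf, U.1)) :
    E.dualForm V (secRes (dual E.sheaf) h φ) (secRes E.sheaf h e) = fres h (E.dualForm U φ e) := by
  rw [formEquiv_apply, dualEval_secRes, dualEval_res _ le_rfl, formEquiv_apply]

lemma ev_map_res (Y : Over S) {U V : S.affineOpens} (h : V.1 ≤ U.1)
    (z : Coord Y U.1 ⊗[Γ(S, U.1)] Γ(dual E.sheaf, U.1)) (e : Γ(E.sheaf, U.1)) :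
    ev (E.dualForm V).toLinearMap (Coord Y V.1)
      (TensorProduct.map (coordRes Y h) (secRes (dual E.sheaf) h) z) (secRes E.sheaf h e) =
    coordRes Y h (ev (E.dualForm U).toLinearMap (Coord Y U.1) z e) := by
  induction z with
  | zero => simp
  | add x y hx hy => simp only [map_add, LinearMap.add_apply, hx, hy]
  | tmul a φ =>
    rw [TensorProduct.map_tmul, ev_tmul, ev_tmul, map_smulₛₗ, LinearEquiv.coe_coe,
      LinearEquiv.coe_coe, dualForm_secRes]

lemma coeff_res {U V : S.affineOpens} (h : V.1 ≤ U.1) (φ : Γ(dual E.sheaf, U.1))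
    (e : Γ(E.sheaf, U.1)) :
    coeff (E.coact V) (E.dualForm V (secRes (dual E.sheaf) h φ)) (secRes E.sheaf h e) =
      coordRes G h (coeff (E.coact U) (E.dualForm U φ) e) := by
  simp only [coeff, LinearMap.comp_apply, E.coact_res U V h]
  generalize E.coact U e = z
  induction z with
  | zero => simp
  | add x y hx hy => simp only [map_add, hx, hy]
  | tmul a m =>
    rw [TensorProduct.map_tmul, LinearMap.lTensor_tmul, LinearMap.lTensor_tmul, LinearEquiv.coe_coe,
      LinearEquiv.coe_coe, TensorProduct.rid_tmul, TensorProduct.rid_tmul, map_smulₛₗ,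
      dualForm_secRes]

section

variable {C : Over S} [GrpObj C] [IsAffineHom C.hom] (i : C ⟶ G)
  {ρ : ∀ U : S.affineOpens, Coord C U.1 →ₗ[Γ(S, U.1)] Γ(S, U.1)}

lemma fixedSections_eq_bot (hρ : IsRetraction ρ) (U : S.affineOpens) (h : E.rey i ρ U = 0) :
    E.fixedSections i U = ⊥ := by
  rw [eq_bot_iff]
  intro x hx
  rw [fixedSections, LinearMap.mem_ker, LinearMap.sub_apply, sub_eq_zero] at hx
  have := reynolds_eq_self (hρ.one U) hx.symm
  rw [Submodule.mem_bot, ← this]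
  exact LinearMap.congr_fun h x

/-- Contracting with ρ commutes with extension of scalars: applied to the equation of a fixed point
it gives Q ⊗ R = 0 on one side and x on the other. -/
lemma fixedLocusIsZero (hρ : IsRetraction ρ) (h : ∀ U, E.rey i ρ U = 0) :
    E.FixedLocusIsZero i := by
  intro U R _ _ x hx
  have h1 := congrArg ((contr (ρ U) Γ(E.sheaf, U.1)).lTensor R) hx
  rw [← LinearMap.comp_apply, ← LinearMap.comp_apply, ← LinearMap.lTensor_comp,
    ← LinearMap.lTensor_comp] at h1
  have h2 : contr (ρ U) Γ(E.sheaf, U.1) ∘ₗ E.coactVia i U = 0 := h U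
  have h3 : contr (ρ U) Γ(E.sheaf, U.1) ∘ₗ TensorProduct.mk Γ(S, U.1) (Coord C U.1) _ 1 =
      LinearMap.id := by
    ext y
    rw [LinearMap.comp_apply, TensorProduct.mk_apply, contr_tmul, hρ.one, one_smul]
    rfl
  rw [h2, h3, LinearMap.lTensor_zero, LinearMap.lTensor_id] at h1
  exact h1.symm

end

variable [IsLocallyNoetherian S] (hE : E.IsVectorBundle)

/-- The dual of an equivariant vector bundle. -/
def dualModule : EquivModule G where
  sheaf := dual E.sheaf
  isQuasicoherent := isQuasicoherent_of_localizesOn _ fun U =>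
    have := hE.finite U
    have := hE.projective U
    localizesOn_dual E.isQuasicoherent U
  coact U :=
    have := hE.finite U
    have := hE.projective U
    dualCoact (E.dualForm U) (antipode G U) (E.coact U)
  coact_res U V h φ := by
    have := hE.finite U
    have := hE.projective U
    have := hE.finite V
    have := hE.projective V
    apply ev_ext (E.dualForm V)
    refine LinearMap.congr_fun (linearMap_ext_secRes (E.localizesOn U) (E.localizesOn V) h
      fun e => ?_)
    rw [ev_dualCoact, ev_map_res, ev_dualCoact, coeff_res, pullCoord_coordRes]
  counit_coact U :=
    have := hE.finite U
    have := hE.projective U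
    counit_dualCoact _ (counit_antipode U) (E.counit_coact U)
  coassoc U :=
    have := hE.finite U
    have := hE.projective U
    coassoc_dualCoact _ (comul_antipode U) (E.coassoc U)

lemma isVectorBundle_dualModule : (dualModule hE).IsVectorBundle := by
  refine isVectorBundle_of_projective (fun U => ?_) fun U => ?_
  · have := hE.finite U
    have := hE.projective U
    exact Module.Finite.equiv (E.dualForm U).symm
  · have := hE.finite U
    have := hE.projective U
    exact Module.Projective.of_equiv (E.dualForm U).symm

section

variable {C : Over S} [GrpObj C] [IsAffineHom C.hom] (i : C ⟶ G) [IsMonHom i]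
  {ρ : ∀ U : S.affineOpens, Coord C U.1 →ₗ[Γ(S, U.1)] Γ(S, U.1)}

/-- The Reynolds operator of the dual is the transpose of that of E, as ρ is invariant under the
antipode of `C` and `i` respects antipodes. -/
lemma rey_dualModule (hρ : IsRetraction ρ) (h : ∀ U, E.rey i ρ U = 0) (U : S.affineOpens) :
    (dualModule hE).rey i ρ U = 0 := by
  have := hE.finite U
  have := hE.projective U
  have hσ (a : Coord G U.1) :
      ρ U (pullCoord i U.1 (antipode G U a)) = ρ U (pullCoord i U.1 a) := by
    rw [antipode_pullCoord]
    exact comp_antipode_eq (antipode_antipode U) (comul_antipode U) (hρ.inv U) (hρ.one U) _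
  ext φ
  apply (E.dualForm U).injective
  ext e
  refine (reynolds_dualCoact (E.dualForm U) (δ := E.coact U) hσ φ e).trans ?_
  have h1 : reynolds (ρ U) ((pullCoord i U.1).toLinearMap.rTensor _ ∘ₗ E.coact U) = 0 := h U
  rw [h1, LinearMap.zero_apply, LinearMap.zero_apply, map_zero]
  exact (LinearMap.congr_fun (map_zero (E.dualForm U)) e).symm

end

end EquivModule

/-! ### Sections of pull-backs -/

section Pullback

variable (X : Over S) {F : S.Modules}

/-- The morphism from a pull-back adjoint to a morphism to a direct image. -/
def pullDesc {N : X.left.Modules} (g : F ⟶ (Scheme.Modules.pushforward X.hom).obj N) :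
    pullbackTo X F ⟶ N :=
  ((Scheme.Modules.pullbackPushforwardAdjunction X.hom).homEquiv F N).symm g

/-- The sections of a direct image. -/
def pushSec (N : X.left.Modules) (U : S.Opens) :
    Γ((Scheme.Modules.pushforward X.hom).obj N, U) ≃+ Γ(N, X.hom ⁻¹ᵁ U) :=
  AddEquiv.refl _

lemma pushSec_secRes (N : X.left.Modules) {U V : S.Opens} (h : V ≤ U)
    (x : Γ((Scheme.Modules.pushforward X.hom).obj N, U)) :
    pushSec X N V (secRes _ h x) = secRes N (X.hom.preimage_mono h) (pushSec X N U x) := rfl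

variable (F) in
/-- The unit of the adjunction between pull-back and direct image. -/
abbrev pullUnit : F ⟶ (Scheme.Modules.pushforward X.hom).obj (pullbackTo X F) :=
  (Scheme.Modules.pullbackPushforwardAdjunction X.hom).unit.app F

lemma pullSec_eq {U : S.Opens} {W : X.left.Opens} (h : W ≤ X.hom ⁻¹ᵁ U) (x : Γ(F, U)) :
    pullSec X F U W h x = secRes (pullbackTo X F) h (pushSec X _ U (homSec (pullUnit X F) U x)) := rfl

lemma homSec_pullDesc {N : X.left.Modules} (g : F ⟶ (Scheme.Modules.pushforward X.hom).obj N)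
    {U : S.Opens} {W : X.left.Opens} (h : W ≤ X.hom ⁻¹ᵁ U) (x : Γ(F, U)) :
    homSec (pullDesc X g) W (pullSec X F U W h x) = secRes N h (pushSec X N U (homSec g U x)) := by
  rw [pullSec_eq, homSec_secRes]
  have h1 : pullUnit X F ≫ (Scheme.Modules.pushforward X.hom).map (pullDesc X g) = g := by
    have := ((Scheme.Modules.pullbackPushforwardAdjunction X.hom).homEquiv F N).apply_symm_apply g
    rwa [Adjunction.homEquiv_unit] at this
  exact congrArg (fun k => secRes N h (pushSec X N U (homSec k U x))) h1

lemma pullback_hom_ext {N : X.left.Modules} {f g : pullbackTo X F ⟶ N}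
    (h : ∀ (U : S.Opens) (x : Γ(F, U)), homSec f _ (pullSec X F U _ le_rfl x) =
      homSec g _ (pullSec X F U _ le_rfl x)) : f = g := by
  apply ((Scheme.Modules.pullbackPushforwardAdjunction X.hom).homEquiv F N).injective
  rw [Adjunction.homEquiv_unit, Adjunction.homEquiv_unit]
  refine Scheme.Modules.hom_ext _ _ fun U => ?_
  ext x
  have := h U x
  rw [pullSec_eq, secRes_rfl] at this
  exact this

lemma secRes_pullSec {U U' : S.Opens} {W W' : X.left.Opens} (h : W ≤ X.hom ⁻¹ᵁ U) (hU : U' ≤ U)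
    (hW : W' ≤ W) (h' : W' ≤ X.hom ⁻¹ᵁ U') (x : Γ(F, U)) :
    secRes (pullbackTo X F) hW (pullSec X F U W h x) = pullSec X F U' W' h' (secRes F hU x) := by
  rw [pullSec_eq, pullSec_eq, secRes_secRes, homSec_secRes, pushSec_secRes, secRes_secRes]

variable (F) in
/-- The sections of a pull-back spanned by the pull-backs of sections over a given open. -/
def pullSpan (U : S.Opens) (W : X.left.Opens) (h : W ≤ X.hom ⁻¹ᵁ U) :
    Submodule Γ(X.left, W) Γ(pullbackTo X F, W) :=
  Submodule.span _ (Set.range (pullSec X F U W h))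

lemma secRes_mem_pullSpan {U U' : S.Opens} {W W' : X.left.Opens} (h : W ≤ X.hom ⁻¹ᵁ U)
    (hU : U' ≤ U) (hW : W' ≤ W) (h' : W' ≤ X.hom ⁻¹ᵁ U') {y : Γ(pullbackTo X F, W)}
    (hy : y ∈ pullSpan X F U W h) : secRes (pullbackTo X F) hW y ∈ pullSpan X F U' W' h' := by
  induction hy using Submodule.span_induction with
  | zero => rw [map_zero]; exact zero_mem _
  | add x y _ _ hx hy => rw [map_add]; exact add_mem hx hy
  | smul a x _ hx => rw [secRes_smul]; exact Submodule.smul_mem _ _ hx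
  | mem x hx =>
    obtain ⟨v, rfl⟩ := hx
    rw [secRes_pullSec X h hU hW h']
    exact Submodule.subset_span ⟨_, rfl⟩

variable (F) in
/-- The subsheaf of a pull-back generated by the pulled back sections. -/
def pullGen : SubSheaf (pullbackTo X F) where
  obj W :=
    { carrier := {y | ∀ p ∈ W, ∃ (U : S.Opens) (W' : X.left.Opens) (hW : W' ≤ W)
        (h : W' ≤ X.hom ⁻¹ᵁ U), p ∈ W' ∧ secRes (pullbackTo X F) hW y ∈ pullSpan X F U W' h}
      zero_mem' := fun p hp => by
        refine ⟨⊤, W, le_rfl, le_top, hp, ?_⟩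
        rw [map_zero]
        exact zero_mem _
      add_mem' := by
        intro y y' hy hy' p hp
        obtain ⟨U, V, hV, h, hpV, hm⟩ := hy p hp
        obtain ⟨U', V', hV', h', hpV', hm'⟩ := hy' p hp
        have hVU : V ⊓ V' ≤ X.hom ⁻¹ᵁ (U ⊓ U') := inf_le_inf h h'
        refine ⟨U ⊓ U', V ⊓ V', inf_le_left.trans hV, hVU, ⟨hpV, hpV'⟩, ?_⟩
        rw [map_add]
        have h1 := secRes_mem_pullSpan X h inf_le_left inf_le_left hVU hm
        have h2 := secRes_mem_pullSpan X h' inf_le_right inf_le_right hVU hm'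
        rw [secRes_secRes] at h1 h2
        exact add_mem h1 h2
      smul_mem' := by
        intro a y hy p hp
        obtain ⟨U, V, hV, h, hpV, hm⟩ := hy p hp
        refine ⟨U, V, hV, h, hpV, ?_⟩
        rw [secRes_smul]
        exact Submodule.smul_mem _ _ hm }
  res {W W'} hW y hy p hp := by
    obtain ⟨U, V, hV, h, hpV, hm⟩ := hy p (hW hp)
    have h' : V ⊓ W' ≤ X.hom ⁻¹ᵁ U := inf_le_left.trans h
    refine ⟨U, V ⊓ W', inf_le_right, h', ⟨hpV, hp⟩, ?_⟩
    have h1 := secRes_mem_pullSpan X h le_rfl inf_le_left h' hm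
    rw [secRes_secRes] at h1 ⊢
    exact h1
  loc {W} y hy p hp := by
    obtain ⟨V, hV, hpV, hm⟩ := hy p hp
    obtain ⟨U, V', hV', h, hpV', hm'⟩ := hm p hpV
    rw [secRes_secRes] at hm'
    exact ⟨U, V', hV'.trans hV, h, hpV', hm'⟩

/-- Sections of a pull-back are locally combinations of pulled back sections. -/
lemma exists_mem_pullSpan {U : S.Opens} {W : X.left.Opens} (hW : W ≤ X.hom ⁻¹ᵁ U)
    (y : Γ(pullbackTo X F, W)) {p : X.left} (hp : p ∈ W) :
    ∃ (U' : S.affineOpens) (W' : X.left.Opens) (h : W' ≤ W) (h' : W' ≤ X.hom ⁻¹ᵁ U'.1),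
      U'.1 ≤ U ∧ p ∈ W' ∧ secRes (pullbackTo X F) h y ∈ pullSpan X F U'.1 W' h' := by
  let N := pullGen X F
  have hN (U : S.Opens) (x : Γ(F, U)) : pullSec X F U _ le_rfl x ∈ N.obj (X.hom ⁻¹ᵁ U) :=
    fun p hp => ⟨U, _, le_rfl, le_rfl, hp, by
      rw [secRes_rfl]
      exact Submodule.subset_span ⟨x, rfl⟩⟩
  -- The unit of the adjunction lands in the generated subsheaf. The adjoint of this factorization
  -- is a section of the inclusion, so the subsheaf is the whole pull-back.
  let g : F ⟶ (Scheme.Modules.pushforward X.hom).obj N.toModules :=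
    homOfSec (fun U =>
      { toFun := fun x => (⟨pullSec X F U _ le_rfl x, hN U x⟩ : N.obj (X.hom ⁻¹ᵁ U))
        map_add' := fun x y => Subtype.ext (map_add _ _ _)
        map_smul' := fun r x => Subtype.ext (by
          refine (pullSec_smul X F U _ le_rfl r x).trans ?_
          rw [Scheme.Hom.appLE_eq_app]
          rfl) })
      (fun {U V} h x => Subtype.ext (secRes_pullSec X le_rfl h (X.hom.preimage_mono h) le_rfl x).symm)
  have hg : pullDesc X g ≫ N.incl = 𝟙 _ := by
    refine pullback_hom_ext X fun V x => ?_
    rw [homSec_comp, homSec_pullDesc, secRes_rfl]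
    rfl
  have hy : y ∈ N.obj W := by
    have h1 : homSec N.incl W (homSec (pullDesc X g) W y) = y := by
      rw [← homSec_comp, hg]
      rfl
    rw [← h1, SubSheaf.homSec_incl]
    exact Subtype.mem _
  obtain ⟨V, W', hW', h, hpW', hm⟩ := hy p hp
  obtain ⟨U', hpU', hU'⟩ := exists_affine_mem (V := V ⊓ U) (p := X.hom p) ⟨h hpW', hW hp⟩
  have h' : W' ⊓ X.hom ⁻¹ᵁ U'.1 ≤ X.hom ⁻¹ᵁ U'.1 := inf_le_right
  refine ⟨U', W' ⊓ X.hom ⁻¹ᵁ U'.1, inf_le_left.trans hW', h', hU'.trans inf_le_right,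
    ⟨hpW', hpU'⟩, ?_⟩
  have h1 := secRes_mem_pullSpan X h (hU'.trans inf_le_left) inf_le_left h' hm
  rwa [secRes_secRes] at h1

/-- Natural families of linear forms on a pull-back are determined by their values on pulled back
sections. -/
lemma pullback_form_ext {U : S.Opens} {W : X.left.Opens} (hW : W ≤ X.hom ⁻¹ᵁ U)
    {α β : ∀ W' : X.left.Opens, W' ≤ W →
      (Γ(pullbackTo X F, W') →ₗ[Γ(X.left, W')] Γ(X.left, W'))}
    (hα : ∀ W' h y, α W' h (secRes (pullbackTo X F) h y) = fres h (α W le_rfl y))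
    (hβ : ∀ W' h y, β W' h (secRes (pullbackTo X F) h y) = fres h (β W le_rfl y))
    (H : ∀ (U' : S.affineOpens) (W' : X.left.Opens) (h : W' ≤ W) (h' : W' ≤ X.hom ⁻¹ᵁ U'.1)
      (v : Γ(F, U'.1)), U'.1 ≤ U → α W' h (pullSec X F U'.1 W' h' v) =
        β W' h (pullSec X F U'.1 W' h' v)) : α W le_rfl = β W le_rfl := by
  ext y
  choose U' W' h h' hU' hp hm using fun p : W => exists_mem_pullSpan X hW y p.2
  refine fun_ext W' h (fun p hp' => Opens.mem_iSup.2 ⟨⟨p, hp'⟩, hp ⟨p, hp'⟩⟩) fun p => ?_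
  rw [← hα, ← hβ]
  refine LinearMap.eqOn_span' ?_ (hm p)
  rintro _ ⟨v, rfl⟩
  exact H _ _ _ _ _ (hU' p)

end Pullback

/-! ### Evaluation of sections of the pull-back of a dual -/

/-- The sheaf data of functions over the intersection with a fixed open. -/
def cutData (X : Scheme.{u}) (W₀ : X.Opens) : SheafData X where
  obj W := Γ(X, W ⊓ W₀)
  module W := Module.compHom _ (fres (inf_le_left : W ⊓ W₀ ≤ W))
  res h :=
    letI (W : X.Opens) : Module Γ(X, W) Γ(X, W ⊓ W₀) :=
      Module.compHom _ (fres (inf_le_left : W ⊓ W₀ ≤ W))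
    { toFun := fres (inf_le_inf_right W₀ h)
      map_add' := map_add _
      map_smul' r x := by
        change fres _ (fres _ r * x) = fres _ (fres _ r) * fres _ x
        rw [map_mul, fres_fres, fres_fres] }
  res_rfl x := fres_rfl x
  res_res _ _ x := fres_fres _ _ x
  ext V x y h := fun_ext (fun j => V j ⊓ W₀) (fun j => inf_le_inf_right _ (le_iSup V j))
    (iSup_inf_eq V W₀).le h
  glue V x h := fun_glue (fun j => V j ⊓ W₀) (fun j => inf_le_inf_right _ (le_iSup V j))
    (iSup_inf_eq V W₀).le x fun i j => by
      have h1 := congrArg (fres (le_inf (inf_le_inf inf_le_left inf_le_left)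
        (inf_le_left.trans inf_le_right) :
          (V i ⊓ W₀) ⊓ (V j ⊓ W₀) ≤ (V i ⊓ V j) ⊓ W₀)) (h i j)
      refine Eq.trans ?_ (h1.trans ?_)
      · exact (fres_fres _ _ (x i)).symm
      · exact fres_fres _ _ (x j)

section Eval

variable (X : Over S) {E : S.Modules}

/-- The function on `X` obtained by evaluating a section of the dual. -/
def evalFun {U : S.Opens} (e : Γ(E, U)) (V : S.Opens) (v : Γ(dual E, V)) :
    Γ(X.left, X.hom ⁻¹ᵁ V ⊓ X.hom ⁻¹ᵁ U) :=
  (X.hom.appLE (V ⊓ U) (X.hom ⁻¹ᵁ V ⊓ X.hom ⁻¹ᵁ U) le_rfl).hom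
    (dualEval E v inf_le_left (secRes E inf_le_right e))

lemma fres_evalFun {U : S.Opens} (e : Γ(E, U)) {V V' : S.Opens} (v : Γ(dual E, V)) (hV : V' ≤ V)
    (hU : V' ≤ U) {W : X.left.Opens} (h : W ≤ X.hom ⁻¹ᵁ V ⊓ X.hom ⁻¹ᵁ U) (h' : W ≤ X.hom ⁻¹ᵁ V') :
    fres h (evalFun X e V v) = (X.hom.appLE V' W h').hom (dualEval E v hV (secRes E hU e)) := by
  have h1 : dualEval E v hV (secRes E hU e) =
      fres (le_inf hV hU) (dualEval E v inf_le_left (secRes E inf_le_right e)) := by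
    rw [← dualEval_res v inf_le_left, secRes_secRes]
  rw [h1, evalFun, ← CommRingCat.comp_apply, ← CommRingCat.comp_apply]
  have h2 : X.hom.appLE (V ⊓ U) (X.hom ⁻¹ᵁ V ⊓ X.hom ⁻¹ᵁ U) le_rfl ≫
      X.left.presheaf.map (homOfLE h).op =
      S.presheaf.map (homOfLE (le_inf hV hU)).op ≫ X.hom.appLE V' W h' :=
    (Scheme.Hom.appLE_map (U := V ⊓ U) X.hom le_rfl _).trans (Scheme.Hom.map_appLE _ _ _).symm
  rw [h2]

lemma evalFun_smul {U : S.Opens} (e : Γ(E, U)) (V : S.Opens) (r : Γ(S, V)) (v : Γ(dual E, V)) :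
    evalFun X e V (r • v) = fres inf_le_left (X.hom.app V r) * evalFun X e V v := by
  rw [evalFun, dualEval_smul, map_mul]
  congr 1
  have h : S.presheaf.map (homOfLE (inf_le_left : V ⊓ U ≤ V)).op ≫
      X.hom.appLE (V ⊓ U) (X.hom ⁻¹ᵁ V ⊓ X.hom ⁻¹ᵁ U) le_rfl =
      X.hom.appLE V (X.hom ⁻¹ᵁ V ⊓ X.hom ⁻¹ᵁ U) inf_le_left := Scheme.Hom.map_appLE _ _ _
  exact congrArg (fun k => k.hom r) h

lemma evalFun_secRes {U : S.Opens} (e : Γ(E, U)) {V V' : S.Opens} (h : V' ≤ V) (v : Γ(dual E, V)) :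
    evalFun X e V' (secRes _ h v) =
      fres (inf_le_inf_right _ (X.hom.preimage_mono h)) (evalFun X e V v) := by
  exact (fres_evalFun X e v (inf_le_left.trans h : V' ⊓ U ≤ V) inf_le_right _ le_rfl).symm

/-- Evaluation at a section `e`, as a morphism from the pull-back of the dual. -/
def evalHom {U : S.Opens} (e : Γ(E, U)) :
    pullbackTo X (dual E) ⟶ (cutData X.left (X.hom ⁻¹ᵁ U)).toModules :=
  -- A form over `V` and the section e over `U` can be paired only on `V ⊓ U`. The target therefore
  -- consists of functions on the part over `U`, which gives a morphism of sheaves on all of `X`.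
  pullDesc X (homOfSec (fun V =>
    { toFun := evalFun X e V
      map_add' := fun v w => (congrArg _ (dualEval_add v w inf_le_left _)).trans (map_add _ _ _)
      map_smul' := evalFun_smul X e V })
    (fun h v => evalFun_secRes X e h v))

/-- Evaluation at a section `e` of sections of the pull-back of the dual. -/
def evalAt {U : S.Opens} (e : Γ(E, U)) (W : X.left.Opens) (h : W ≤ X.hom ⁻¹ᵁ U) :
    Γ(pullbackTo X (dual E), W) →ₗ[Γ(X.left, W)] Γ(X.left, W) where
  toFun y := fres (le_inf le_rfl h) (show Γ(X.left, W ⊓ X.hom ⁻¹ᵁ U) from homSec (evalHom X e) W y)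
  map_add' y y' := (congrArg _ (map_add (homSec (evalHom X e) W) y y')).trans (map_add _ _ _)
  map_smul' r y := by
    refine (congrArg _ (map_smul (homSec (evalHom X e) W) r y)).trans ?_
    refine (map_mul (fres (le_inf le_rfl h)) (fres inf_le_left r) _).trans ?_
    rw [fres_fres, fres_rfl]
    rfl

lemma evalAt_secRes {U : S.Opens} (e : Γ(E, U)) {W W' : X.left.Opens} (h : W ≤ X.hom ⁻¹ᵁ U)
    (hW : W' ≤ W) (y : Γ(pullbackTo X (dual E), W)) :
    evalAt X e W' (hW.trans h) (secRes _ hW y) = fres hW (evalAt X e W h y) := by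
  refine (congrArg (fres (le_inf le_rfl (hW.trans h))) (homSec_secRes (evalHom X e) hW y)).trans ?_
  refine (fres_fres (inf_le_inf_right _ hW) (le_inf le_rfl (hW.trans h)) _).trans ?_
  exact (fres_fres _ _ _).symm

lemma evalAt_pullSec {U U' : S.Opens} (e : Γ(E, U)) (hU : U' ≤ U) {W : X.left.Opens}
    (h : W ≤ X.hom ⁻¹ᵁ U) (h' : W ≤ X.hom ⁻¹ᵁ U') (v : Γ(dual E, U')) :
    evalAt X e W h (pullSec X (dual E) U' W h' v) =
      (X.hom.appLE U' W h').hom (dualEval E v le_rfl (secRes E hU e)) := by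
  refine (congrArg (fres (le_inf le_rfl h)) (homSec_pullDesc X _ h' v)).trans ?_
  refine (fres_fres (inf_le_inf_right _ h') (le_inf le_rfl h) _).trans ?_
  exact fres_evalFun X e v le_rfl hU _ h'

/-- Evaluation depends only on the restriction of the section. -/
lemma evalAt_res {U U' : S.Opens} (e : Γ(E, U)) (hU : U' ≤ U) {W : X.left.Opens}
    (h : W ≤ X.hom ⁻¹ᵁ U) (h' : W ≤ X.hom ⁻¹ᵁ U') :
    evalAt X (secRes E hU e) W h' = evalAt X e W h := by
  refine pullback_form_ext X h' (α := fun W' hW => evalAt X (secRes E hU e) W' (hW.trans h'))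
    (β := fun W' hW => evalAt X e W' (hW.trans h)) (fun _ _ _ => evalAt_secRes _ _ _ _ _)
    (fun _ _ _ => evalAt_secRes _ _ _ _ _) fun V W' hW hV v hVU => ?_
  rw [evalAt_pullSec X _ hVU, evalAt_pullSec X e (hVU.trans hU), secRes_secRes]

/-- The linear form on the sections of `E` defined by a section of the pull-back of the dual. -/
def evalMap {U : S.Opens} {W : X.left.Opens} (h : W ≤ X.hom ⁻¹ᵁ U)
    (y : Γ(pullbackTo X (dual E), W)) : Γ(E, U) →ₗ[Γ(S, U)] Sec X U W h where
  toFun e := evalAt X e W h y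
  -- Linearity in e is tested on pulled back sections, where the evaluation is the pull-back of an
  -- honest value of a form; the same applies to scalars.
  map_add' e e' := LinearMap.congr_fun (pullback_form_ext X h
    (α := fun W' hW => evalAt X (e + e') W' (hW.trans h))
    (β := fun W' hW => evalAt X e W' (hW.trans h) + evalAt X e' W' (hW.trans h))
    (fun _ _ _ => evalAt_secRes _ _ _ _ _)
    (fun _ _ _ => by
      rw [LinearMap.add_apply, LinearMap.add_apply, map_add, evalAt_secRes, evalAt_secRes])
    fun V W' hW hV v hVU => by
      rw [LinearMap.add_apply, evalAt_pullSec X _ hVU, evalAt_pullSec X _ hVU,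
        evalAt_pullSec X _ hVU, map_add, map_add, map_add]) y
  map_smul' r e := by
    refine Eq.trans ?_ (Algebra.smul_def r (show Sec X U W h from evalAt X e W h y)).symm
    refine LinearMap.congr_fun (pullback_form_ext X h
      (α := fun W' hW => evalAt X (r • e) W' (hW.trans h))
      (β := fun W' hW => (X.hom.appLE U W' (hW.trans h)).hom r • evalAt X e W' (hW.trans h))
      (fun _ _ _ => evalAt_secRes _ _ _ _ _) (fun W' hW y => ?_) fun V W' hW hV v hVU => ?_) y
    · rw [LinearMap.smul_apply, LinearMap.smul_apply, evalAt_secRes X e h, smul_eq_mul, smul_eq_mul,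
        map_mul]
      congr 1
      change _ = (X.hom.appLE U W h ≫ X.left.presheaf.map _).hom r
      rw [Scheme.Hom.appLE_map X.hom h]
    · rw [LinearMap.smul_apply, evalAt_pullSec X _ hVU, evalAt_pullSec X _ hVU, secRes_smul,
        map_smul, smul_eq_mul, smul_eq_mul, map_mul]
      congr 1
      change (S.presheaf.map _ ≫ X.hom.appLE _ _ _).hom r = _
      rw [Scheme.Hom.map_appLE]

end Eval

/-! ### The pull-back of the dual of a vector bundle -/

/-- A quasi-coherent sheaf with finite projective sections on affine opens. -/
structure IsFiniteProjective (E : S.Modules) : Prop where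
  isQuasicoherent : E.IsQuasicoherent
  finite (U : S.affineOpens) : Module.Finite Γ(S, U.1) Γ(E, U.1)
  projective (U : S.affineOpens) : Module.Projective Γ(S, U.1) Γ(E, U.1)

section PullbackDual

variable (X : Over S) {E : S.Modules} (hE : IsFiniteProjective E)

lemma tensorToPullback_tmul {F : S.Modules} {U : S.Opens} {W : X.left.Opens} (h : W ≤ X.hom ⁻¹ᵁ U)
    (a : Sec X U W h) (v : Γ(F, U)) :
    tensorToPullback X F U W h (a ⊗ₜ v) = (show Γ(X.left, W) from a) • pullSec X F U W h v := rfl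

include hE in
lemma evalAt_tensorToPullback {U U' : S.affineOpens} (hU : U'.1 ≤ U.1) (e : Γ(E, U.1))
    {W : X.left.Opens} (h : W ≤ X.hom ⁻¹ᵁ U.1) (h' : W ≤ X.hom ⁻¹ᵁ U'.1)
    (z : Sec X U'.1 W h' ⊗[Γ(S, U'.1)] Γ(dual E, U'.1)) :
    evalAt X e W h (tensorToPullback X (dual E) U'.1 W h' z) =
      ev (formEquiv hE.isQuasicoherent U').toLinearMap (Sec X U'.1 W h') z (secRes E hU e) := by
  induction z with
  | zero => simp; rfl
  | add x y hx hy => rw [map_add, map_add, map_add, LinearMap.add_apply, hx, hy]; rfl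
  | tmul a v =>
    rw [tensorToPullback_tmul, map_smul, evalAt_pullSec X e hU, ev_tmul, Algebra.smul_def, mul_comm]
    rfl

include hE in
lemma evalMap_tensorToPullback (U : S.affineOpens) {W : X.left.Opens} (h : W ≤ X.hom ⁻¹ᵁ U.1)
    (z : Sec X U.1 W h ⊗[Γ(S, U.1)] Γ(dual E, U.1)) :
    evalMap X h (tensorToPullback X (dual E) U.1 W h z) =
      ev (formEquiv hE.isQuasicoherent U).toLinearMap (Sec X U.1 W h) z := by
  ext e
  refine (evalAt_tensorToPullback X hE le_rfl e h h z).trans ?_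
  rw [secRes_rfl]

lemma exists_tensorToPullback {F : S.Modules} {U : S.Opens} {W : X.left.Opens}
    (h : W ≤ X.hom ⁻¹ᵁ U) {y : Γ(pullbackTo X F, W)} (hy : y ∈ pullSpan X F U W h) :
    ∃ z, tensorToPullback X F U W h z = y := by
  induction hy using Submodule.span_induction with
  | zero => exact ⟨0, map_zero _⟩
  | mem x hx =>
    obtain ⟨v, rfl⟩ := hx
    exact ⟨1 ⊗ₜ v, one_smul Γ(X.left, W) (pullSec X F U W h v)⟩
  | add x y _ _ hx hy =>
    obtain ⟨z, rfl⟩ := hx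
    obtain ⟨z', rfl⟩ := hy
    exact ⟨z + z', map_add _ _ _⟩
  | smul a x _ hx =>
    obtain ⟨z, hz⟩ := hx
    refine ⟨(LinearMap.mulLeft Γ(S, U) (show Sec X U W h from a)).rTensor _ z, ?_⟩
    rw [← hz]
    clear hz
    induction z with
    | zero => simp
    | add x y hx hy => rw [map_add, map_add, map_add, smul_add, hx, hy]
    | tmul b v =>
      rw [LinearMap.rTensor_tmul, tensorToPullback_tmul, tensorToPullback_tmul, ← mul_smul]
      rfl

include hE in
/-- A section of the pull-back of the dual is determined by its evaluations. -/
lemma evalMap_injective (U : S.affineOpens) {W : X.left.Opens} (h : W ≤ X.hom ⁻¹ᵁ U.1)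
    {y y' : Γ(pullbackTo X (dual E), W)} (H : evalMap X h y = evalMap X h y') : y = y' := by
  choose U' W' hW' h' hU' hp hm using fun p : W => exists_mem_pullSpan X h (y - y') p.2
  refine sec_ext _ W' hW' (fun p hp' => Opens.mem_iSup.2 ⟨⟨p, hp'⟩, hp ⟨p, hp'⟩⟩) fun p => ?_
  obtain ⟨z, hz⟩ := exists_tensorToPullback X (h' p) (hm p)
  have := hE.finite (U' p)
  have := hE.projective (U' p)
  have hL (U : S.affineOpens) : LocalizesOn E U.1 :=
    have := hE.isQuasicoherent
    localizesOn_of_isQuasicoherent E U.2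
  have hz0 : z = 0 := by
    apply ev_ext (formEquiv hE.isQuasicoherent (U' p))
    refine LinearMap.congr_fun (linearMap_ext_secRes (hL U) (hL (U' p)) (hU' p) fun e => ?_)
    rw [map_zero, LinearMap.zero_apply]
    refine (evalAt_tensorToPullback X hE (hU' p) e ((hW' p).trans h) (h' p) z).symm.trans ?_
    rw [hz, evalAt_secRes X e h, map_sub]
    have h1 : evalAt X e W h y = evalAt X e W h y' := LinearMap.congr_fun H e
    rw [h1, sub_self, map_zero]
    rfl
  rw [hz0, map_zero, map_sub] at hz
  exact (sub_eq_zero.1 hz.symm)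

-- By finite projectivity ψ comes from a tensor in 𝒪(W) ⊗ E^∨(U), and such a tensor maps to the
-- pull-back.
include hE in
lemma exists_evalMap (U : S.affineOpens) {W : X.left.Opens} (h : W ≤ X.hom ⁻¹ᵁ U.1)
    (ψ : Γ(E, U.1) →ₗ[Γ(S, U.1)] Sec X U.1 W h) :
    ∃ y : Γ(pullbackTo X (dual E), W), evalMap X h y = ψ := by
  have := hE.finite U
  have := hE.projective U
  refine ⟨tensorToPullback X (dual E) U.1 W h ((evEquiv _ (formEquiv hE.isQuasicoherent U)).symm ψ),
    ?_⟩
  rw [evalMap_tensorToPullback X hE, ev_evEquiv_symm]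

include hE in
/-- A section is a combination of finitely many sections, with evaluations as coefficients. -/
lemma exists_sum_evalAt (U : S.affineOpens) {W : X.left.Opens} (h : W ≤ X.hom ⁻¹ᵁ U.1) :
    ∃ (n : ℕ) (e : Fin n → Γ(E, U.1)) (q : Fin n → Γ(pullbackTo X (dual E), W)),
      ∀ (W' : X.left.Opens) (hW : W' ≤ W) (y : Γ(pullbackTo X (dual E), W')),
        y = ∑ j, evalAt X (e j) W' (hW.trans h) y • secRes _ hW (q j) := by
  have := hE.finite U
  have := hE.projective U
  obtain ⟨n, e, e', he⟩ := exists_dual_basis (R := Γ(S, U.1)) (M := Γ(E, U.1))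
  let κ := formEquiv hE.isQuasicoherent U
  -- The q_j are the pull-backs of the dual basis, and m = ∑ e'_j(m) e_j becomes the asserted
  -- expansion.
  refine ⟨n, e, fun j => pullSec X _ U.1 W h (κ.symm (e' j)), fun W' hW y => ?_⟩
  apply evalMap_injective X hE U (hW.trans h)
  ext m
  change evalAt X m W' (hW.trans h) y = evalAt X m W' (hW.trans h) _
  rw [map_sum]
  have h1 : evalMap X (hW.trans h) y m = _ := congrArg (evalMap X (hW.trans h) y) (he m).symm
  refine h1.trans ?_
  rw [map_sum]
  refine Finset.sum_congr rfl fun j _ => ?_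
  rw [map_smul, map_smul, secRes_pullSec X h le_rfl hW (hW.trans h), secRes_rfl,
    evalAt_pullSec X m le_rfl, secRes_rfl]
  have h2 : dualEval E (κ.symm (e' j)) le_rfl m = e' j m := by
    rw [← formEquiv_apply hE.isQuasicoherent, LinearEquiv.apply_symm_apply]
  rw [h2, Algebra.smul_def, smul_eq_mul, mul_comm]
  rfl

lemma exists_common_exponent {n : ℕ} {P : Fin n → ℕ → Prop} (hP : ∀ j k m, P j k → P j (k + m))
    (h : ∀ j, ∃ k, P j k) : ∃ N, ∀ j, P j N := by
  choose k hk using h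
  refine ⟨∑ j, k j, fun j => ?_⟩
  rw [← Finset.add_sum_erase _ _ (Finset.mem_univ j)]
  exact hP _ _ _ (hk j)

-- The expansion in the q_j has evaluations as coefficients, and these are compatible with
-- restriction; so torsion and lifting reduce to functions on the affine open `W`.
include hE in
lemma localizesOn_pullback_dual (U : S.affineOpens) {W : X.left.Opens} (hW : IsAffineOpen W)
    (h : W ≤ X.hom ⁻¹ᵁ U.1) : LocalizesOn (pullbackTo X (dual E)) W := by
  intro f
  obtain ⟨n, e, q, hq⟩ := exists_sum_evalAt X hE U h
  obtain ⟨ht, hl⟩ := fres_basicOpen_of_qcqs hW.isCompact hW.isQuasiSeparated f rfl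
    (X.left.basicOpen_le f)
  constructor
  · intro y hy
    obtain ⟨N, hN⟩ := exists_common_exponent
      (P := fun (j : Fin n) k => f ^ k * evalAt X (e j) W h y = 0)
      (fun j k m hk => by rw [pow_add, mul_right_comm, hk, zero_mul])
      (fun j => ht _ (by rw [← evalAt_secRes, hy, map_zero]))
    refine ⟨N, ?_⟩
    rw [hq W le_rfl y, Finset.smul_sum]
    refine Finset.sum_eq_zero fun j _ => ?_
    rw [← mul_smul, hN, zero_smul]
  · intro y
    have hD := (X.left.basicOpen_le f).trans h
    obtain ⟨N, hN⟩ := exists_common_exponent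
      (P := fun (j : Fin n) k => ∃ a, fres (X.left.basicOpen_le f) a =
        fres (X.left.basicOpen_le f) f ^ k * evalAt X (e j) _ hD y)
      (fun j k m ⟨a, ha⟩ => ⟨f ^ m * a, by rw [map_mul, ha, map_pow, pow_add]; ring⟩)
      (fun j => hl _)
    choose a ha using hN
    refine ⟨N, ∑ j, a j • q j, ?_⟩
    rw [map_sum]
    conv_rhs => rw [hq _ (X.left.basicOpen_le f) y, Finset.smul_sum]
    refine Finset.sum_congr rfl fun j _ => ?_
    rw [secRes_smul, ha, mul_smul]

lemma exists_affine_over (x : X.left) :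
    ∃ (U : S.affineOpens) (W : X.left.affineOpens), x ∈ W.1 ∧ W.1 ≤ X.hom ⁻¹ᵁ U.1 := by
  obtain ⟨U, hU, -⟩ := exists_affine_mem (V := (⊤ : S.Opens)) (p := X.hom x) trivial
  obtain ⟨W, hxW, hW⟩ := exists_affine_mem (V := X.hom ⁻¹ᵁ U.1) (p := x) hU
  exact ⟨U, W, hxW, hW⟩

include hE in
lemma isQuasicoherent_pullback_dual : (pullbackTo X (dual E)).IsQuasicoherent :=
  isQuasicoherent_of_cover _ fun x => by
    obtain ⟨U, W, hxW, hW⟩ := exists_affine_over X x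
    exact ⟨W, hxW, localizesOn_pullback_dual X hE U W.2 hW⟩

include hE in
lemma finite_pullback_dual (W : X.left.affineOpens) :
    Module.Finite Γ(X.left, W.1) Γ(pullbackTo X (dual E), W.1) := by
  have hqc := isQuasicoherent_pullback_dual X hE
  refine finite_of_cover (fun U => localizesOn_of_isQuasicoherent _ U.2) (fun x => ?_) W
  obtain ⟨U, W, hxW, hW⟩ := exists_affine_over X x
  obtain ⟨n, e, q, hq⟩ := exists_sum_evalAt X hE U hW
  refine ⟨W, hxW, ⟨Submodule.fg_def.2 ⟨Set.range q, Set.finite_range q, eq_top_iff.2 fun y _ => ?_⟩⟩⟩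
  rw [hq W.1 le_rfl y]
  refine Submodule.sum_mem _ fun j _ => Submodule.smul_mem _ _ (Submodule.subset_span ⟨j, ?_⟩)
  rw [secRes_rfl]

variable (h : E ⟶ coordSheaf X)

/-- The linear map on sections defined by a morphism to the functions on `X`. -/
def funMap (U : S.Opens) : Γ(E, U) →ₗ[Γ(S, U)] Coord X U :=
  (coordSec X U).toLinearMap ∘ₗ homSec h U

lemma funMap_secRes {U V : S.Opens} (hV : V ≤ U) (e : Γ(E, U)) :
    funMap X h V (secRes E hV e) = coordRes X hV (funMap X h U e) := by
  change coordSec X V (homSec h V _) = coordRes X hV (coordSec X U (homSec h U e))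
  rw [homSec_secRes, coordSec_secRes]

include hE in
lemma evalMap_secRes_eq {U V : S.affineOpens} (hV : V.1 ≤ U.1)
    {y : Γ(pullbackTo X (dual E), X.hom ⁻¹ᵁ U.1)} (hy : evalMap X le_rfl y = funMap X h U.1) :
    evalMap X le_rfl (secRes _ (X.hom.preimage_mono hV) y) = funMap X h V.1 := by
  have hL (U : S.affineOpens) : LocalizesOn E U.1 :=
    have := hE.isQuasicoherent
    localizesOn_of_isQuasicoherent E U.2
  refine linearMap_ext_secRes (hL U) (hL V) hV fun e => ?_
  rw [funMap_secRes]
  change evalAt X (secRes E hV e) _ le_rfl _ = _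
  rw [evalAt_res X e hV (X.hom.preimage_mono hV), evalAt_secRes X e le_rfl]
  exact congrArg (fres _) (LinearMap.congr_fun hy e)

-- The intersection U ∩ V need not be affine. Over each affine open inside it, both sections
-- represent the restriction of `h`, so they agree because a section is determined by its
-- evaluations.
include hE in
lemma secRes_eq_of_evalMap_eq {U V : S.affineOpens}
    {y : Γ(pullbackTo X (dual E), X.hom ⁻¹ᵁ U.1)} {y' : Γ(pullbackTo X (dual E), X.hom ⁻¹ᵁ V.1)}
    (hy : evalMap X le_rfl y = funMap X h U.1) (hy' : evalMap X le_rfl y' = funMap X h V.1) :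
    secRes _ (inf_le_left : X.hom ⁻¹ᵁ U.1 ⊓ X.hom ⁻¹ᵁ V.1 ≤ X.hom ⁻¹ᵁ U.1) y =
      secRes _ (inf_le_right : X.hom ⁻¹ᵁ U.1 ⊓ X.hom ⁻¹ᵁ V.1 ≤ X.hom ⁻¹ᵁ V.1) y' := by
  choose A hA hAUV using fun x : {x : X.left // X.hom x ∈ U.1 ⊓ V.1} => exists_affine_mem x.2
  have hAU (x) := (hAUV x).trans inf_le_left
  have hAV (x) := (hAUV x).trans inf_le_right
  refine sec_ext _ (fun x => X.hom ⁻¹ᵁ (A x).1)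
    (fun x => le_inf (X.hom.preimage_mono (hAU x)) (X.hom.preimage_mono (hAV x))) (fun x hx =>
      Opens.mem_iSup.2 ⟨⟨x, hx⟩, hA ⟨x, hx⟩⟩) fun x => ?_
  rw [secRes_secRes, secRes_secRes]
  exact evalMap_injective X hE (A x) le_rfl ((evalMap_secRes_eq X hE h (hAU x) hy).trans
    (evalMap_secRes_eq X hE h (hAV x) hy').symm)

include hE in
/-- A morphism from `E` to the functions on `X` defines a section of the pull-back of the dual. -/
theorem exists_section : ∃ s : Γ(pullbackTo X (dual E), ⊤), ∀ (U : S.affineOpens) (e : Γ(E, U.1))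
    (W : X.left.Opens) (hW : W ≤ X.hom ⁻¹ᵁ U.1),
    evalAt X e W hW (secRes _ le_top s) = fres hW (funMap X h U.1 e) := by
  choose y hy using fun U : S.affineOpens => exists_evalMap X hE U le_rfl (funMap X h U.1)
  obtain ⟨s, hs⟩ := sec_glue (pullbackTo X (dual E)) (U := ⊤)
    (fun U : S.affineOpens => X.hom ⁻¹ᵁ U.1) (fun _ => le_top)
    (fun x _ => by
      obtain ⟨U, hU, -⟩ := exists_affine_mem (V := (⊤ : S.Opens)) (p := X.hom x) trivial
      exact Opens.mem_iSup.2 ⟨U, hU⟩) y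
    (fun U V => secRes_eq_of_evalMap_eq X hE h (hy U) (hy V))
  refine ⟨s, fun U e W hW => ?_⟩
  have h1 : secRes (pullbackTo X (dual E)) (le_top : W ≤ ⊤) s = secRes _ hW (y U) := by
    rw [← hs U, secRes_secRes]
  rw [h1, evalAt_secRes X e le_rfl]
  exact congrArg (fres hW) (LinearMap.congr_fun (hy U) e)

end PullbackDual

/-! ### The zero locus -/

/-- A morphism factors through a closed subscheme if and only if its kernel contains the ideal
sheaf; for an affine target both are determined by their global sections. -/
lemma exists_lift_subscheme_iff {X Y : Scheme.{u}} [IsAffine X] (I : Ideal Γ(X, ⊤)) (f : Y ⟶ X) :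
    (∃ l : Y ⟶ (Scheme.IdealSheafData.ofIdealTop I).subscheme,
      l ≫ (Scheme.IdealSheafData.ofIdealTop I).subschemeι = f) ↔ ∀ a ∈ I, f.appTop a = 0 := by
  have key : Scheme.IdealSheafData.ofIdealTop I ≤ f.ker ↔ ∀ a ∈ I, f.appTop a = 0 := by
    rw [Scheme.ker_of_isAffine]
    exact map_le_map_iff Scheme.IdealSheafData.equivOfIsAffine.symm
  rw [← key]
  constructor
  · rintro ⟨l, rfl⟩
    conv_lhs => rw [← Scheme.IdealSheafData.ker_subschemeι (Scheme.IdealSheafData.ofIdealTop I)]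
    exact Scheme.Hom.le_ker_comp _ _
  · intro h
    have h' : (Scheme.IdealSheafData.ofIdealTop I).subschemeι.ker ≤ f.ker := by
      rwa [Scheme.IdealSheafData.ker_subschemeι]
    exact ⟨_, IsClosedImmersion.lift_fac _ f h'⟩

section ZeroLocus

variable {X : Over S} [IsAffine X.left] {E : S.Modules} (hE : IsFiniteProjective E)

/-- The affine open given by the whole scheme. -/
abbrev topAff (X : Scheme.{u}) [IsAffine X] : X.affineOpens := ⟨⊤, isAffineOpen_top X⟩

include hE in
/-- After multiplication by a power of `f`, evaluations over `D(f)` extend to linear forms. -/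
lemma exists_form [IsLocallyNoetherian X.left] {U : S.Opens} (e : Γ(E, U)) (f : Γ(X.left, ⊤))
    (hf : X.left.basicOpen f ≤ X.hom ⁻¹ᵁ U) :
    ∃ (n : ℕ) (φ : Γ(pullbackTo X (dual E), ⊤) →ₗ[Γ(X.left, ⊤)] Γ(X.left, ⊤)), ∀ y,
      fres (X.left.basicOpen_le f) (φ y) = fres (X.left.basicOpen_le f) f ^ n *
        evalAt X e _ hf (secRes _ (X.left.basicOpen_le f) y) := by
  have : IsNoetherianRing Γ(X.left, ⊤) := IsLocallyNoetherian.component_noetherian (topAff X.left)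
  have : Module.Finite Γ(X.left, ⊤) Γ(pullbackTo X (dual E), ⊤) :=
    finite_pullback_dual X hE (topAff X.left)
  have := Module.finitePresentation_of_finite Γ(X.left, ⊤) Γ(pullbackTo X (dual E), ⊤)
  let := (fres (X.left.basicOpen_le f)).toAlgebra
  have hloc : IsLocalization.Away f Γ(X.left, X.left.basicOpen f) :=
    isLocalization_fres (isAffineOpen_top X.left) f
  let g : Γ(pullbackTo X (dual E), ⊤) →ₗ[Γ(X.left, ⊤)] Γ(X.left, X.left.basicOpen f) :=
    { toFun := fun y => evalAt X e _ hf (secRes _ (X.left.basicOpen_le f) y)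
      map_add' := fun y y' => by rw [map_add, map_add]
      map_smul' := fun r y => by
        rw [secRes_smul, map_smul, RingHom.id_apply, Algebra.smul_def]
        rfl }
  -- The global sections of the pull-back form a finitely presented module, so a linear map from
  -- them into a localization comes, up to a power of f, from one into the ring itself.
  obtain ⟨φ, ⟨_, n, rfl⟩, hφ⟩ := Module.FinitePresentation.exists_lift_of_isLocalizedModule
    (.powers f) (Algebra.linearMap Γ(X.left, ⊤) Γ(X.left, X.left.basicOpen f)) g
  refine ⟨n, φ, fun y => ?_⟩
  refine (LinearMap.congr_fun hφ y).trans ?_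
  change f ^ n • g y = _
  rw [Algebra.smul_def, map_pow]
  rfl

lemma appLE_fres {Y : Scheme.{u}} {X : Scheme.{u}} (t : Y ⟶ X) (a : Γ(X, ⊤)) {W : X.Opens} :
    (t.appLE W (t ⁻¹ᵁ W) le_rfl).hom (fres le_top a) = fres le_top (t.appTop a) := by
  change (X.presheaf.map _ ≫ t.appLE _ _ _).hom a = (t.appLE ⊤ _ le_top).hom a
  rw [Scheme.Hom.map_appLE]

lemma isUnit_appLE_fres {Y X : Scheme.{u}} (t : Y ⟶ X) (f : Γ(X, ⊤)) :
    IsUnit ((t.appLE (X.basicOpen f) (t ⁻¹ᵁ X.basicOpen f) le_rfl).hom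
      (fres (X.basicOpen_le f) f)) :=
  (RingedSpace.isUnit_res_basicOpen X.toRingedSpace f).map _

variable (h : E ⟶ coordSheaf X) {s : Γ(pullbackTo X (dual E), ⊤)}
  (hs : ∀ (U : S.affineOpens) (e : Γ(E, U.1)) (W : X.left.Opens) (hW : W ≤ X.hom ⁻¹ᵁ U.1),
    evalAt X e W hW (secRes _ le_top s) = fres hW (funMap X h U.1 e))

include hE hs in
/-- The points of the zero locus of the section defined by `h`. -/
lemma zeroIdeal_iff [IsLocallyNoetherian X.left] {Y : Over S} (t : Y ⟶ X) :
    (∀ a ∈ zeroIdeal (pullbackTo X (dual E)) s, t.left.appTop a = 0) ↔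
      ∀ (U : S.affineOpens) (e : Γ(E, U.1)), pullCoord t U.1 (funMap X h U.1 e) = 0 := by
  constructor
  · intro H U e
    have hloc (y : {y : Y.left // Y.hom y ∈ U.1}) : ∃ f : Γ(X.left, ⊤),
        t.left y.1 ∈ X.left.basicOpen f ∧ X.left.basicOpen f ≤ X.hom ⁻¹ᵁ U.1 :=
      exists_basicOpen_mem (isAffineOpen_top X.left) le_top (preimage_le t _ y.2)
    choose f hyf hf using hloc
    refine fun_ext (S := Y.left) (fun y => t.left ⁻¹ᵁ X.left.basicOpen (f y))
      (fun y => le_of_over t (hf y) le_rfl) (fun y hy => Opens.mem_iSup.2 ⟨⟨y, hy⟩, hyf ⟨y, hy⟩⟩)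
      fun y => ?_
    -- Evaluation at e becomes a global linear form after multiplication by a power of f. That form
    -- takes s into the zero ideal, and f is invertible on the open of `Y` considered.
    obtain ⟨n, φ, hφ⟩ := exists_form hE e (f y) (hf y)
    have h1 := H (φ s) (Ideal.subset_span ⟨φ, rfl⟩)
    have h2 := hφ s
    rw [hs] at h2
    have h3 := congrArg (t.left.appLE _ (t.left ⁻¹ᵁ X.left.basicOpen (f y)) le_rfl).hom h2
    rw [appLE_fres, h1, map_zero, map_mul, map_pow] at h3
    have h4 := ((isUnit_appLE_fres t.left (f y)).pow n).mul_right_eq_zero.1 h3.symm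
    have h5 := pull_res t le_rfl le_rfl (preimage_le t _) (hf y) (le_of_over t (hf y) le_rfl) le_rfl
      (funMap X h U.1 e)
    exact h5.symm.trans (h4.trans (map_zero _).symm)
  · intro H
    have key : zeroIdeal (pullbackTo X (dual E)) s ≤ RingHom.ker t.left.appTop.hom := by
      rw [zeroIdeal, Ideal.span_le]
      rintro _ ⟨φ, rfl⟩
      change t.left.appTop.hom (φ s) = 0
      have hqc := isQuasicoherent_pullback_dual X hE
      have hL := localizesOn_of_isQuasicoherent (pullbackTo X (dual E)) (isAffineOpen_top X.left)
      have hloc (y : Y.left) : ∃ (U : S.affineOpens) (f : Γ(X.left, ⊤)),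
          t.left y ∈ X.left.basicOpen f ∧ X.left.basicOpen f ≤ X.hom ⁻¹ᵁ U.1 := by
        obtain ⟨U, hU, -⟩ := exists_affine_mem (V := (⊤ : S.Opens)) (p := X.hom (t.left y)) trivial
        exact ⟨U, exists_basicOpen_mem (V := X.hom ⁻¹ᵁ U.1) (isAffineOpen_top X.left) le_top hU⟩
      choose U f hyf hf using hloc
      refine fun_ext (S := Y.left) (fun y => t.left ⁻¹ᵁ X.left.basicOpen (f y))
        (fun y => le_top) (fun y _ => Opens.mem_iSup.2 ⟨y, hyf y⟩) fun y => ?_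
      rw [map_zero, ← appLE_fres]
      -- Over D(f) the section s is a combination of the q_j with coefficients h(e_j), which vanish
      -- along t; hence so should φ(s).
      obtain ⟨n, e, q, hq⟩ := exists_sum_evalAt X hE (U y) (hf y)
      have hsum := hq _ le_rfl (secRes _ le_top s)
      let T : Γ(X.left, X.left.basicOpen (f y)) →+* Γ(Y.left, t.left ⁻¹ᵁ X.left.basicOpen (f y)) :=
        (t.left.appLE _ _ le_rfl).hom
      have hT (j : Fin n) : T (evalAt X (e j) _ (hf y) (secRes _ le_top s)) = 0 := by
        rw [hs]
        have h5 := pull_res t le_rfl le_rfl (preimage_le t _) (hf y)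
          (le_of_over t (hf y) le_rfl) le_rfl (funMap X h (U y).1 (e j))
        exact h5.trans ((congrArg (fres _) (H (U y) (e j))).trans (map_zero _))
      obtain ⟨N, hN⟩ := exists_common_exponent
        (P := fun (j : Fin n) k => ∃ b, secRes _ (X.left.basicOpen_le (f y)) b =
          fres (X.left.basicOpen_le (f y)) (f y) ^ k • secRes (pullbackTo X (dual E)) le_rfl (q j))
        (fun j k m ⟨a, ha⟩ => ⟨f y ^ m • a, by
          rw [secRes_smul, ha, map_pow, ← mul_smul, ← pow_add, add_comm]⟩)
        (fun j => (hL (f y)).lift _)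
      choose b hb using hN
      obtain ⟨ht, hl⟩ := fres_basicOpen_of_qcqs (isAffineOpen_top X.left).isCompact
        (isAffineOpen_top X.left).isQuasiSeparated (f y) rfl (X.left.basicOpen_le (f y))
      obtain ⟨M, hM⟩ := exists_common_exponent
        (P := fun (j : Fin n) k => ∃ c, fres (X.left.basicOpen_le (f y)) c =
          fres (X.left.basicOpen_le (f y)) (f y) ^ k *
            evalAt X (e j) _ (hf y) (secRes _ le_top s))
        (fun j k m ⟨a, ha⟩ => ⟨f y ^ m * a, by rw [map_mul, ha, map_pow, pow_add]; ring⟩)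
        (fun j => hl _)
      choose c hc using hM
      -- φ is defined only on global sections, so the expansion of s is globalized: M clears the
      -- denominators of the coefficients, N those of the q_j, and L removes the remaining torsion.
      -- All three powers of f become invertible along t.
      obtain ⟨L, hL'⟩ := (hL (f y)).torsion (f y ^ (M + N) • s - ∑ j, c j • b j) (by
        rw [map_sub, sub_eq_zero, map_sum, secRes_smul]
        conv_lhs => rw [hsum, Finset.smul_sum]
        refine Finset.sum_congr rfl fun j _ => ?_
        rw [secRes_smul, hc, hb, ← mul_smul, ← mul_smul, map_pow, pow_add]
        congr 1
        ring)
      have h1 := congrArg φ hL'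
      rw [map_smul, map_sub, map_smul, map_sum, map_zero, smul_sub, sub_eq_zero] at h1
      have h2 := congrArg (fun a => T (fres (X.left.basicOpen_le (f y)) a)) h1
      simp only [map_smul, smul_eq_mul, map_mul, map_sum, hc, hT, mul_zero, zero_mul,
        Finset.sum_const_zero, map_pow] at h2
      have hu : IsUnit (T (fres (X.left.basicOpen_le (f y)) (f y))) := isUnit_appLE_fres t.left (f y)
      exact (hu.pow _).mul_right_eq_zero.1 ((hu.pow _).mul_right_eq_zero.1 h2)
    exact fun a ha => key ha

end ZeroLocus

/-! ### Equivariance of the section -/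

lemma EquivModule.IsVectorBundle.isFiniteProjective [IsLocallyNoetherian S] {G : Over S} [GrpObj G]
    [IsAffineHom G.hom] {E : EquivModule G} (hE : E.IsVectorBundle) : IsFiniteProjective E.sheaf :=
  ⟨E.isQuasicoherent, hE.finite, hE.projective⟩

/-- Restriction of functions to an open subset. -/
abbrev coordToSec (X : Over S) (U : S.Opens) (W : X.left.Opens) (hW : W ≤ X.hom ⁻¹ᵁ U) :
    Coord X U →ₐ[Γ(S, U)] Sec X U W hW := pull (𝟙 X) U le_rfl hW hW

lemma productMap_lTensor {R A B B' Q : Type*} [CommRing R] [CommRing A] [Algebra R A] [CommRing B]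
    [Algebra R B] [CommRing B'] [Algebra R B'] [CommRing Q] [Algebra R Q] (g : A →ₐ[R] Q)
    (p : B' →ₐ[R] Q) (k : B →ₐ[R] B') (w : A ⊗[R] B) :
    Algebra.TensorProduct.productMap g p (k.toLinearMap.lTensor A w) =
      Algebra.TensorProduct.productMap g (p.comp k) w := by
  induction w with
  | zero => simp
  | add x y hx hy => simp only [map_add, hx, hy]
  | tmul a b => simp

/-- The section defined by an equivariant morphism to the functions on `X` is equivariant. -/
lemma isEquivariantSection [IsLocallyNoetherian S] {G X : Over S} [GrpObj G] [IsAffineHom G.hom]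
    [Flat G.hom] [ModObj G X] [IsAffine X.left] [IsNoetherian X.left] {E : EquivModule G}
    (hE : E.IsVectorBundle) {h : E.sheaf ⟶ coordSheaf X}
    (hh : EquivModule.IsEquivariantHom E (funModule G X) h) {s : Γ(pullbackTo X (dual E.sheaf), ⊤)}
    (hs : ∀ (U : S.affineOpens) (e : Γ(E.sheaf, U.1)) (W : X.left.Opens) (hW : W ≤ X.hom ⁻¹ᵁ U.1),
      evalAt X e W hW (secRes _ le_top s) = fres hW (funMap X h U.1 e)) :
    IsEquivariantSection (EquivModule.dualModule hE) X s := by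
  intro U W W' hW hW' z z' hz hz' Y hY hY'
  have := hE.finite U
  have := hE.projective U
  -- Any tensor representing s over `W` evaluates to `h` followed by restriction to `W`, so the
  -- choice of representatives does not matter.
  have key (W : X.left.Opens) (hW : W ≤ X.hom ⁻¹ᵁ U.1)
      (z : Sec X U.1 W hW ⊗[Γ(S, U.1)] Γ(dual E.sheaf, U.1))
      (hz : tensorToPullback X (dual E.sheaf) U.1 W hW z = secRes _ le_top s) :
      ev (E.dualForm U).toLinearMap _ z =
        (coordToSec X U.1 W hW).toLinearMap ∘ₗ funMap X h U.1 := by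
    rw [← evalMap_tensorToPullback X hE.isFiniteProjective U hW z, hz]
    ext e
    refine (hs U e W hW).trans ?_
    exact (pull_id le_rfl hW hW _).symm
  have hYU : Y.1 ≤ (G ⊗ X).hom ⁻¹ᵁ U.1 := le_of_over (act G X) hW hY
  -- The identity becomes formal: it is enough that h(m), pulled back along the action, is the value
  -- of the coaction of m, which is the equivariance of `h`.
  refine twist_eq (E.dualForm U) (E.coassoc U) (E.counit_coact U) (antipode_mul_id U)
    (pull (act G X) U.1 hW hYU hY) (pull (fst G X) U.1 le_rfl hYU (hYU.trans (preimage_le _ U.1)))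
    (pull (snd G X) U.1 hW' hYU hY') _ _ (fun m => ?_) z z' (key W.1 hW z hz) (key W'.1 hW' z' hz')
  have h1 : funCoact' G X U (funMap X h U.1 m) =
      (funMap X h U.1).lTensor (Coord G U.1) (E.coact U m) := hh U m
  have h2 := productMap_funCoact_open (G := G) U (isCompact_preimage X U.1)
    (isQuasiSeparated_preimage X U.1) (fst G X) (snd G X) hYU (funMap X h U.1 m)
  have h3 : funCoact G X U (isCompact_preimage X U.1) (isQuasiSeparated_preimage X U.1)
      (funMap X h U.1 m) = (funMap X h U.1).lTensor (Coord G U.1) (E.coact U m) := h1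
  rw [h3, lift_fst_snd, Category.id_comp] at h2
  rw [LinearMap.comp_apply, AlgHom.toLinearMap_apply, LinearMap.lTensor_comp, LinearMap.comp_apply,
    productMap_lTensor]
  have restrict {V : X.left.Opens} (hV : V ≤ X.hom ⁻¹ᵁ U.1) {k : G ⊗ X ⟶ X} (hk : Y.1 ≤ k.left ⁻¹ᵁ V)
      (x : Coord X U.1) : pull k U.1 hV hYU hk (coordToSec X U.1 V hV x) =
        pull k U.1 le_rfl hYU (hYU.trans (preimage_le k U.1)) x :=
    (pull_pull k (𝟙 X) le_rfl hV hV hYU hk (hYU.trans (preimage_le _ U.1)) x).trans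
      (pull_congr (Category.comp_id _) _ _ _ _ _)
  rw [show (pull (snd G X) U.1 hW' hYU hY').comp (coordToSec X U.1 W'.1 hW') =
    pull (snd G X) U.1 le_rfl hYU (hYU.trans (preimage_le _ U.1)) from AlgHom.ext (restrict hW' hY')]
  exact (restrict hW hY _).trans h2.symm

end GeomConc

end

/-! ### The main theorem -/

theorem mainTheorem1 {S : Scheme.{u}} [IsNoetherian S]
    (T : Over S) [IsAffine T.left] [IsNoetherian T.left] (hT : GeomConc.IsQuasiAffineHom T.hom)
    (G : Over S) [GrpObj G] [IsAffineHom G.hom] [Flat G.hom] [LocallyOfFiniteType G.hom]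
    (hG : GeomConc.IsLinearlyReductive G) (hGres : GeomConc.HasResolutionProperty G)
    (C : Over S) [GrpObj C] [IsAffineHom C.hom] [Flat C.hom] [LocallyOfFiniteType C.hom]
    (i : C ⟶ G) [IsMonHom.Normal i] [IsClosedImmersion i.left]
    (hC : GeomConc.IsLinearlyReductive C) (hCproj : GeomConc.IsLocallyProjective C)
    (X : Over S) [IsAffine X.left] [IsNoetherian X.left] [ModObj G X]
    (p : X ⟶ T) (hp : GeomConc.act G X ≫ p = snd G X ≫ p) :
    ∃ E : GeomConc.EquivModule G, E.IsVectorBundle ∧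
      (∀ U : S.affineOpens, E.fixedSections i U = ⊥) ∧ E.FixedLocusIsZero i ∧
      ∃ s : Γ(GeomConc.pullbackTo X E.sheaf, ⊤),
        GeomConc.IsEquivariantSection E X s ∧
        GeomConc.IsFixedLocus i (GeomConc.zeroLocus (GeomConc.pullbackTo X E.sheaf) s) := by
  obtain ⟨ρ, hρ⟩ := hC.exists_retraction
  obtain ⟨E, h, hE, hh, hr, hfix⟩ := GeomConc.exists_bundle_fixed (X := X) i hρ hGres
  obtain ⟨s, hs⟩ := GeomConc.exists_section X hE.isFiniteProjective h
  have hr' := GeomConc.EquivModule.rey_dualModule hE i hρ hr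
  refine ⟨GeomConc.EquivModule.dualModule hE, GeomConc.EquivModule.isVectorBundle_dualModule hE,
    fun U => GeomConc.EquivModule.fixedSections_eq_bot i hρ U (hr' U),
    GeomConc.EquivModule.fixedLocusIsZero i hρ hr', s,
    GeomConc.isEquivariantSection hE hh hs, fun Y t => ?_⟩
  -- A point is fixed if and only if it kills the functions coming from E, if and only if it kills
  -- the zero ideal of s, if and only if it factors through the zero locus.
  exact (hfix Y t).trans ((GeomConc.zeroIdeal_iff hE.isFiniteProjective h hs t).symm.trans
    (GeomConc.exists_lift_subscheme_iff _ t.left).symm)
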